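/- **Systems.** Consider the continuous Hahn (cH), Wilson (W) and Askey–Wilson (AW) systems with parameters $\boldsymbol\lambda=(\lambda_1,\dots,\lambda_4)\in\mathbb C^4$ (and $0<q<1$ for AW). Put $a_k=\lambda_k$ for cH, W and $a_k=q^{\lambda_k}$ for AW, and write $\sigma=\lambda_1+\lambda_2+\lambda_3+\lambda_4$. Let $\eta(x)=x,\ x^2,\ \cos x$; $\gamma=1,1,\log q$; $\kappa=1,1,q^{-1}$; $\varphi(x)=1,\ 2x,\ 2\sin x$ (in the order cH, W, AW), and $$V(x)=(a_1+ix)(a_2+ix),\qquad \frac{\prod_k(a_k+ix)}{2ix(2ix+1)},\qquad \frac{\prod_k(1-a_ke^{ix})}{(1-e^{2ix})(1-qe^{2ix})},$$ $V^*(x)=(a_3-ix)(a_4-ix)$ for cH and $V^*(x)=V(-x)$ for W, AW (this is $\overline{V(\bar x)}$ under the usual reality conditions $\lambda_3=\bar\lambda_1,\lambda_4=\bar\lambda_2$ for cH, $\{\bar\lambda_k\}=\{\lambda_k\}$ for W, AW). Let $\mathcal E_n=n(n+\sigma-1)$ for cH, W and $\mathcal E_n=(q^{-n}-1)(1-q^{\sigma+n-1})$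 for AW, and let $\check P_n(x;\boldsymbol\lambda)=P_n(\eta(x))$ be the continuous Hahn, Wilson, Askey–Wilson polynomials $$\tfrac{i^n(a_1+a_3,a_1+a_4)_n}{n!}\,{}_3F_2\!\left({-n,\,n+\sigma-1,\,a_1+ix\atop a_1+a_3,\,a_1+a_4}\Big|1\right),$$ $$(a_1+a_2,a_1+a_3,a_1+a_4)_n\,{}_4F_3\!\left({-n,\,n+\sigma-1,\,a_1+ix,\,a_1-ix\atop a_1+a_2,\,a_1+a_3,\,a_1+a_4}\Big|1\right),$$ $$a_1^{-n}(a_1a_2,a_1a_3,a_1a_4;q)_n\,{}_4\phi_3\!\left({q^{-n},\,a_1a_2a_3a_4q^{n-1},\,a_1e^{ix},\,a_1e^{-ix}\atop a_1a_2,\,a_1a_3,\,a_1a_4}\Big|q;q\right)$$ (with $(c)_n/(c)_k$ read as $(c+k)_{n-k}$, and similarly for $q$). **Virtual states.** There are two types I, II. The pair of parameters $(\lambda_k,\lambda_l)$ attached to type I, II is $(\lambda_1,\lambda_3)$, $(\lambda_2,\lambda_4)$ for cH and $(\lambda_1,\lambda_2)$, $(\lambda_3,\lambda_4)$ for W, AW.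 The twist $\mathfrak t^t(\boldsymbol\lambda)$ of type $t$ replaces the pair $(\lambda_k,\lambda_l)$ of $t$ by $(1-\lambda_l,1-\lambda_k)$ for cH and by $(1-\lambda_k,1-\lambda_l)$ for W, AW. A virtual state of degree $\mathrm v$ and type $t$ has $\check\xi_{\mathrm v}(x)=\check P_{\mathrm v}(x;\mathfrak t^t(\boldsymbol\lambda))$ and energy $\tilde{\mathcal E}_{\mathrm v}=-(u-\mathrm v-1)(w+\mathrm v)$ for cH, W, $\tilde{\mathcal E}_{\mathrm v}=-(1-q^{u-\mathrm v-1})(1-q^{w+\mathrm v})$ for AW, where $u$ and $w$ are the sums of the pairs of $t$ and of the other type. Let $\alpha^t=1$ for cH, W and $\alpha^t=q^{u-1}$ for AW; for AW a power $(\alpha^t)^s$ means $q^{s(u-1)}$, and $\sqrt{\alpha^{\rm I}\alpha^{\rm II}}:=(\alpha^{\rm I})^{1/2}(\alpha^{\rm II})^{1/2}=q^{(\sigma-2)/2}$. Let $\boldsymbol\delta=(\frac12,\frac12,\frac12,\frac12)$, and let $\tilde{\boldsymbol\delta}^t$ have the entries $-\frac12$ at the pair of $t$ and $\frac12$ elsewhere.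 **Multi-indexed polynomials.** For $x\in\mathbb C$ and $N\ge0$ put $x_j^{(N)}=x+i(\frac{N+1}2-j)\gamma$. Let $\Pi^{t}_{s;m,n}(x)$ be $(\lambda_k+s+ix)_m(\lambda_l+s-ix)_n$ for cH, $\prod_{h\in\{k,l\}}(\lambda_h+s+ix)_m(\lambda_h+s-ix)_n$ for W, and $\prod_{h\in\{k,l\}}(q^{\lambda_h+s}e^{ix};q)_m(q^{\lambda_h+s}e^{-ix};q)_n$ for AW, where $(\lambda_k,\lambda_l)$ is the pair of $t$. Put $$r^t_j(x;N)=(\alpha^t)^{-\frac{N-1}2}\kappa^{-(j-1)(N-j)}\,\epsilon_j\,\Pi^t_{-\frac{N-1}2;\,j-1,\,N-j}(x),\qquad \epsilon_j=i^{2j-1-N},\ 1,\ e^{ix(N+1-2j)},$$ $$\varphi_N(x)=\varphi(x)^{[N/2]}\prod_{k=1}^{N-2}\bigl(\varphi(x-\tfrac{ik\gamma}2)\varphi(x+\tfrac{ik\gamma}2)\bigr)^{[(N-k)/2]},$$ $$A_{N;m_1,m_2}(x)=\prod_{j=1}^{m_1}c^{\rm II}_j\,\Pi^{\rm II}_{-\frac{N-1}2;j,j}(x)\prod_{j=1}^{m_2}c^{\rm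 I}_j\,\Pi^{\rm I}_{-\frac{N-1}2;j,j}(x),$$ with $c^t_j=1$ for cH, W and $c^t_j=q^{-j(\lambda_k+\lambda_l)+j(j+1)/2}$ for AW. For a finite ordered set $\mathcal D=\{d_1,\dots,d_M\}$ of distinct virtual states (each with its degree and type), $M_{\rm I}$ of type I and $M_{\rm II}$ of type II, let $\bar t$ denote the type other than $t$, $t_k$ the type of $d_k$, and $$\check\Xi_{\mathcal D}(x;\boldsymbol\lambda)=\frac{i^{M(M-1)/2}\det\bigl(r_j^{\bar t_k}(x;M)\,\check\xi_{d_k}(x_j^{(M)})\bigr)_{1\le j,k\le M}}{\varphi_M(x)\,A_{M;\max(M_{\rm I}-1,0),\max(M_{\rm II}-1,0)}(x)},$$ $$\check P_{\mathcal D,n}(x;\boldsymbol\lambda)=\frac{i^{M(M+1)/2}\det\bigl(\,r_j^{\bar t_k}(x;M{+}1)\check\xi_{d_k}(x_j^{(M+1)})\,\big|\,r_j^{\rm I}r_j^{\rm II}(x;M{+}1)\check P_n(x_j^{(M+1)})\bigr)_{1\le j\le M+1}}{\varphi_{M+1}(x)\,A_{M+1;M_{\rm I},M_{\rm II}}(x)},$$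 the last determinant having the columns $k=1,\dots,M$ and one more column. (These functions are polynomials $\Xi_{\mathcal D}$, $P_{\mathcal D,n}$ in $\eta(x)$.) With $\boldsymbol\lambda_{\mathcal D}=\boldsymbol\lambda+M_{\rm I}\tilde{\boldsymbol\delta}^{\rm I}+M_{\rm II}\tilde{\boldsymbol\delta}^{\rm II}$, let $$\widetilde{\mathcal H}_{\mathcal D}f(x)=\sum_{\pm}V^{\pm}(x;\boldsymbol\lambda_{\mathcal D})\frac{\check\Xi_{\mathcal D}(x\pm i\frac\gamma2;\boldsymbol\lambda)}{\check\Xi_{\mathcal D}(x\mp i\frac\gamma2;\boldsymbol\lambda)}\Bigl(f(x\mp i\gamma)-\frac{\check\Xi_{\mathcal D}(x\mp i\gamma;\boldsymbol\lambda+\boldsymbol\delta)}{\check\Xi_{\mathcal D}(x;\boldsymbol\lambda+\boldsymbol\delta)}f(x)\Bigr),\qquad V^+=V,\ V^-=V^*.$$ **Proposition.** Let $n\ge0$, let $\mathcal D=\{d_1,\dots,d_M\}$ ($M\ge0$) be as above, let $d',d''\notin\mathcal D$ be virtual states with $d'\ne d''$, and let $\mathcal D'=\{d_1,\dots,d_M,d'\}$,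 $\mathcal D''=\{d_1,\dots,d_M,d''\}$, $\mathcal D'''=\{d_1,\dots,d_M,d',d''\}$. (1) If $d'$ and $d''$ are of the same type, then $$(\mathcal E_n-\tilde{\mathcal E}_{d'})\Bigl(\frac{\check\Xi_{\mathcal D'}(x-i\frac\gamma2)}{\check\Xi_{\mathcal D''}(x-i\frac\gamma2)}+\frac{\check\Xi_{\mathcal D'}(x+i\frac\gamma2)}{\check\Xi_{\mathcal D''}(x+i\frac\gamma2)}\Bigr)\check P_{\mathcal D'',n}(x)=(\widetilde{\mathcal H}_{\mathcal D''}+\mathcal E_n-\tilde{\mathcal E}_{d'}-\tilde{\mathcal E}_{d''})\check P_{\mathcal D',n}(x).$$ (2) If $d'$ and $d''$ are of different types, then $$\kappa^{2M+\frac32}\sqrt{\alpha^{\rm I}\alpha^{\rm II}}\Bigl(\frac{\check\Xi_{\mathcal D}(x-i\frac\gamma2)}{\check\Xi_{\mathcal D'''}(x-i\frac\gamma2)}+\frac{\check\Xi_{\mathcal D}(x+i\frac\gamma2)}{\check\Xi_{\mathcal D'''}(x+i\frac\gamma2)}\Bigr)\check P_{\mathcal D''',n}(x)=(\widetilde{\mathcal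 H}_{\mathcal D'''}+\mathcal E_n-\tilde{\mathcal E}_{d'}-\tilde{\mathcal E}_{d''})\check P_{\mathcal D,n}(x).$$ Both identities hold for every $x\in\mathbb C$ at which no denominator vanishes, the denominators of the quotients that define $\check\Xi$, $\check P$ and $V$ included. If moreover polynomials in $\eta$ are given that represent the functions $\check\Xi$ and $\check P$ involved, then, with these polynomials in place of the quotients, the identities hold for every $x\in\mathbb C$ at which the denominators of $V(x)$, $V^*(x)$ and those displayed in the identity and in $\widetilde{\mathcal H}$ do not vanish. -/

import Mathlib

open Complex Polynomial

/-- The three systems: continuous Hahn, Wilson, Askey-Wilson. -/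
inductive Kind
  | cH
  | W
  | AW

/-- The two types (I and II) of virtual states. -/
inductive VType
  | one
  | two
  deriving DecidableEq

/-- The other type. -/
def VType.other : VType → VType
  | .one => .two
  | .two => .one

/-- A virtual state label: its degree together with its type. -/
abbrev Label := ℕ × VType

/-- A system is given by its kind, the parameter `q` (which plays a role in the Askey-Wilson case
only) and the four parameters `λ₁, …, λ₄`.  The usual parameters are `a_k = λ_k` for the continuous
Hahn and Wilson systems, and `a_k = q ^ λ_k` for the Askey-Wilson system. -/
structure System where
  kind : Kind
  q : ℝ
  lam : Fin 4 → ℂ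

noncomputable section

namespace System

/-- The shift `γ`. -/
def gam (S : System) : ℂ :=
  match S.kind with
  | .cH => 1
  | .W => 1
  | .AW => (Real.log S.q : ℂ)

/-- The sinusoidal coordinate `η(x)`. -/
def eta (S : System) (x : ℂ) : ℂ :=
  match S.kind with
  | .cH => x
  | .W => x ^ 2
  | .AW => Complex.cos x

/-- The auxiliary function `φ(x)`; up to a constant,
`η(x - iγ/2) - η(x + iγ/2)`. -/
def phi (S : System) (x : ℂ) : ℂ :=
  match S.kind with
  | .cH => 1
  | .W => 2 * x
  | .AW => 2 * Complex.sin x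

/-- `κ = 1` (continuous Hahn, Wilson), `κ = q⁻¹` (Askey-Wilson). -/
def kappa (S : System) : ℝ :=
  match S.kind with
  | .cH => 1
  | .W => 1
  | .AW => S.q⁻¹

/-- The elementary factor `b + ix` (continuous Hahn, Wilson) or `1 - q ^ b e^{ix}`
(Askey-Wilson). -/
def lin (S : System) (b x : ℂ) : ℂ :=
  match S.kind with
  | .cH => b + I * x
  | .W => b + I * x
  | .AW => 1 - (S.q : ℂ) ^ b * Complex.exp (I * x)

/-- The shifted factorial `(b + ix)_n` (continuous Hahn, Wilson) or
`(q ^ b e^{ix}; q)_n` (Askey-Wilson). -/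
def poch (S : System) (b x : ℂ) (n : ℕ) : ℂ :=
  ∏ i ∈ Finset.range n, S.lin (b + i) x

/-- The potential function `V(x)`. -/
def V (S : System) (x : ℂ) : ℂ :=
  match S.kind with
  | .cH => S.lin (S.lam 0) x * S.lin (S.lam 1) x
  | .W => (∏ k, S.lin (S.lam k) x) / (2 * I * x * (2 * I * x + 1))
  | .AW => (∏ k, S.lin (S.lam k) x) /
      ((1 - Complex.exp (2 * I * x)) * (1 - (S.q : ℂ) * Complex.exp (2 * I * x)))

/-- The potential function `V*(x)`, in the form that makes sense for arbitrary complex parameters.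
See `Vstar_eq_conj` for its agreement with the `*`-operation when the parameters satisfy the
reality conditions. -/
def Vstar (S : System) (x : ℂ) : ℂ :=
  match S.kind with
  | .cH => S.lin (S.lam 2) (-x) * S.lin (S.lam 3) (-x)
  | .W => S.V (-x)
  | .AW => S.V (-x)

/-- If the parameters satisfy the reality conditions, then `Vstar` is the `*`-image of `V`, i.e.
the function `x ↦ conj (V (conj x))`. -/
theorem Vstar_eq_conj (S : System) (hq : 0 < S.q)
    (h : match S.kind with
      | .cH => S.lam 2 = starRingEnd ℂ (S.lam 0) ∧ S.lam 3 = starRingEnd ℂ (S.lam 1)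
      | .W => ∃ σ : Equiv.Perm (Fin 4), ∀ k, starRingEnd ℂ (S.lam k) = S.lam (σ k)
      | .AW => ∃ σ : Equiv.Perm (Fin 4), ∀ k, starRingEnd ℂ (S.lam k) = S.lam (σ k))
    (x : ℂ) : S.Vstar x = starRingEnd ℂ (S.V (starRingEnd ℂ x)) := by
  have hlin : ∀ b : ℂ, starRingEnd ℂ (S.lin b (starRingEnd ℂ x))
      = S.lin (starRingEnd ℂ b) (-x) := by
    intro b
    have hpow : starRingEnd ℂ ((S.q : ℂ) ^ b) = (S.q : ℂ) ^ (starRingEnd ℂ b) := by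
      have h0 : (S.q : ℂ) ≠ 0 := by exact_mod_cast hq.ne'
      rw [Complex.cpow_def_of_ne_zero h0, Complex.cpow_def_of_ne_zero h0, ← Complex.exp_conj,
        ← Complex.ofReal_log hq.le]
      simp
    rcases hk : S.kind with _ | _ | _
    · simp [lin, hk]
    · simp [lin, hk]
    · simp [lin, hk, hpow, ← Complex.exp_conj]
  rcases hk : S.kind with _ | _ | _
  · simp only [hk] at h
    simp [Vstar, V, hk, hlin, h.1, h.2]
  · simp only [hk] at h
    obtain ⟨σ, hσ⟩ := h
    have h2 : starRingEnd ℂ 2 = 2 := map_ofNat _ 2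
    simp only [Vstar, V, hk, map_div₀, map_prod, hlin, hσ]
    rw [Equiv.prod_comp σ (fun k => S.lin (S.lam k) (-x))]
    simp [h2]
  · simp only [hk] at h
    obtain ⟨σ, hσ⟩ := h
    have h2 : starRingEnd ℂ 2 = 2 := map_ofNat _ 2
    simp only [Vstar, V, hk, map_div₀, map_prod, hlin, hσ]
    rw [Equiv.prod_comp σ (fun k => S.lin (S.lam k) (-x))]
    simp [← Complex.exp_conj, h2]

/-- The denominator of `V(x)`. -/
def Vden (S : System) (x : ℂ) : ℂ :=
  match S.kind with
  | .cH => 1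
  | .W => 2 * I * x * (2 * I * x + 1)
  | .AW => (1 - Complex.exp (2 * I * x)) * (1 - (S.q : ℂ) * Complex.exp (2 * I * x))

/-- The energy eigenvalue `E_n`: `n (n + λ₁ + ⋯ + λ₄ - 1)` (continuous Hahn, Wilson) or
`(q^{-n} - 1)(1 - a₁a₂a₃a₄ q^{n-1})` (Askey-Wilson). -/
def energy (S : System) (n : ℕ) : ℂ :=
  match S.kind with
  | .cH => n * (n + (∑ k, S.lam k) - 1)
  | .W => n * (n + (∑ k, S.lam k) - 1)
  | .AW => ((S.q : ℂ) ^ (-(n : ℂ)) - 1) * (1 - (S.q : ℂ) ^ ((∑ k, S.lam k) + n - 1))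

/-- The polynomial eigenfunction `P_n(η(x))`: the continuous Hahn, Wilson and Askey-Wilson
polynomials
`i^n (a₁+a₃)_n (a₁+a₄)_n / n! · ₃F₂(-n, n+a₁+a₂+a₃+a₄-1, a₁+ix; a₁+a₃, a₁+a₄; 1)`,
`(a₁+a₂)_n (a₁+a₃)_n (a₁+a₄)_n
  · ₄F₃(-n, n+a₁+a₂+a₃+a₄-1, a₁+ix, a₁-ix; a₁+a₂, a₁+a₃, a₁+a₄; 1)`,
`a₁^{-n} (a₁a₂, a₁a₃, a₁a₄; q)_n
  · ₄φ₃(q^{-n}, a₁a₂a₃a₄q^{n-1}, a₁e^{ix}, a₁e^{-ix}; a₁a₂, a₁a₃, a₁a₄; q, q)`.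
The quotients `(c)_n / (c)_k` are written as `(c+k)_{n-k}`, so that no division by zero occurs. -/
def P (S : System) (n : ℕ) (x : ℂ) : ℂ :=
  match S.kind with
  | .cH => I ^ n / (n.factorial : ℂ) * ∑ k ∈ Finset.range (n + 1),
      S.poch (-n) 0 k * S.poch (n + (∑ m, S.lam m) - 1) 0 k * S.poch (S.lam 0) x k
        / (k.factorial : ℂ)
        * (S.poch (S.lam 0 + S.lam 2 + k) 0 (n - k) * S.poch (S.lam 0 + S.lam 3 + k) 0 (n - k))
  | .W => ∑ k ∈ Finset.range (n + 1),
      S.poch (-n) 0 k * S.poch (n + (∑ m, S.lam m) - 1) 0 k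
        * (S.poch (S.lam 0) x k * S.poch (S.lam 0) (-x) k) / (k.factorial : ℂ)
        * (S.poch (S.lam 0 + S.lam 1 + k) 0 (n - k) * S.poch (S.lam 0 + S.lam 2 + k) 0 (n - k)
          * S.poch (S.lam 0 + S.lam 3 + k) 0 (n - k))
  | .AW => (S.q : ℂ) ^ (-(n : ℂ) * S.lam 0) * ∑ k ∈ Finset.range (n + 1),
      S.poch (-n) 0 k * S.poch (n + (∑ m, S.lam m) - 1) 0 k
        * (S.poch (S.lam 0) x k * S.poch (S.lam 0) (-x) k) / S.poch 1 0 k * (S.q : ℂ) ^ k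
        * (S.poch (S.lam 0 + S.lam 1 + k) 0 (n - k) * S.poch (S.lam 0 + S.lam 2 + k) 0 (n - k)
          * S.poch (S.lam 0 + S.lam 3 + k) 0 (n - k))

/-- The two parameters that are attached to a type of virtual states: `λ₁, λ₃` and `λ₂, λ₄`
for the continuous Hahn system, `λ₁, λ₂` and `λ₃, λ₄` for the Wilson and Askey-Wilson systems. -/
def pair (S : System) (t : VType) : Fin 4 × Fin 4 :=
  match S.kind, t with
  | .cH, .one => (0, 2)
  | .cH, .two => (1, 3)
  | .W, .one => (0, 1)
  | .W, .two => (2, 3)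
  | .AW, .one => (0, 1)
  | .AW, .two => (2, 3)

/-- The sum of the two parameters attached to a type. -/
def pairSum (S : System) (t : VType) : ℂ :=
  S.lam (S.pair t).1 + S.lam (S.pair t).2

/-- The twisted system: a pair `(λ_k, λ_l)` becomes `(1 - λ_l, 1 - λ_k)` for the continuous Hahn
system and `(1 - λ_k, 1 - λ_l)` for the Wilson and Askey-Wilson systems. -/
def twist (S : System) (t : VType) : System :=
  { S with
    lam := fun k =>
      if k = (S.pair t).1 then
        (match S.kind with
          | .cH => 1 - S.lam (S.pair t).2
          | .W => 1 - S.lam k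
          | .AW => 1 - S.lam k)
      else if k = (S.pair t).2 then
        (match S.kind with
          | .cH => 1 - S.lam (S.pair t).1
          | .W => 1 - S.lam k
          | .AW => 1 - S.lam k)
      else S.lam k }

/-- The virtual state polynomial `ξ_v(η(x))` of a type. -/
def xi (S : System) (d : Label) (x : ℂ) : ℂ :=
  (S.twist d.2).P d.1 x

/-- The power `α ^ s` of the constant `α` of a type; `α = 1` (continuous Hahn, Wilson) and
`α = a_k a_l q⁻¹ = q ^ (λ_k + λ_l - 1)` (Askey-Wilson), `(k, l)` being the pair of the type. -/
def alphaPow (S : System) (t : VType) (s : ℂ) : ℂ :=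
  match S.kind with
  | .cH => 1
  | .W => 1
  | .AW => (S.q : ℂ) ^ (s * (S.pairSum t - 1))

/-- The square root `√(α^I α^II)`. -/
def sqrtAlpha (S : System) : ℂ :=
  S.alphaPow .one (1 / 2) * S.alphaPow .two (1 / 2)

/-- If `λ₁ + λ₂ + λ₃ + λ₄` is real (as is the case under the reality conditions), then `sqrtAlpha`
is the principal square root of the product of the constants `α` of the two types. -/
theorem sqrtAlpha_eq (S : System) (hq : 0 < S.q) (h : (∑ k, S.lam k).im = 0) :
    S.sqrtAlpha = (S.alphaPow .one 1 * S.alphaPow .two 1) ^ (1 / 2 : ℂ) := by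
  have h0 : (S.q : ℂ) ≠ 0 := by exact_mod_cast hq.ne'
  rcases hk : S.kind with _ | _ | _
  · simp [sqrtAlpha, alphaPow, hk]
  · simp [sqrtAlpha, alphaPow, hk]
  · have hs : S.pairSum .one + S.pairSum .two = ((∑ k, S.lam k).re : ℂ) := by
      have h1 : ((∑ k, S.lam k).re : ℂ) = ∑ k, S.lam k :=
        Complex.ext (by simp) (by simp only [Complex.ofReal_im]; exact h.symm)
      rw [h1]
      simp only [pairSum, pair, hk, Fin.sum_univ_four]
      ring
    simp only [sqrtAlpha, alphaPow, hk]
    rw [← Complex.cpow_add _ _ h0, ← Complex.cpow_add _ _ h0]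
    have e1 : 1 / 2 * (S.pairSum .one - 1) + 1 / 2 * (S.pairSum .two - 1)
        = ((((∑ k, S.lam k).re - 2) * (1 / 2) : ℝ) : ℂ) := by
      push_cast
      rw [← hs]
      ring
    have e2 : 1 * (S.pairSum .one - 1) + 1 * (S.pairSum .two - 1)
        = (((∑ k, S.lam k).re - 2 : ℝ) : ℂ) := by
      push_cast
      rw [← hs]
      ring
    rw [e1, e2, ← Complex.ofReal_cpow hq.le, ← Complex.ofReal_cpow hq.le,
      Real.rpow_mul hq.le, Complex.ofReal_cpow (Real.rpow_nonneg hq.le _)]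
    norm_num

/-- The energy of a virtual state: `-(u - v - 1)(w + v)` (continuous Hahn, Wilson) and
`-(1 - q ^ (u - v - 1))(1 - q ^ (w + v))` (Askey-Wilson), where `u` and `w` are the sums of the
parameters attached to the type of the state and to the other type. -/
def virtEnergy (S : System) (d : Label) : ℂ :=
  -(S.lin (S.pairSum d.2 - d.1 - 1) 0 * S.lin (S.pairSum d.2.other + d.1) 0)

/-- The system with the parameters `λ + δ`, `δ = (1/2, 1/2, 1/2, 1/2)`. -/
def plusDelta (S : System) : System :=
  { S with lam := fun k => S.lam k + 1 / 2 }

/-- The number of labels of a type. -/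
def count {M : ℕ} (D : Fin M → Label) (t : VType) : ℕ :=
  (Finset.univ.filter fun k => (D k).2 = t).card

/-- The vector `δ̃` of a type: `-1/2` at the pair of the type, `1/2` at the other pair. -/
def deltaTilde (S : System) (t : VType) (k : Fin 4) : ℂ :=
  if k = (S.pair t).1 ∨ k = (S.pair t).2 then -1 / 2 else 1 / 2

/-- The system with the parameters `λ_D = λ + M_I δ̃^I + M_II δ̃^II`. -/
def deform (S : System) {M : ℕ} (D : Fin M → Label) : System :=
  { S with
    lam := fun k => S.lam k + count D .one * S.deltaTilde .one k
      + count D .two * S.deltaTilde .two k }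

/-- The points `x_j^{(N)} = x + i ((N+1)/2 - j) γ`, with `j = 1, …, N` represented by
`j - 1 ∈ Fin N`. -/
def node (S : System) {N : ℕ} (x : ℂ) (j : Fin N) : ℂ :=
  x + I * ((N + 1) / 2 - (j + 1)) * S.gam

/-- For the pair `(k, l)` of a type: `(λ_k + s + ix)_m (λ_l + s - ix)_n` (continuous Hahn), or the
product of `(λ + s + ix)_m (λ + s - ix)_n` over `λ = λ_k, λ_l` (Wilson), or its `q`-analogue. -/
def pairPoch (S : System) (t : VType) (s : ℂ) (m n : ℕ) (x : ℂ) : ℂ :=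
  match S.kind with
  | .cH => S.poch (S.lam (S.pair t).1 + s) x m * S.poch (S.lam (S.pair t).2 + s) (-x) n
  | .W => (S.poch (S.lam (S.pair t).1 + s) x m * S.poch (S.lam (S.pair t).1 + s) (-x) n)
      * (S.poch (S.lam (S.pair t).2 + s) x m * S.poch (S.lam (S.pair t).2 + s) (-x) n)
  | .AW => (S.poch (S.lam (S.pair t).1 + s) x m * S.poch (S.lam (S.pair t).1 + s) (-x) n)
      * (S.poch (S.lam (S.pair t).2 + s) x m * S.poch (S.lam (S.pair t).2 + s) (-x) n)

/-- The phase in `r_j`. With `j = j₀ + 1` it is `(-1)^{j-1} i^{1-N} = i^{2j-1-N}`, `1` and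
`e^{ix(N+1-2j)}`, respectively. -/
def phase (S : System) (N j₀ : ℕ) (x : ℂ) : ℂ :=
  match S.kind with
  | .cH => I ^ (2 * (j₀ : ℤ) + 1 - N)
  | .W => 1
  | .AW => Complex.exp (I * x * ((N : ℂ) - 1 - 2 * j₀))

/-- The functions `r_j(x_j^{(N)}; λ, N)` of a type. Up to a factor that does not depend on `j`, they
are the values at `x_j^{(N)}` of the ratio of the ground state wavefunctions of the system and of
the twisted system. -/
def r (S : System) (t : VType) {N : ℕ} (j : Fin N) (x : ℂ) : ℂ :=
  S.alphaPow t (-((N : ℂ) - 1) / 2) * (S.kappa : ℂ) ^ (-((j : ℤ) * ((N : ℤ) - 1 - j)))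
    * S.phase N j x * S.pairPoch t (-((N : ℂ) - 1) / 2) j (N - 1 - j) x

/-- The auxiliary function `φ_N(x)`. -/
def phiN (S : System) (N : ℕ) (x : ℂ) : ℂ :=
  S.phi x ^ (N / 2) * ∏ k ∈ Finset.Icc 1 (N - 2),
    (S.phi (x - I * k / 2 * S.gam) * S.phi (x + I * k / 2 * S.gam)) ^ ((N - k) / 2)

/-- Normalization of the factors of `normA`: `a_k^{-j} a_l^{-j} q^{j(j+1)/2}` for
the Askey-Wilson system. -/
def normC (S : System) (t : VType) (j : ℕ) : ℂ :=
  match S.kind with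
  | .cH => 1
  | .W => 1
  | .AW => (S.q : ℂ) ^ (-(j : ℂ) * S.pairSum t + (j : ℂ) * (j + 1) / 2)

/-- The common factor that is removed from the determinants of size `N`. -/
def normA (S : System) (N m₁ m₂ : ℕ) (x : ℂ) : ℂ :=
  (∏ j ∈ Finset.Icc 1 m₁, S.normC .two j * S.pairPoch .two (-((N : ℂ) - 1) / 2) j j x)
    * ∏ j ∈ Finset.Icc 1 m₂, S.normC .one j * S.pairPoch .one (-((N : ℂ) - 1) / 2) j j x

/-- The column of the determinants that belongs to a virtual state `d`:
`r_j^{other type}(x_j) ξ_d(x_j)`. -/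
def colV (S : System) {N : ℕ} (d : Label) (x : ℂ) (j : Fin N) : ℂ :=
  S.r d.2.other j x * S.xi d (S.node x j)

/-- The column of the determinants that belongs to `P_n`: `r_j^I(x_j) r_j^II(x_j) P_n(x_j)`. -/
def colP (S : System) {N : ℕ} (n : ℕ) (x : ℂ) (j : Fin N) : ℂ :=
  S.r .one j x * S.r .two j x * S.P n (S.node x j)

/-- The Casoratian `i^{M(M-1)/2} det (…)` of the virtual states of `D`, up to an elementary
factor. -/
def XiNum (S : System) {M : ℕ} (D : Fin M → Label) (x : ℂ) : ℂ :=
  I ^ (M * (M - 1) / 2) * Matrix.det (Matrix.of fun j k : Fin M => S.colV (D k) x j)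

/-- The elementary factor to be removed from `XiNum`. -/
def XiDen (S : System) {M : ℕ} (D : Fin M → Label) (x : ℂ) : ℂ :=
  S.phiN M x * S.normA M (count D .one - 1) (count D .two - 1) x

/-- The denominator polynomial `Ξ_D(η(x))` of the ordered set `D`. -/
def Xi (S : System) {M : ℕ} (D : Fin M → Label) (x : ℂ) : ℂ :=
  S.XiNum D x / S.XiDen D x

/-- The Casoratian `i^{M(M+1)/2} det (…)` of the virtual states of `D` and of `P_n`, up to an
elementary factor. -/
def PNum (S : System) {M : ℕ} (D : Fin M → Label) (n : ℕ) (x : ℂ) : ℂ :=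
  I ^ (M * (M + 1) / 2) * Matrix.det (Matrix.of fun j k : Fin (M + 1) =>
    (Fin.snoc (α := fun _ => ℂ) (fun i : Fin M => S.colV (D i) x j) (S.colP n x j) : _ → ℂ) k)

/-- The elementary factor to be removed from `PNum`. -/
def PDen (S : System) {M : ℕ} (D : Fin M → Label) (x : ℂ) : ℂ :=
  S.phiN (M + 1) x * S.normA (M + 1) (count D .one) (count D .two) x

/-- The multi-indexed polynomial `P_{D,n}(η(x))` of the ordered set `D`. -/
def PD (S : System) {M : ℕ} (D : Fin M → Label) (n : ℕ) (x : ℂ) : ℂ :=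
  S.PNum D n x / S.PDen D x

/-- The polynomial `p` is the denominator polynomial `Ξ_D(η)`. (There is at most one such `p`.) -/
def IsXiPoly (S : System) {M : ℕ} (D : Fin M → Label) (p : ℂ[X]) : Prop :=
  ∀ x : ℂ, S.XiDen D x * p.eval (S.eta x) = S.XiNum D x

/-- The polynomial `p` is the multi-indexed polynomial `P_{D,n}(η)`. (There is at most one such
`p`.) -/
def IsPDPoly (S : System) {M : ℕ} (D : Fin M → Label) (n : ℕ) (p : ℂ[X]) : Prop :=
  ∀ x : ℂ, S.PDen D x * p.eval (S.eta x) = S.PNum D n x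

/-- The polynomial `p`, considered as a function of `x` through the sinusoidal coordinate. -/
def check (S : System) (p : ℂ[X]) (x : ℂ) : ℂ := p.eval (S.eta x)

/-- The similarity transformed deformed Hamiltonian `H̃_D`, applied to `f` at `x`; here `Ξ` stands
for `Ξ_D(η(x); λ)` and `Ξδ` for `Ξ_D(η(x); λ + δ)`, and `e^{±γp} f(x) = f(x ∓ iγ)`. -/
def hamWith (S : System) {M : ℕ} (D : Fin M → Label) (Ξ Ξδ f : ℂ → ℂ) (x : ℂ) : ℂ :=
  (S.deform D).V x * (Ξ (x + I * S.gam / 2) / Ξ (x - I * S.gam / 2))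
      * (f (x - I * S.gam) - Ξδ (x - I * S.gam) / Ξδ x * f x)
    + (S.deform D).Vstar x * (Ξ (x - I * S.gam / 2) / Ξ (x + I * S.gam / 2))
      * (f (x + I * S.gam) - Ξδ (x + I * S.gam) / Ξδ x * f x)

/-- The operator `H̃_D`. -/
def ham (S : System) {M : ℕ} (D : Fin M → Label) (f : ℂ → ℂ) (x : ℂ) : ℂ :=
  S.hamWith D (S.Xi D) (S.plusDelta.Xi D) f x

end System

end

/-- The ordered set `D ∪ {d}`, with `d` in the last place. -/
def addLabel {M : ℕ} (D : Fin M → Label) (d : Label) : Fin (M + 1) → Label :=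
  Fin.snoc (α := fun _ => Label) D d

/-! ### Casoratians: cofactor expansion and two quadratic identities. -/

section Casoratian

variable {R : Type*}

/-! The proposition is an identity between Casoratians of solutions of one three-term recurrence,
read through explicit scalar factors.

Restrict all functions to a lattice `y₀ - i j γ`. After multiplication by gauge factors `theta`, the
virtual states and the eigenpolynomials become sequences `seqV` and `seqP` that solve the same
second order difference equation and differ only in the eigenvalue, `virtEnergy` or `energy`
(`isSol_seqV`, `isSol_seqP`). The source is a pair of first order shift relations for the
hypergeometric sums (`facStar_mul_P_sub`), one per type, which compose to a second order operator
(`shift_comp`). The twist exchanges the two factors of the potentials that belong to its type, so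
the same composition also yields the equation of the virtual states.

A column of the determinants that define `Xi` and `PD` is, up to a scalar, such a sequence on a
window of consecutive lattice points centred at `x`. Hence `Xi` and `PD` are multiples, by
`casScale`, of Casoratians (`Xi_cen`, `PD_cen`). The function `Ξ_D` at `λ + δ` fits in as well:
because `P_0 = 1`, row differences reduce the determinant of `P_{D,0}` to it (`PD_zero_cen`). The
constant between the two cancels in the Hamiltonian, where only ratios occur, so `seqP y₀ 0`, with
eigenvalue zero, takes its place.

What remains is `casoratian_same_type` and `casoratian_other_type`. Both follow from the
Desnanot-Jacobi identity and from `casoratian_bilinear`, the discrete form of the fact that the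
derivative of the Wronskian of two eigenfunctions is the difference of the eigenvalues times their
product. The algebra divides by a Casoratian that may vanish; the solutions are therefore deformed
(`exists_deformation`) and the identity is obtained as a limit.

The scalars are matched by relations between neighbouring windows. These turn the recurrence
coefficients into the potentials at `λ_D` (`V_mul_casScale`, `Vstar_mul_casScale`) and, for
different types, produce the constant made of `κ` and `α` (`kappa_mul_casScale_right`,
`kappa_mul_casScale_left`).

The gauge requires that no factor vanishes on the lattice. This holds after parameters and point are
moved by the same small nonzero `s`, and `s → 0` gives the identities for the quotients. The
versions with polynomials follow by a second limit, in `x` alone. -/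

/-- The ordered family `u` of sequences with `v` added in the last place. -/
def snocSeq {N : ℕ} (u : Fin N → ℕ → R) (v : ℕ → R) : Fin (N + 1) → ℕ → R :=
  Fin.snoc (α := fun _ => ℕ → R) u v

@[simp] theorem snocSeq_last {N : ℕ} (u : Fin N → ℕ → R) (v : ℕ → R) :
    snocSeq u v (Fin.last N) = v := by simp [snocSeq]

@[simp] theorem snocSeq_castSucc {N : ℕ} (u : Fin N → ℕ → R) (v : ℕ → R) (k : Fin N) :
    snocSeq u v k.castSucc = u k := by simp [snocSeq]

variable [CommRing R]

/-- The Casoratian of a family of `N` sequences on the window `a, …, a + N - 1`. -/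
def casoratian {N : ℕ} (u : Fin N → ℕ → R) (a : ℕ) : R :=
  Matrix.det (Matrix.of fun i k : Fin N => u k (a + i))

/-- The cofactors of the last column in the Casoratian of a family that extends `u` by one
sequence. -/
def casCofactor {N : ℕ} (u : Fin N → ℕ → R) (a : ℕ) (i : Fin (N + 1)) : R :=
  (-1) ^ ((i : ℕ) + N) * Matrix.det (Matrix.of fun r k : Fin N => u k (a + i.succAbove r))

theorem casoratian_snoc {N : ℕ} (u : Fin N → ℕ → R) (v : ℕ → R) (a : ℕ) :
    casoratian (snocSeq u v) a = ∑ i : Fin (N + 1), casCofactor u a i * v (a + i) := by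
  rw [casoratian, Matrix.det_succ_column _ (Fin.last N)]
  refine Finset.sum_congr rfl fun i _ => ?_
  have : (Matrix.of fun i k : Fin (N + 1) => snocSeq u v k (a + i)).submatrix i.succAbove
      (Fin.last N).succAbove = Matrix.of fun r k : Fin N => u k (a + i.succAbove r) := by
    ext r k
    simp
  rw [this, casCofactor]
  simp
  ring

theorem casCofactor_last {N : ℕ} (u : Fin N → ℕ → R) (a : ℕ) :
    casCofactor u a (Fin.last N) = casoratian u a := by
  simp [casCofactor, casoratian, ← two_mul]

theorem casCofactor_zero {N : ℕ} (u : Fin N → ℕ → R) (a : ℕ) :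
    casCofactor u a 0 = (-1) ^ N * casoratian u (a + 1) := by
  simp only [casCofactor, casoratian]
  congr 2
  · simp
  · ext r k
    simp
    ring_nf

theorem casoratian_snoc_self {N : ℕ} (u : Fin N → ℕ → R) (k : Fin N) (a : ℕ) :
    casoratian (snocSeq u (u k)) a = 0 := by
  refine Matrix.det_zero_of_column_eq (i := k.castSucc) (j := Fin.last N)
    (Fin.castSucc_lt_last k).ne fun i => ?_
  simp

/-- The Desnanot-Jacobi identity for Casoratians. -/
theorem casoratian_desnanot {N : ℕ} (u : Fin N → ℕ → R) (f h : ℕ → R) (a : ℕ) :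
    casoratian (snocSeq (snocSeq u f) h) a * casoratian u (a + 1)
      = casoratian (snocSeq u f) a * casoratian (snocSeq u h) (a + 1)
        - casoratian (snocSeq u f) (a + 1) * casoratian (snocSeq u h) a := by
  set K := snocSeq (snocSeq u f) h with hK
  set X : Matrix (Fin (N + 2)) (Fin (N + 2)) R := Matrix.of fun i k => K k (a + i) with hX
  -- The last row is replaced by the combination of rows whose coefficients are the cofactors of `u`
  -- on the window `a + 1`. Its entries are Casoratians of `u` with `K k`, which vanish when `K k`
  -- belongs to `u`, so the expansion along this row has only the terms of `f` and `h`. The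
  -- determinant itself is multiplied by the last coefficient, `casoratian u (a + 1)`.
  set c : Fin (N + 2) → R := Fin.cons 0 (casCofactor u (a + 1)) with hc
  have h1 := Matrix.det_updateRow_sum X (Fin.last (N + 1)) c
  have hrow : (∑ k, c k • X k) = fun k => casoratian (snocSeq u (K k)) (a + 1) := by
    ext k
    rw [Finset.sum_apply, Fin.sum_univ_succ, casoratian_snoc]
    simp [hc, hX]
    refine Finset.sum_congr rfl fun i _ => ?_
    ring_nf
  have hclast : c (Fin.last (N + 1)) = casoratian u (a + 1) := by
    rw [hc, ← Fin.succ_last, Fin.cons_succ, casCofactor_last]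
  rw [hrow, hclast, Matrix.det_succ_row _ (Fin.last (N + 1))] at h1
  have hsub : ∀ k : Fin (N + 2), (X.updateRow (Fin.last (N + 1))
      (fun k => casoratian (snocSeq u (K k)) (a + 1))).submatrix (Fin.last (N + 1)).succAbove
        k.succAbove = Matrix.of fun i j : Fin (N + 1) => K (k.succAbove j) (a + i) := by
    intro k
    ext i j
    simp [Matrix.updateRow_apply, hX, (Fin.castSucc_lt_last i).ne]
  simp only [hsub, Matrix.updateRow_self] at h1
  rw [Fin.sum_univ_castSucc, Fin.sum_univ_castSucc, Finset.sum_eq_zero, zero_add] at h1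
  · have e1 : (Matrix.of fun i j : Fin (N + 1) =>
        K ((Fin.last (N + 1)).succAbove j) (a + i)).det = casoratian (snocSeq u f) a := by
      simp [casoratian, hK]
    have e2 : (Matrix.of fun i j : Fin (N + 1) =>
        K ((Fin.last N).castSucc.succAbove j) (a + i)).det = casoratian (snocSeq u h) a := by
      rw [casoratian]
      congr 1
      ext i j
      refine Fin.lastCases ?_ (fun j => ?_) j
      · simp [hK]
      · have : (Fin.last N).castSucc.succAbove j.castSucc = j.castSucc.castSucc := by
          rw [Fin.succAbove_of_castSucc_lt]
          simp [Fin.lt_def]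
        simp [hK, this]
    rw [e1, e2] at h1
    have k1 : K (Fin.last (N + 1)) = h := by simp [hK]
    have k2 : K (Fin.last N).castSucc = f := by simp [hK]
    rw [k1, k2] at h1
    have hdet : casoratian K a = X.det := rfl
    rw [hdet]
    simp only [Fin.val_last, Fin.val_castSucc, smul_eq_mul] at h1
    rw [show N + 1 + (N + 1) = 2 * (N + 1) by ring, show N + 1 + N = 2 * N + 1 by ring, pow_succ,
      pow_mul, pow_mul] at h1
    simp only [even_two, Even.neg_pow, one_pow] at h1
    linear_combination -h1
  · intro k _
    have : K k.castSucc.castSucc = u k := by simp [hK]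
    rw [this, casoratian_snoc_self]
    simp

/-- The determinant of the rows `v, a, …, a + N` of a family of `N + 2` sequences, as a function
of `v`. -/
theorem det_cons_row {N : ℕ} (K : Fin (N + 2) → ℕ → R) (a : ℕ) (v : Fin (N + 2) → R) :
    Matrix.det (Matrix.of (Fin.cons v fun (i : Fin (N + 1)) k => K k (a + i)))
      = ∑ k, v k * ((-1) ^ (k : ℕ) * casoratian (fun j => K (k.succAbove j)) a) := by
  rw [Matrix.det_succ_row_zero]
  refine Finset.sum_congr rfl fun k _ => ?_
  have : (Matrix.of (Fin.cons v fun (i : Fin (N + 1)) k => K k (a + i))).submatrix Fin.succ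
      k.succAbove = Matrix.of fun i j : Fin (N + 1) => K (k.succAbove j) (a + i) := by
    ext i j
    simp
  rw [this, casoratian]
  simp
  ring

/-- Differences of Casoratians of solutions of a second order difference equation. -/
theorem casoratian_bilinear {N : ℕ} (p ps b : ℕ → R) (u : Fin N → ℕ → R) (f h : ℕ → R)
    (E : Fin N → R) (Ef Eh : R) (a : ℕ)
    (hu : ∀ k, ∀ i ≤ N, p (a + i + 1) * u k (a + i + 2) + ps (a + i + 1) * u k (a + i)
      + b (a + i + 1) * u k (a + i + 1) = E k * u k (a + i + 1))
    (hf : ∀ i ≤ N, p (a + i + 1) * f (a + i + 2) + ps (a + i + 1) * f (a + i)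
      + b (a + i + 1) * f (a + i + 1) = Ef * f (a + i + 1))
    (hh : ∀ i ≤ N, p (a + i + 1) * h (a + i + 2) + ps (a + i + 1) * h (a + i)
      + b (a + i + 1) * h (a + i + 1) = Eh * h (a + i + 1)) :
    ps (a + 1) * casoratian u (a + 2) * casoratian (snocSeq (snocSeq u f) h) a
      - p (a + N + 1) * casoratian u (a + 1) * casoratian (snocSeq (snocSeq u f) h) (a + 1)
      = (Ef - Eh) * casoratian (snocSeq u f) (a + 1) * casoratian (snocSeq u h) (a + 1) := by
  set K := snocSeq (snocSeq u f) h with hK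
  set EK : Fin (N + 2) → R := Fin.snoc (α := fun _ => R) (Fin.snoc (α := fun _ => R) E Ef) Eh
    with hEK
  have hKeq : ∀ k, ∀ i ≤ N, p (a + i + 1) * K k (a + i + 2) + ps (a + i + 1) * K k (a + i)
      + b (a + i + 1) * K k (a + i + 1) = EK k * K k (a + i + 1) := by
    intro k
    refine Fin.lastCases ?_ (fun k => ?_) k
    · simpa [hK, hEK] using hh
    · refine Fin.lastCases ?_ (fun k => ?_) k
      · simpa [hK, hEK] using hf
      · simpa [hK, hEK] using hu k
  -- `l v` is the determinant with first row `v` above the rows `a + 1, …, a + N + 1`. It kills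
  -- these rows, and on the two adjacent rows `a` and `a + N + 2` it gives, up to sign, the
  -- Casoratians of `K` at `a` and `a + 1`.
  set l : (Fin (N + 2) → R) → R := fun v =>
    ∑ k, v k * ((-1) ^ (k : ℕ) * casoratian (fun j => K (k.succAbove j)) (a + 1)) with hl
  have ldet : ∀ v, l v = Matrix.det (Matrix.of
      (Fin.cons v fun (i : Fin (N + 1)) k => K k (a + 1 + i))) := fun v =>
    (det_cons_row K (a + 1) v).symm
  have lzero : ∀ i ≤ N, l (fun k => K k (a + 1 + i)) = 0 := by
    intro i hi
    rw [ldet]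
    exact Matrix.det_zero_of_row_eq (i := 0) (j := Fin.succ ⟨i, by omega⟩)
      (Fin.succ_ne_zero _).symm rfl
  have lfirst : l (fun k => K k a) = casoratian K a := by
    rw [ldet, casoratian]
    congr 1
    ext i k
    refine Fin.cases ?_ (fun i => ?_) i
    · simp
    · simp
      ring_nf
  have llast : l (fun k => K k (a + N + 2)) = (-1) ^ (N + 1) * casoratian K (a + 1) := by
    rw [ldet, casoratian]
    have := Matrix.det_permute (finRotate (N + 2)) (Matrix.of
      (Fin.cons (fun k => K k (a + N + 2)) fun (i : Fin (N + 1)) k => K k (a + 1 + i)))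
    rw [sign_finRotate] at this
    have e : (Matrix.of (Fin.cons (fun k => K k (a + N + 2))
        fun (i : Fin (N + 1)) k => K k (a + 1 + i))).submatrix (finRotate (N + 2)) id
        = Matrix.of fun i k : Fin (N + 2) => K k (a + 1 + i) := by
      ext i k
      refine Fin.lastCases ?_ (fun i => ?_) i
      · simp
        ring_nf
      · simp [finRotate_apply]
    rw [e] at this
    rw [this]
    simp [← mul_assoc, ← mul_pow]
  have ladd : ∀ v w, l (v + w) = l v + l w := fun v w => by
    simp [hl, add_mul, Finset.sum_add_distrib]
  have lsmul : ∀ (c : R) v, l (c • v) = c * l v := fun c v => by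
    simp [hl, Finset.mul_sum, mul_assoc]
  have lrow : ∀ i ≤ N, l (fun k => EK k * K k (a + i + 1))
      = p (a + i + 1) * l (fun k => K k (a + i + 2)) + ps (a + i + 1) * l (fun k => K k (a + i)) := by
    intro i hi
    have : (fun k => EK k * K k (a + i + 1)) = p (a + i + 1) • (fun k => K k (a + i + 2))
        + ps (a + i + 1) • (fun k => K k (a + i)) + b (a + i + 1) • (fun k => K k (a + 1 + i)) := by
      ext k
      rw [← hKeq k i hi]
      simp [show a + 1 + i = a + i + 1 by ring]
    rw [this, ladd, ladd, lsmul, lsmul, lsmul, lzero i hi]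
    ring
  -- One sum, evaluated twice. Interchanging the summations leaves only the columns `f` and `h`,
  -- hence the factor `Ef - Eh`. Inserting the difference equation leaves only the boundary rows:
  -- the term `i = N` with `p` and the term `i = 0` with `ps`.
  have hsum1 : ∑ i : Fin (N + 1), casCofactor u (a + 1) i * l (fun k => EK k * K k (a + i + 1))
      = ∑ k, EK k * casoratian (snocSeq u (K k)) (a + 1)
        * ((-1) ^ (k : ℕ) * casoratian (fun j => K (k.succAbove j)) (a + 1)) := by
    simp only [hl, Finset.mul_sum, casoratian_snoc, Finset.sum_mul]
    rw [Finset.sum_comm]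
    refine Finset.sum_congr rfl fun k _ => Finset.sum_congr rfl fun i _ => ?_
    rw [show a + 1 + (i : ℕ) = a + i + 1 by ring]
    ring
  have hsum2 : ∑ i : Fin (N + 1), casCofactor u (a + 1) i * l (fun k => EK k * K k (a + i + 1))
      = casoratian u (a + 1) * (p (a + N + 1) * ((-1) ^ (N + 1) * casoratian K (a + 1)))
        + (-1) ^ N * casoratian u (a + 2) * (ps (a + 1) * casoratian K a) := by
    have : ∀ i : Fin (N + 1), casCofactor u (a + 1) i * l (fun k => EK k * K k (a + i + 1))
        = casCofactor u (a + 1) i * (p (a + i + 1) * l (fun k => K k (a + i + 2)))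
          + casCofactor u (a + 1) i * (ps (a + i + 1) * l (fun k => K k (a + i))) := by
      intro i
      rw [lrow i (by omega)]
      ring
    rw [Finset.sum_congr rfl fun i _ => this i, Finset.sum_add_distrib]
    congr 1
    · rw [Fin.sum_univ_castSucc, Finset.sum_eq_zero]
      · rw [casCofactor_last, Fin.val_last, llast]
        ring
      · intro i _
        have := lzero (i + 1) (by omega)
        rw [show a + 1 + ((i : ℕ) + 1) = a + i + 2 by ring] at this
        simp [this]
    · rw [Fin.sum_univ_succ, Finset.sum_eq_zero]
      · rw [casCofactor_zero]
        simp [lfirst]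
      · intro i _
        have := lzero i (by omega)
        rw [show a + 1 + (i : ℕ) = a + (i + 1) by ring] at this
        simp [this]
  rw [hsum1, Fin.sum_univ_castSucc, Fin.sum_univ_castSucc, Finset.sum_eq_zero, zero_add] at hsum2
  · have e1 : casoratian (fun j => K ((Fin.last (N + 1)).succAbove j)) (a + 1)
        = casoratian (snocSeq u f) (a + 1) := by
      simp [casoratian, hK]
    have e2 : casoratian (fun j => K ((Fin.last N).castSucc.succAbove j)) (a + 1)
        = casoratian (snocSeq u h) (a + 1) := by
      congr 1
      ext j
      refine Fin.lastCases ?_ (fun j => ?_) j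
      · simp [hK]
      · have : (Fin.last N).castSucc.succAbove j.castSucc = j.castSucc.castSucc := by
          rw [Fin.succAbove_of_castSucc_lt]
          simp [Fin.lt_def]
        simp [hK, this]
    rw [e1, e2] at hsum2
    simp only [hK, hEK, snocSeq_last, snocSeq_castSucc, Fin.snoc_last, Fin.snoc_castSucc,
      Fin.val_last, Fin.val_castSucc] at hsum2
    rw [← hK] at hsum2
    have hsgn : ((-1 : R) ^ N) * (-1) ^ N = 1 := by rw [← mul_pow]; simp
    rw [pow_succ] at hsum2
    linear_combination (-(-1) ^ N) * hsum2 + (p (a + N + 1) * casoratian u (a + 1) * casoratian K (a + 1)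
      - ps (a + 1) * casoratian u (a + 2) * casoratian K a + (Ef - Eh) *
      casoratian (snocSeq u f) (a + 1) * casoratian (snocSeq u h) (a + 1)) * hsgn
  · intro k _
    have : K k.castSucc.castSucc = u k := by simp [hK]
    rw [this, casoratian_snoc_self]
    simp

end Casoratian

/-! ### The two Casoratian identities under a non-degeneracy assumption. -/

section Casoratian

open Filter Topology

/-- The sequence `f` solves the second order difference equation with the coefficients `p`, `ps`,
`b` and the eigenvalue `E` at the places `1, …, J`. -/
def IsSol (p ps b : ℕ → ℂ) (J : ℕ) (E : ℂ) (f : ℕ → ℂ) : Prop :=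
  ∀ j < J, p (j + 1) * f (j + 2) + ps (j + 1) * f j + b (j + 1) * f (j + 1) = E * f (j + 1)

theorem casoratian_bilinear_of_isSol {p ps b : ℕ → ℂ} {J N : ℕ} {u : Fin N → ℕ → ℂ}
    {f h : ℕ → ℂ} {E : Fin N → ℂ} {Ef Eh : ℂ} (hu : ∀ k, IsSol p ps b J (E k) (u k))
    (hf : IsSol p ps b J Ef f) (hh : IsSol p ps b J Eh h) (a : ℕ) (ha : a + N < J) :
    ps (a + 1) * casoratian u (a + 2) * casoratian (snocSeq (snocSeq u f) h) a
      - p (a + N + 1) * casoratian u (a + 1) * casoratian (snocSeq (snocSeq u f) h) (a + 1)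
      = (Ef - Eh) * casoratian (snocSeq u f) (a + 1) * casoratian (snocSeq u h) (a + 1) :=
  casoratian_bilinear p ps b u f h E Ef Eh a (fun k i hi => hu k (a + i) (by omega))
    (fun i hi => hf (a + i) (by omega)) (fun i hi => hh (a + i) (by omega))

theorem isSol_snocSeq {p ps b : ℕ → ℂ} {J N : ℕ} {u : Fin N → ℕ → ℂ} {f : ℕ → ℂ}
    {E : Fin N → ℂ} {Ef : ℂ} (hu : ∀ k, IsSol p ps b J (E k) (u k)) (hf : IsSol p ps b J Ef f)
    (k : Fin (N + 1)) :
    IsSol p ps b J (Fin.snoc (α := fun _ => ℂ) E Ef k) (snocSeq u f k) := by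
  refine Fin.lastCases ?_ (fun k => ?_) k
  · simpa using hf
  · simpa using hu k

/-- In the application `f` and `g` are the two virtual states, `h` is the eigenfunction, and `z` is
the zero mode whose Casoratian stands for `Ξ` at `λ + δ`. Up to the factor `casoratian u 2` the
claim is a combination of the bilinear relations for `(f, h)` and for `(g, z)`, each on two
neighbouring windows, and of three Desnanot-Jacobi identities. -/
theorem casoratian_same_type_of_ne {p ps b : ℕ → ℂ} {N : ℕ} {u : Fin N → ℕ → ℂ}
    {f g h z : ℕ → ℂ} {E : Fin N → ℂ} {Ef Eg Eh : ℂ}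
    (hu : ∀ k, IsSol p ps b (N + 2) (E k) (u k)) (hf : IsSol p ps b (N + 2) Ef f)
    (hg : IsSol p ps b (N + 2) Eg g) (hh : IsSol p ps b (N + 2) Eh h)
    (hz : IsSol p ps b (N + 2) 0 z)
    (hA1 : casoratian (snocSeq u g) 1 ≠ 0) (hA2 : casoratian (snocSeq u g) 2 ≠ 0)
    (hZ : casoratian (snocSeq (snocSeq u g) z) 1 ≠ 0) (hW : casoratian u 2 ≠ 0) :
    (Eh - Ef) * (casoratian (snocSeq u f) 2 / casoratian (snocSeq u g) 2
        + casoratian (snocSeq u f) 1 / casoratian (snocSeq u g) 1)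
        * casoratian (snocSeq (snocSeq u g) h) 1
      = p (N + 2) * (casoratian (snocSeq u g) 1 / casoratian (snocSeq u g) 2)
          * (casoratian (snocSeq (snocSeq u f) h) 2
            - casoratian (snocSeq (snocSeq u g) z) 2 / casoratian (snocSeq (snocSeq u g) z) 1
              * casoratian (snocSeq (snocSeq u f) h) 1)
        + ps 1 * (casoratian (snocSeq u g) 2 / casoratian (snocSeq u g) 1)
          * (casoratian (snocSeq (snocSeq u f) h) 0
            - casoratian (snocSeq (snocSeq u g) z) 0 / casoratian (snocSeq (snocSeq u g) z) 1
              * casoratian (snocSeq (snocSeq u f) h) 1)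
        + (Eh - Ef - Eg) * casoratian (snocSeq (snocSeq u f) h) 1 := by
  have s0 := casoratian_bilinear_of_isSol hu hf hh 0 (by omega)
  have s1 := casoratian_bilinear_of_isSol hu hf hh 1 (by omega)
  have t0 := casoratian_bilinear_of_isSol hu hg hz 0 (by omega)
  have t1 := casoratian_bilinear_of_isSol hu hg hz 1 (by omega)
  have d1 := casoratian_desnanot u f h 1
  have d2 := casoratian_desnanot u g h 1
  have d3 := casoratian_desnanot u g z 1
  simp only [zero_add, show 1 + N + 1 = N + 2 by ring, Nat.reduceAdd] at s0 s1 t0 t1 d1 d2 d3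
  generalize casoratian (snocSeq u g) 1 = G1 at *
  generalize casoratian (snocSeq u g) 2 = G2 at *
  generalize casoratian (snocSeq u f) 1 = F1 at *
  generalize casoratian (snocSeq u f) 2 = F2 at *
  generalize casoratian (snocSeq u h) 1 = H1 at *
  generalize casoratian (snocSeq u h) 2 = H2 at *
  generalize casoratian (snocSeq u z) 1 = ζ1 at *
  generalize casoratian (snocSeq u z) 2 = ζ2 at *
  generalize casoratian (snocSeq (snocSeq u g) z) 0 = Z0 at *
  generalize casoratian (snocSeq (snocSeq u g) z) 1 = Z1 at *
  generalize casoratian (snocSeq (snocSeq u g) z) 2 = Z2 at *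
  generalize casoratian (snocSeq (snocSeq u f) h) 0 = Q0 at *
  generalize casoratian (snocSeq (snocSeq u f) h) 1 = Q1 at *
  generalize casoratian (snocSeq (snocSeq u f) h) 2 = Q2 at *
  generalize casoratian (snocSeq (snocSeq u g) h) 1 = T1 at *
  generalize casoratian u 1 = C1 at *
  generalize casoratian u 2 = C2 at *
  generalize casoratian u 3 = C3 at *
  generalize p (N + 1) = p1 at *
  generalize p (N + 2) = p2 at *
  generalize ps 1 = q1 at *
  generalize ps 2 = q2 at *
  field_simp
  -- The Casoratians of `u` on the windows `1` and `3` cancel between the relations for `(f, h)` and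
  -- those for `(g, z)`; everything left is divisible by the one on the window `2`.
  apply mul_left_cancel₀ hW
  linear_combination (G1 ^ 2 * Z1) * s1 - (G2 ^ 2 * Z1) * s0 - (G1 ^ 2 * Q1) * t1
    + (G2 ^ 2 * Q1) * t0 + (G1 * G2 * Eg * Q1) * d3 - ((Eh - Ef) * G1 * G2 * Z1) * d1
    + ((Eh - Ef) * Z1 * (F2 * G1 + F1 * G2)) * d2

/-- Here `f` and `g` join `u` together, and Casoratians with neither of them are compared with
Casoratians with both. The intermediate family `u, f` mediates: the bilinear relation is used for
`u` with `f, h` and for `u, f` with `g, z`, and the Casoratian of `u, f` is the factor to be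
cancelled. -/
theorem casoratian_other_type_of_ne {p ps b : ℕ → ℂ} {N : ℕ} {u : Fin N → ℕ → ℂ}
    {f g h z : ℕ → ℂ} {E : Fin N → ℂ} {Ef Eg Eh : ℂ}
    (hu : ∀ k, IsSol p ps b (N + 3) (E k) (u k)) (hf : IsSol p ps b (N + 3) Ef f)
    (hg : IsSol p ps b (N + 3) Eg g) (hh : IsSol p ps b (N + 3) Eh h)
    (hz : IsSol p ps b (N + 3) 0 z)
    (hA1 : casoratian (snocSeq (snocSeq u f) g) 1 ≠ 0)
    (hA2 : casoratian (snocSeq (snocSeq u f) g) 2 ≠ 0)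
    (hZ : casoratian (snocSeq (snocSeq (snocSeq u f) g) z) 1 ≠ 0)
    (hW : casoratian (snocSeq u f) 2 ≠ 0) :
    casoratian (snocSeq (snocSeq (snocSeq u f) g) h) 1
        * (ps 2 * casoratian u 3 / casoratian (snocSeq (snocSeq u f) g) 2
        + p (N + 2) * casoratian u 2 / casoratian (snocSeq (snocSeq u f) g) 1)
      = casoratian (snocSeq (snocSeq u f) g) 1 / casoratian (snocSeq (snocSeq u f) g) 2
          * (ps 2 * casoratian (snocSeq u h) 3
            - p (N + 3) * (casoratian (snocSeq (snocSeq (snocSeq u f) g) z) 2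
              / casoratian (snocSeq (snocSeq (snocSeq u f) g) z) 1) * casoratian (snocSeq u h) 2)
        + casoratian (snocSeq (snocSeq u f) g) 2 / casoratian (snocSeq (snocSeq u f) g) 1
          * (p (N + 2) * casoratian (snocSeq u h) 1
            - ps 1 * (casoratian (snocSeq (snocSeq (snocSeq u f) g) z) 0
              / casoratian (snocSeq (snocSeq (snocSeq u f) g) z) 1) * casoratian (snocSeq u h) 2)
        + (Eh - Ef - Eg) * casoratian (snocSeq u h) 2 := by
  have hv := isSol_snocSeq hu hf
  have s1 := casoratian_bilinear_of_isSol hu hf hh 1 (by omega)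
  have t0 := casoratian_bilinear_of_isSol hv hg hz 0 (by omega)
  have t1 := casoratian_bilinear_of_isSol hv hg hz 1 (by omega)
  have d1 := casoratian_desnanot u f h 1
  have d2 := casoratian_desnanot u f h 2
  have d3 := casoratian_desnanot (snocSeq u f) g z 1
  have d4 := casoratian_desnanot (snocSeq u f) g h 1
  simp only [zero_add, show 1 + N + 1 = N + 2 by ring, show N + 1 + 1 = N + 2 by ring,
    show 1 + (N + 1) + 1 = N + 3 by ring, Nat.reduceAdd] at s1 t0 t1 d1 d2 d3 d4
  generalize casoratian (snocSeq (snocSeq u f) g) 1 = A1 at *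
  generalize casoratian (snocSeq (snocSeq u f) g) 2 = A2 at *
  generalize casoratian (snocSeq (snocSeq u f) z) 1 = B1 at *
  generalize casoratian (snocSeq (snocSeq u f) z) 2 = B2 at *
  generalize casoratian (snocSeq u f) 1 = F1 at *
  generalize casoratian (snocSeq u f) 2 = F2 at *
  generalize casoratian (snocSeq u f) 3 = F3 at *
  generalize casoratian (snocSeq u h) 1 = H1 at *
  generalize casoratian (snocSeq u h) 2 = H2 at *
  generalize casoratian (snocSeq u h) 3 = H3 at *
  generalize casoratian (snocSeq (snocSeq (snocSeq u f) g) z) 0 = Z0 at *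
  generalize casoratian (snocSeq (snocSeq (snocSeq u f) g) z) 1 = Z1 at *
  generalize casoratian (snocSeq (snocSeq (snocSeq u f) g) z) 2 = Z2 at *
  generalize casoratian (snocSeq (snocSeq (snocSeq u f) g) h) 1 = T at *
  generalize casoratian (snocSeq (snocSeq u f) h) 1 = Q1 at *
  generalize casoratian (snocSeq (snocSeq u f) h) 2 = Q2 at *
  generalize casoratian u 2 = C2 at *
  generalize casoratian u 3 = C3 at *
  generalize p (N + 3) = p3 at *
  generalize p (N + 2) = p2 at *
  generalize ps 1 = q1 at *
  generalize ps 2 = q2 at *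
  field_simp
  apply mul_left_cancel₀ hW
  linear_combination -(A1 * A2 * Z1) * s1 - (A1 ^ 2 * H2) * t1 + (A2 ^ 2 * H2) * t0
    + (Z1 * (q2 * C3 * A1 + p2 * C2 * A2)) * d4 + (A1 * A2 * Eg * H2) * d3
    - (Z1 * p2 * A2 ^ 2) * d1 + (Z1 * q2 * A1 ^ 2) * d2

end Casoratian

/-! ### Deformation of solutions, and removal of the non-degeneracy assumption. -/

section Casoratian

open Filter Topology

/-- The solution of a second order difference equation with given values `α`, `β` at the places
`1` and `2`. -/
noncomputable def solve (p ps b : ℕ → ℂ) (E α β : ℂ) : ℕ → ℂ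
  | 0 => ((E - b 1) * α - p 1 * β) / ps 1
  | 1 => α
  | 2 => β
  | n + 3 => ((E - b (n + 2)) * solve p ps b E α β (n + 2)
      - ps (n + 2) * solve p ps b E α β (n + 1)) / p (n + 2)

theorem isSol_solve {p ps b : ℕ → ℂ} {J : ℕ} (hp : ∀ j < J, p (j + 1) ≠ 0) (hps : ps 1 ≠ 0)
    (E α β : ℂ) : IsSol p ps b J E (solve p ps b E α β) := by
  intro j hj
  rcases j with _ | j
  · simp only [solve, zero_add]
    field_simp
    ring
  · have := hp (j + 1) hj
    simp only [solve]
    field_simp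
    ring

theorem eq_solve {p ps b : ℕ → ℂ} {J : ℕ} (hp : ∀ j < J, p (j + 1) ≠ 0) (hps : ps 1 ≠ 0)
    {E : ℂ} {f : ℕ → ℂ} (hf : IsSol p ps b J E f) (hJ : 0 < J) :
    ∀ j ≤ J + 1, solve p ps b E (f 1) (f 2) j = f j
  | 0, _ => by
    have := hf 0 hJ
    simp only [solve, zero_add] at this ⊢
    field_simp
    linear_combination -this
  | 1, _ => rfl
  | 2, _ => rfl
  | n + 3, h => by
    have h1 := eq_solve hp hps hf hJ (n + 1) (by omega)
    have h2 := eq_solve hp hps hf hJ (n + 2) (by omega)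
    have := hf (n + 1) (by omega)
    have := hp (n + 1) (by omega)
    simp only [solve, h1, h2]
    field_simp
    linear_combination -hf (n + 1) (by omega)

theorem differentiable_solve {p ps b : ℕ → ℂ} {E α β : ℂ → ℂ} (hE : Differentiable ℂ E)
    (hα : Differentiable ℂ α) (hβ : Differentiable ℂ β) :
    ∀ j, Differentiable ℂ fun s => solve p ps b (E s) (α s) (β s) j
  | 0 => by
    simp only [solve]
    fun_prop
  | 1 => hα
  | 2 => hβ
  | n + 3 => by
    have h1 := differentiable_solve (p := p) (ps := ps) (b := b) hE hα hβ (n + 1)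
    have h2 := differentiable_solve (p := p) (ps := ps) (b := b) hE hα hβ (n + 2)
    simp only [solve]
    fun_prop

/-- With the values `0`, `1` at the places `1`, `2`, each step of the recursion multiplies by `E -
b` and divides by `p`, up to terms of lower degree in `E`. The product of the `p` clears the
denominators and makes the leading coefficient `1`. -/
theorem exists_monic_solve (p ps b : ℕ → ℂ) {J : ℕ} (hp : ∀ j < J, p (j + 1) ≠ 0) :
    ∀ j, j < J → ∃ Q : ℂ[X], Q.Monic ∧ Q.natDegree = j ∧ ∀ E,
      (∏ i ∈ Finset.range j, p (i + 2)) * solve p ps b E 0 1 (j + 2) = Q.eval E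
  | 0, _ => ⟨1, monic_one, natDegree_one, fun E => by simp [solve]⟩
  | 1, h => by
    refine ⟨X - C (b 2), monic_X_sub_C _, natDegree_X_sub_C _, fun E => ?_⟩
    have := hp 1 h
    simp only [solve]
    field_simp
    simp
  | j + 2, h => by
    obtain ⟨Q₀, m₀, d₀, e₀⟩ := exists_monic_solve p ps b hp j (by omega)
    obtain ⟨Q₁, m₁, d₁, e₁⟩ := exists_monic_solve p ps b hp (j + 1) (by omega)
    have hm : ((X - C (b (j + 3))) * Q₁).Monic := (monic_X_sub_C _).mul m₁
    have hd : ((X - C (b (j + 3))) * Q₁).natDegree = j + 2 := by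
      rw [(monic_X_sub_C _).natDegree_mul m₁, natDegree_X_sub_C, d₁]
      ring
    have hlt : (C (ps (j + 3) * p (j + 2)) * Q₀).natDegree
        < ((X - C (b (j + 3))) * Q₁).natDegree := by
      rw [hd]
      exact lt_of_le_of_lt (natDegree_C_mul_le _ _) (by omega)
    refine ⟨(X - C (b (j + 3))) * Q₁ - C (ps (j + 3) * p (j + 2)) * Q₀,
      hm.sub_of_left (degree_lt_degree hlt), ?_, fun E => ?_⟩
    · rw [natDegree_sub_eq_left_of_natDegree_lt hlt, hd]
    · have := hp (j + 2) h
      have := hp (j + 1) (by omega)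
      rw [eval_sub, eval_mul, eval_mul, ← e₀, ← e₁]
      simp only [solve, Finset.prod_range_succ, eval_sub, eval_X, eval_C]
      field_simp

/-- After scaling of the rows the entries are monic polynomials of degrees `0, …, m - 1` at the
points `E k`, so the determinant is that of Vandermonde. -/
theorem casoratian_solve_ne_zero (p ps b : ℕ → ℂ) {J m : ℕ} (hp : ∀ j < J, p (j + 1) ≠ 0)
    (hm : m ≤ J) {E : Fin m → ℂ} (hE : Function.Injective E) :
    casoratian (fun k => solve p ps b (E k) 0 1) 2 ≠ 0 := by
  have h := fun i : Fin m => exists_monic_solve p ps b hp i (by omega)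
  choose Q hQ hd he using h
  have hv := Matrix.det_vandermonde_ne_zero_iff.2 hE
  rw [Matrix.det_eval_matrixOfPolynomials_eq_det_vandermonde E Q hd hQ] at hv
  intro h0
  apply hv
  rw [← Matrix.det_transpose]
  have : (Matrix.of fun i j : Fin m => eval (E i) (Q j)).transpose
      = Matrix.of fun i j : Fin m => (∏ l ∈ Finset.range (i : ℕ), p (l + 2))
        * (Matrix.of fun i k : Fin m => solve p ps b (E k) 0 1 (2 + i)) i j := by
    ext i j
    simp [← he, add_comm]
  rw [this, Matrix.det_mul_column]
  rw [casoratian] at h0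
  rw [h0, mul_zero]

theorem continuous_casoratian {N : ℕ} {U : ℂ → Fin N → ℕ → ℂ}
    (hU : ∀ k j, Continuous fun s => U s k j) (a : ℕ) :
    Continuous fun s => casoratian (U s) a :=
  Continuous.matrix_det (continuous_pi fun i => continuous_pi fun k => hU k (a + i))

theorem continuous_snocSeq {N : ℕ} {U : ℂ → Fin N → ℕ → ℂ}
    (hU : ∀ k j, Continuous fun s => U s k j) (f : ℕ → ℂ) (k : Fin (N + 1)) (j : ℕ) :
    Continuous fun s => snocSeq (U s) f k j := by
  refine Fin.lastCases ?_ (fun k => ?_) k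
  · simpa using continuous_const
  · simpa using hU k j

/-- Solutions of a second order difference equation can be deformed into solutions with a
non-vanishing Casoratian. -/
theorem exists_deformation {p ps b : ℕ → ℂ} {J m : ℕ} {u : Fin m → ℕ → ℂ} {E : Fin m → ℂ}
    (hp : ∀ j < J, p (j + 1) ≠ 0) (hps : ps 1 ≠ 0) (hm : m < J)
    (hu : ∀ k, IsSol p ps b J (E k) (u k)) :
    ∃ (U : ℂ → Fin m → ℕ → ℂ) (e : ℂ → Fin m → ℂ), (∀ k j, Continuous fun s => U s k j) ∧
      (∀ k, Continuous fun s => e s k) ∧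
      (∀ s k, IsSol p ps b J (e s k) (U s k)) ∧ U 0 = u ∧ e 0 = E ∧
      ∀ᶠ s in 𝓝[≠] (0 : ℂ), casoratian (U s) 2 ≠ 0 := by
  -- A straight path of eigenvalues and initial values: `s = 0` gives the original solutions, `s =
  -- 1` the eigenvalues `0, …, m - 1` with initial values `0, 1`. The Casoratian is entire in `s`
  -- and nonzero at `s = 1` by `casoratian_solve_ne_zero`, hence its zeros are isolated.
  set e : ℂ → Fin m → ℂ := fun s k => E k + s * ((k : ℕ) - E k) with he
  set V : ℂ → Fin m → ℕ → ℂ := fun s k =>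
    solve p ps b (e s k) ((1 - s) * u k 1) (u k 2 + s * (1 - u k 2)) with hV
  have hVd : ∀ k j, Differentiable ℂ fun s => V s k j := fun k j =>
    differentiable_solve (by fun_prop) (by fun_prop) (by fun_prop) j
  -- The equation determines a solution only up to the place `J + 1`. Beyond it the values of `u`
  -- are kept, so that `U 0 = u` holds for the whole sequences.
  refine ⟨fun s k j => if j ≤ J + 1 then V s k j else u k j, e, ?_, fun k => by fun_prop,
    ?_, ?_, ?_, ?_⟩
  · intro k j
    by_cases hj : j ≤ J + 1 <;> simp only [hj, if_true, if_false]
    · exact (hVd k j).continuous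
    · exact continuous_const
  · intro s k j hj
    have := isSol_solve (b := b) hp hps (e s k) ((1 - s) * u k 1) (u k 2 + s * (1 - u k 2)) j hj
    simpa [show j + 2 ≤ J + 1 by omega, show j ≤ J + 1 by omega, show j ≤ J by omega] using this
  · ext k j
    by_cases hj : j ≤ J + 1
    · simpa [hj, hV, he] using eq_solve hp hps (hu k) (by omega) j hj
    · simp [hj]
  · simp [he]
  · have hcas : ∀ s, casoratian (fun k j => if j ≤ J + 1 then V s k j else u k j) 2
        = casoratian (V s) 2 := fun s => by
      rw [casoratian, casoratian]
      congr 1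
      ext i k
      have : 2 + (i : ℕ) ≤ J + 1 := by omega
      simp [this]
    simp only [hcas]
    have hd : Differentiable ℂ fun s => casoratian (V s) 2 := by
      simp only [casoratian, Matrix.det_apply, Matrix.of_apply]
      refine Differentiable.fun_sum fun σ _ => Differentiable.const_smul ?_ _
      exact Differentiable.fun_finsetProd fun i _ => hVd _ _
    have ha : AnalyticOnNhd ℂ (fun s => casoratian (V s) 2) Set.univ :=
      hd.differentiableOn.analyticOnNhd isOpen_univ
    by_contra hne
    have hfr : ∃ᶠ s in 𝓝[≠] (0 : ℂ), casoratian (V s) 2 = 0 :=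
      (Filter.not_eventually.1 hne).mono fun s hs => not_not.1 hs
    have hz := ha.eqOn_zero_of_preconnected_of_frequently_eq_zero isPreconnected_univ
      (Set.mem_univ 0) hfr (Set.mem_univ 1)
    refine casoratian_solve_ne_zero p ps b hp hm.le (E := fun k : Fin m => ((k : ℕ) : ℂ)) ?_ ?_
    · intro i j hij
      exact Fin.ext (Nat.cast_injective hij)
    · simpa [hV, he] using hz

theorem eq_of_eventually_eq {F G : ℂ → ℂ} (hF : ContinuousAt F 0) (hG : ContinuousAt G 0)
    (h : ∀ᶠ s in 𝓝[≠] (0 : ℂ), F s = G s) : F 0 = G 0 :=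
  tendsto_nhds_unique ((hF.tendsto.mono_left nhdsWithin_le_nhds).congr' h)
    (hG.tendsto.mono_left nhdsWithin_le_nhds)

/-- The sequences `u` are deformed until `casoratian u 2` is nonzero. The denominators stay nonzero
for small `s`, and both sides are continuous at `s = 0`. -/
theorem casoratian_same_type {p ps b : ℕ → ℂ} {N : ℕ} {u : Fin N → ℕ → ℂ}
    {f g h z : ℕ → ℂ} {E : Fin N → ℂ} {Ef Eg Eh : ℂ}
    (hp : ∀ j < N + 2, p (j + 1) ≠ 0) (hps : ps 1 ≠ 0)
    (hu : ∀ k, IsSol p ps b (N + 2) (E k) (u k)) (hf : IsSol p ps b (N + 2) Ef f)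
    (hg : IsSol p ps b (N + 2) Eg g) (hh : IsSol p ps b (N + 2) Eh h)
    (hz : IsSol p ps b (N + 2) 0 z)
    (hA1 : casoratian (snocSeq u g) 1 ≠ 0) (hA2 : casoratian (snocSeq u g) 2 ≠ 0)
    (hZ : casoratian (snocSeq (snocSeq u g) z) 1 ≠ 0) :
    (Eh - Ef) * (casoratian (snocSeq u f) 2 / casoratian (snocSeq u g) 2
        + casoratian (snocSeq u f) 1 / casoratian (snocSeq u g) 1)
        * casoratian (snocSeq (snocSeq u g) h) 1
      = p (N + 2) * (casoratian (snocSeq u g) 1 / casoratian (snocSeq u g) 2)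
          * (casoratian (snocSeq (snocSeq u f) h) 2
            - casoratian (snocSeq (snocSeq u g) z) 2 / casoratian (snocSeq (snocSeq u g) z) 1
              * casoratian (snocSeq (snocSeq u f) h) 1)
        + ps 1 * (casoratian (snocSeq u g) 2 / casoratian (snocSeq u g) 1)
          * (casoratian (snocSeq (snocSeq u f) h) 0
            - casoratian (snocSeq (snocSeq u g) z) 0 / casoratian (snocSeq (snocSeq u g) z) 1
              * casoratian (snocSeq (snocSeq u f) h) 1)
        + (Eh - Ef - Eg) * casoratian (snocSeq (snocSeq u f) h) 1 := by
  obtain ⟨U, e, hU, -, hs, rfl, rfl, hne⟩ := exists_deformation hp hps (by omega) hu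
  have c1 : ∀ f a, Continuous fun s => casoratian (snocSeq (U s) f) a := fun f a =>
    continuous_casoratian (continuous_snocSeq hU f) a
  have c2 : ∀ f g a, Continuous fun s => casoratian (snocSeq (snocSeq (U s) f) g) a := fun f g a =>
    continuous_casoratian (continuous_snocSeq (continuous_snocSeq hU f) g) a
  have hA1' := (c1 g 1).continuousAt.eventually_ne hA1
  have hA2' := (c1 g 2).continuousAt.eventually_ne hA2
  have hZ' := (c2 g z 1).continuousAt.eventually_ne hZ
  have k1 := fun f a => (c1 f a).continuousAt (x := 0)
  have k2 := fun f g a => (c2 f g a).continuousAt (x := 0)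
  refine eq_of_eventually_eq
    (F := fun s => (Eh - Ef) * (casoratian (snocSeq (U s) f) 2 / casoratian (snocSeq (U s) g) 2
        + casoratian (snocSeq (U s) f) 1 / casoratian (snocSeq (U s) g) 1)
        * casoratian (snocSeq (snocSeq (U s) g) h) 1)
    (G := fun s => p (N + 2) * (casoratian (snocSeq (U s) g) 1 / casoratian (snocSeq (U s) g) 2)
          * (casoratian (snocSeq (snocSeq (U s) f) h) 2
            - casoratian (snocSeq (snocSeq (U s) g) z) 2
              / casoratian (snocSeq (snocSeq (U s) g) z) 1
              * casoratian (snocSeq (snocSeq (U s) f) h) 1)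
        + ps 1 * (casoratian (snocSeq (U s) g) 2 / casoratian (snocSeq (U s) g) 1)
          * (casoratian (snocSeq (snocSeq (U s) f) h) 0
            - casoratian (snocSeq (snocSeq (U s) g) z) 0
              / casoratian (snocSeq (snocSeq (U s) g) z) 1
              * casoratian (snocSeq (snocSeq (U s) f) h) 1)
        + (Eh - Ef - Eg) * casoratian (snocSeq (snocSeq (U s) f) h) 1) ?_ ?_ ?_
  · exact (continuousAt_const.mul (((k1 f 2).div (k1 g 2) hA2).add ((k1 f 1).div (k1 g 1) hA1))).mul
      (k2 g h 1)
  · exact (((continuousAt_const.mul ((k1 g 1).div (k1 g 2) hA2)).mul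
      ((k2 f h 2).sub (((k2 g z 2).div (k2 g z 1) hZ).mul (k2 f h 1)))).add
      ((continuousAt_const.mul ((k1 g 2).div (k1 g 1) hA1)).mul
      ((k2 f h 0).sub (((k2 g z 0).div (k2 g z 1) hZ).mul (k2 f h 1))))).add
      (continuousAt_const.mul (k2 f h 1))
  · filter_upwards [hne, nhdsWithin_le_nhds hA1', nhdsWithin_le_nhds hA2', nhdsWithin_le_nhds hZ']
      with s h1 h2 h3 h4
    exact casoratian_same_type_of_ne (hs s) hf hg hh hz h2 h3 h4 h1

theorem snocSeq_init_last {N : ℕ} (v : Fin (N + 1) → ℕ → ℂ) :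
    snocSeq (fun k => v k.castSucc) (v (Fin.last N)) = v := by
  ext k j
  refine Fin.lastCases ?_ (fun k => ?_) k <;> simp

/-- The Casoratian to be made nonzero is that of `u` together with `f`, so `f` and its eigenvalue
are deformed too. -/
theorem casoratian_other_type {p ps b : ℕ → ℂ} {N : ℕ} {u : Fin N → ℕ → ℂ}
    {f g h z : ℕ → ℂ} {E : Fin N → ℂ} {Ef Eg Eh : ℂ}
    (hp : ∀ j < N + 3, p (j + 1) ≠ 0) (hps : ps 1 ≠ 0)
    (hu : ∀ k, IsSol p ps b (N + 3) (E k) (u k)) (hf : IsSol p ps b (N + 3) Ef f)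
    (hg : IsSol p ps b (N + 3) Eg g) (hh : IsSol p ps b (N + 3) Eh h)
    (hz : IsSol p ps b (N + 3) 0 z)
    (hA1 : casoratian (snocSeq (snocSeq u f) g) 1 ≠ 0)
    (hA2 : casoratian (snocSeq (snocSeq u f) g) 2 ≠ 0)
    (hZ : casoratian (snocSeq (snocSeq (snocSeq u f) g) z) 1 ≠ 0) :
    casoratian (snocSeq (snocSeq (snocSeq u f) g) h) 1
        * (ps 2 * casoratian u 3 / casoratian (snocSeq (snocSeq u f) g) 2
        + p (N + 2) * casoratian u 2 / casoratian (snocSeq (snocSeq u f) g) 1)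
      = casoratian (snocSeq (snocSeq u f) g) 1 / casoratian (snocSeq (snocSeq u f) g) 2
          * (ps 2 * casoratian (snocSeq u h) 3
            - p (N + 3) * (casoratian (snocSeq (snocSeq (snocSeq u f) g) z) 2
              / casoratian (snocSeq (snocSeq (snocSeq u f) g) z) 1) * casoratian (snocSeq u h) 2)
        + casoratian (snocSeq (snocSeq u f) g) 2 / casoratian (snocSeq (snocSeq u f) g) 1
          * (p (N + 2) * casoratian (snocSeq u h) 1
            - ps 1 * (casoratian (snocSeq (snocSeq (snocSeq u f) g) z) 0
              / casoratian (snocSeq (snocSeq (snocSeq u f) g) z) 1) * casoratian (snocSeq u h) 2)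
        + (Eh - Ef - Eg) * casoratian (snocSeq u h) 2 := by
  obtain ⟨V, e, hV, he, hs, hV0, he0, hne⟩ := exists_deformation hp hps (by omega)
    (isSol_snocSeq hu hf)
  set U : ℂ → Fin N → ℕ → ℂ := fun s k => V s k.castSucc with hU'
  set φ : ℂ → ℕ → ℂ := fun s => V s (Fin.last N) with hφ'
  have hVU : ∀ s, V s = snocSeq (U s) (φ s) := fun s => (snocSeq_init_last (V s)).symm
  have hU : ∀ k j, Continuous fun s => U s k j := fun k j => hV _ _
  have hU0 : U 0 = u := by
    ext k j
    simp [hU', hV0]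
  have hφ0 : φ 0 = f := by simp [hφ', hV0]
  have hEf : e 0 (Fin.last N) = Ef := by simp [he0]
  rw [← hU0, ← hφ0, ← hEf]
  rw [← hU0, ← hφ0] at hA1 hA2 hZ
  rw [← hVU] at hA1 hA2 hZ ⊢
  have c0 : ∀ a, Continuous fun s => casoratian (U s) a := fun a => continuous_casoratian hU a
  have c1 : ∀ f a, Continuous fun s => casoratian (snocSeq (U s) f) a := fun f a =>
    continuous_casoratian (continuous_snocSeq hU f) a
  have c2 : ∀ f a, Continuous fun s => casoratian (snocSeq (V s) f) a := fun f a =>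
    continuous_casoratian (continuous_snocSeq hV f) a
  have c3 : ∀ f g a, Continuous fun s => casoratian (snocSeq (snocSeq (V s) f) g) a := fun f g a =>
    continuous_casoratian (continuous_snocSeq (continuous_snocSeq hV f) g) a
  have hA1' := (c2 g 1).continuousAt.eventually_ne hA1
  have hA2' := (c2 g 2).continuousAt.eventually_ne hA2
  have hZ' := (c3 g z 1).continuousAt.eventually_ne hZ
  have k0 := fun a => (c0 a).continuousAt (x := 0)
  have k1 := fun f a => (c1 f a).continuousAt (x := 0)
  have k2 := fun f a => (c2 f a).continuousAt (x := 0)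
  have k3 := fun f g a => (c3 f g a).continuousAt (x := 0)
  refine eq_of_eventually_eq
    (F := fun s => casoratian (snocSeq (snocSeq (V s) g) h) 1
        * (ps 2 * casoratian (U s) 3 / casoratian (snocSeq (V s) g) 2
        + p (N + 2) * casoratian (U s) 2 / casoratian (snocSeq (V s) g) 1))
    (G := fun s => casoratian (snocSeq (V s) g) 1 / casoratian (snocSeq (V s) g) 2
          * (ps 2 * casoratian (snocSeq (U s) h) 3
            - p (N + 3) * (casoratian (snocSeq (snocSeq (V s) g) z) 2
              / casoratian (snocSeq (snocSeq (V s) g) z) 1) * casoratian (snocSeq (U s) h) 2)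
        + casoratian (snocSeq (V s) g) 2 / casoratian (snocSeq (V s) g) 1
          * (p (N + 2) * casoratian (snocSeq (U s) h) 1
            - ps 1 * (casoratian (snocSeq (snocSeq (V s) g) z) 0
              / casoratian (snocSeq (snocSeq (V s) g) z) 1) * casoratian (snocSeq (U s) h) 2)
        + (Eh - e s (Fin.last N) - Eg) * casoratian (snocSeq (U s) h) 2) ?_ ?_ ?_
  · exact (k3 g h 1).mul (((continuousAt_const.mul (k0 3)).div (k2 g 2) hA2).add
      ((continuousAt_const.mul (k0 2)).div (k2 g 1) hA1))
  · exact ((((k2 g 1).div (k2 g 2) hA2).mul ((continuousAt_const.mul (k1 h 3)).sub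
      ((continuousAt_const.mul ((k3 g z 2).div (k3 g z 1) hZ)).mul (k1 h 2)))).add
      (((k2 g 2).div (k2 g 1) hA1).mul ((continuousAt_const.mul (k1 h 1)).sub
      ((continuousAt_const.mul ((k3 g z 0).div (k3 g z 1) hZ)).mul (k1 h 2))))).add
      (((continuousAt_const.sub (he _).continuousAt).sub continuousAt_const).mul (k1 h 2))
  · filter_upwards [hne, nhdsWithin_le_nhds hA1', nhdsWithin_le_nhds hA2', nhdsWithin_le_nhds hZ']
      with s h1 h2 h3 h4
    have := casoratian_other_type_of_ne (fun k => hs s k.castSucc) (hs s (Fin.last N)) hg hh hz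
    rw [snocSeq_init_last] at this
    exact this h2 h3 h4 h1

end Casoratian

/-! ### Shift relations for terminating hypergeometric sums. -/

section Hypergeometric

/-- The shifted factorial `∏_{i < k} [b + i]` that belongs to a bracket. -/
noncomputable def brPoch (br : ℂ → ℂ) (b : ℂ) (k : ℕ) : ℂ :=
  ∏ i ∈ Finset.range k, br (b + i)

theorem brPoch_zero (br : ℂ → ℂ) (b : ℂ) : brPoch br b 0 = 1 := by simp [brPoch]

theorem brPoch_succ (br : ℂ → ℂ) (b : ℂ) (k : ℕ) :
    brPoch br b (k + 1) = brPoch br b k * br (b + k) := by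
  simp [brPoch, Finset.prod_range_succ]

theorem brPoch_succ' (br : ℂ → ℂ) (b : ℂ) (k : ℕ) :
    brPoch br b (k + 1) = br b * brPoch br (b + 1) k := by
  simp only [brPoch, Finset.prod_range_succ']
  rw [mul_comm]
  congr 1
  · simp
  · exact Finset.prod_congr rfl fun i _ => by push_cast; ring_nf

/-- Summation by parts: a term `T k` meets only the neighbouring basis functions `b k` and `b (k -
1)`, and after regrouping the coefficient of `b k` is `c * C' k`. The top index `n` receives one
contribution only, whence the separate hypothesis `hn`. -/
theorem sum_two_term {C C' A B T b : ℕ → ℂ} {c : ℂ} {n : ℕ} (h0 : T 0 = A 0 * b 0)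
    (hT : ∀ k, T (k + 1) = A (k + 1) * b (k + 1) - B k * b k)
    (hC : ∀ k < n, C k * A k - C (k + 1) * B k = c * C' k) (hn : C n * A n = c * C' n) :
    ∑ k ∈ Finset.range (n + 1), C k * T k = c * ∑ k ∈ Finset.range (n + 1), C' k * b k := by
  have h1 : ∑ k ∈ Finset.range (n + 1), C k * T k
      = ∑ k ∈ Finset.range (n + 1), C k * (A k * b k)
        - ∑ k ∈ Finset.range n, C (k + 1) * (B k * b k) := by
    rw [Finset.sum_range_succ', Finset.sum_range_succ' (fun k => C k * (A k * b k)), h0]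
    rw [add_sub_right_comm, ← Finset.sum_sub_distrib]
    congr 1
    exact Finset.sum_congr rfl fun k _ => by rw [hT]; ring
  rw [h1, Finset.sum_range_succ, add_sub_right_comm, ← Finset.sum_sub_distrib,
    Finset.sum_range_succ, mul_add, Finset.mul_sum]
  congr 1
  · exact Finset.sum_congr rfl fun k hk => by
      linear_combination b k * hC k (Finset.mem_range.1 hk)
  · linear_combination b n * hn

/-- The properties of the bracket, `[u] = u` or `[u] = q^{-u/2} - q^{u/2}`, on which the theory of
the Wilson and Askey-Wilson polynomials rests. -/
structure IsBracket (br : ℂ → ℂ) : Prop where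
  add : ∀ α β w, br (α + w) * br (β + w) - br (α - w) * br (β - w) = br (α + β) * br (2 * w)
  quartic : ∀ α β a k w, br (α - w) * br (β - w) * br (a + w) * br (a + k - w)
    - br (α + w) * br (β + w) * br (a - w) * br (a + k + w)
    = -br (2 * w) * (br (α + β + k) * br (a + k + w) * br (a + k - w)
      - br k * br (a + α + k) * br (a + β + k))
  exchange : ∀ a b n k, br (a + k) * br (b + k) - br (k - n) * br (n + a + b + k)
    = br (b + n) * br (a + n)
  ne_zero : ∀ k : ℕ, br (1 + k) ≠ 0

theorem isBracket_id : IsBracket (fun u : ℂ => u) where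
  add _ _ _ := by ring
  quartic _ _ _ _ _ := by ring
  exchange _ _ _ _ := by ring
  ne_zero k := by rw [add_comm]; exact Nat.cast_add_one_ne_zero k

theorem isBracket_exp {c : ℝ} (hc : c ≠ 0) :
    IsBracket (fun u : ℂ => Complex.exp (-(c * u)) - Complex.exp (c * u)) where
  add α β w := by
    simp only [mul_add, mul_sub, neg_add, neg_sub, Complex.exp_add, Complex.exp_sub,
      Complex.exp_neg, two_mul]
    have h1 := Complex.exp_ne_zero (c * α)
    have h2 := Complex.exp_ne_zero (c * β)
    have h3 := Complex.exp_ne_zero (c * w)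
    field_simp
    ring
  quartic α β a k w := by
    simp only [mul_add, mul_sub, neg_add, neg_sub, Complex.exp_add, Complex.exp_sub,
      Complex.exp_neg, two_mul]
    have h1 := Complex.exp_ne_zero (c * α)
    have h2 := Complex.exp_ne_zero (c * β)
    have h3 := Complex.exp_ne_zero (c * w)
    have h4 := Complex.exp_ne_zero (c * a)
    have h5 := Complex.exp_ne_zero (c * k)
    field_simp
    ring
  exchange a b n k := by
    simp only [mul_add, mul_sub, neg_add, neg_sub, Complex.exp_add, Complex.exp_sub,
      Complex.exp_neg]
    have h1 := Complex.exp_ne_zero (c * a)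
    have h2 := Complex.exp_ne_zero (c * b)
    have h4 := Complex.exp_ne_zero (c * n)
    have h5 := Complex.exp_ne_zero (c * k)
    field_simp
    ring
  ne_zero k h := by
    have hk : (1 + k : ℝ) ≠ 0 := by positivity
    have h2 : ((Real.exp (-(c * (1 + k))) : ℝ) : ℂ) = ((Real.exp (c * (1 + k)) : ℝ) : ℂ) := by
      push_cast
      exact sub_eq_zero.1 h
    have h3 := Real.exp_injective (Complex.ofReal_injective h2)
    have : c * (1 + k) = 0 := by linarith
    exact (mul_ne_zero hc hk) this

/-- The coefficients of `wilsonSum`. -/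
noncomputable def wilsonCoeff (br : ℂ → ℂ) (a₁ a₂ a₃ a₄ : ℂ) (n k : ℕ) : ℂ :=
  brPoch br (-n) k * brPoch br (n + (a₁ + a₂ + a₃ + a₄) - 1) k / brPoch br 1 k
    * (brPoch br (a₁ + a₂ + k) (n - k) * brPoch br (a₁ + a₃ + k) (n - k)
      * brPoch br (a₁ + a₄ + k) (n - k))

/-- The Wilson and the Askey-Wilson polynomial (up to a constant factor) in terms of the bracket. -/
noncomputable def wilsonSum (br : ℂ → ℂ) (a₁ a₂ a₃ a₄ : ℂ) (n : ℕ) (w : ℂ) : ℂ :=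
  ∑ k ∈ Finset.range (n + 1), wilsonCoeff br a₁ a₂ a₃ a₄ n k
    * (brPoch br (a₁ + w) k * brPoch br (a₁ - w) k)

/-- The relation holds term by term, because the basis functions are built from `a₁`, which belongs
to the shifted pair. The prefactors with `a₁` lengthen the shifted factorials by one factor (`e1`,
`e2`), and the `add` identity of the bracket contracts what is left. -/
theorem wilsonSum_shift_fst {br : ℂ → ℂ} (hb : IsBracket br) (a₁ a₂ a₃ a₄ : ℂ) (n : ℕ) (w : ℂ) :
    br (a₁ - 1 / 2 - w) * br (a₂ - 1 / 2 - w) * wilsonSum br a₁ a₂ a₃ a₄ n (w - 1 / 2)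
      - br (a₁ - 1 / 2 + w) * br (a₂ - 1 / 2 + w) * wilsonSum br a₁ a₂ a₃ a₄ n (w + 1 / 2)
      = -br (a₁ + a₂ + n - 1) * br (2 * w)
        * wilsonSum br (a₁ - 1 / 2) (a₂ - 1 / 2) (a₃ + 1 / 2) (a₄ + 1 / 2) n w := by
  simp only [wilsonSum, Finset.mul_sum]
  rw [← Finset.sum_sub_distrib]
  refine Finset.sum_congr rfl fun k hk => ?_
  have hk : k ≤ n := by simpa [Nat.lt_succ_iff] using hk
  have e1 : br (a₁ - 1 / 2 - w) * brPoch br (a₁ - (w - 1 / 2)) k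
      = brPoch br (a₁ - 1 / 2 - w) k * br (a₁ - 1 / 2 + k - w) := by
    rw [show a₁ - (w - 1 / 2) = a₁ - 1 / 2 - w + 1 by ring, ← brPoch_succ', brPoch_succ]
    ring_nf
  have e2 : br (a₁ - 1 / 2 + w) * brPoch br (a₁ + (w + 1 / 2)) k
      = brPoch br (a₁ - 1 / 2 + w) k * br (a₁ - 1 / 2 + k + w) := by
    rw [show a₁ + (w + 1 / 2) = a₁ - 1 / 2 + w + 1 by ring, ← brPoch_succ', brPoch_succ]
    ring_nf
  have e3 := hb.add (a₁ - 1 / 2 + k) (a₂ - 1 / 2) w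
  have e4 : br (a₁ - 1 / 2 + k + (a₂ - 1 / 2)) * brPoch br (a₁ + a₂ + k) (n - k)
      = br (a₁ + a₂ + n - 1) * brPoch br (a₁ - 1 / 2 + (a₂ - 1 / 2) + k) (n - k) := by
    rw [show a₁ + a₂ + k = a₁ - 1 / 2 + k + (a₂ - 1 / 2) + 1 by ring, ← brPoch_succ', brPoch_succ,
      Nat.cast_sub hk]
    ring_nf
  simp only [wilsonCoeff]
  rw [show a₁ + (w - 1 / 2) = a₁ - 1 / 2 + w by ring,
    show a₁ - (w + 1 / 2) = a₁ - 1 / 2 - w by ring,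
    show a₁ - 1 / 2 + (a₂ - 1 / 2) + (a₃ + 1 / 2) + (a₄ + 1 / 2) = a₁ + a₂ + a₃ + a₄ by ring,
    show a₁ - 1 / 2 + (a₃ + 1 / 2) + k = a₁ + a₃ + k by ring,
    show a₁ - 1 / 2 + (a₄ + 1 / 2) + k = a₁ + a₄ + k by ring]
  generalize brPoch br (-n) k * brPoch br (n + (a₁ + a₂ + a₃ + a₄) - 1) k / brPoch br 1 k = c
  generalize brPoch br (a₁ + a₃ + k) (n - k) = x₃
  generalize brPoch br (a₁ + a₄ + k) (n - k) = x₄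
  linear_combination
    (c * x₃ * x₄ * brPoch br (a₁ + a₂ + k) (n - k) * br (a₂ - 1 / 2 - w)
      * brPoch br (a₁ - 1 / 2 + w) k) * e1
    - (c * x₃ * x₄ * brPoch br (a₁ + a₂ + k) (n - k) * br (a₂ - 1 / 2 + w)
      * brPoch br (a₁ - 1 / 2 - w) k) * e2
    - (c * x₃ * x₄ * brPoch br (a₁ + a₂ + k) (n - k) * brPoch br (a₁ - 1 / 2 + w) k
      * brPoch br (a₁ - 1 / 2 - w) k) * e3
    - (c * x₃ * x₄ * br (2 * w) * brPoch br (a₁ - 1 / 2 + w) k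
      * brPoch br (a₁ - 1 / 2 - w) k) * e4

/-- The pair `a₃, a₄` does not enter the basis functions, so the relation fails term by term:
`quartic` spreads each term over two neighbouring basis functions, and `exchange` unites the two
contributions to each coefficient. -/
theorem wilsonSum_shift_snd {br : ℂ → ℂ} (hb : IsBracket br) (a₁ a₂ a₃ a₄ : ℂ) (n : ℕ) (w : ℂ) :
    br (a₃ - 1 / 2 - w) * br (a₄ - 1 / 2 - w) * wilsonSum br a₁ a₂ a₃ a₄ n (w - 1 / 2)
      - br (a₃ - 1 / 2 + w) * br (a₄ - 1 / 2 + w) * wilsonSum br a₁ a₂ a₃ a₄ n (w + 1 / 2)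
      = -br (a₃ + a₄ + n - 1) * br (2 * w)
        * wilsonSum br (a₁ + 1 / 2) (a₂ + 1 / 2) (a₃ - 1 / 2) (a₄ - 1 / 2) n w := by
  have key := sum_two_term (C := wilsonCoeff br a₁ a₂ a₃ a₄ n)
    (C' := wilsonCoeff br (a₁ + 1 / 2) (a₂ + 1 / 2) (a₃ - 1 / 2) (a₄ - 1 / 2) n)
    (A := fun k => -br (2 * w) * br (a₃ + a₄ - 1 + k))
    (B := fun k => -br (2 * w) * (br (1 + k) * br (a₁ + a₃ + k) * br (a₁ + a₄ + k)))
    (T := fun k => br (a₃ - 1 / 2 - w) * br (a₄ - 1 / 2 - w)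
        * (brPoch br (a₁ + (w - 1 / 2)) k * brPoch br (a₁ - (w - 1 / 2)) k)
      - br (a₃ - 1 / 2 + w) * br (a₄ - 1 / 2 + w)
        * (brPoch br (a₁ + (w + 1 / 2)) k * brPoch br (a₁ - (w + 1 / 2)) k))
    (b := fun k => brPoch br (a₁ + 1 / 2 + w) k * brPoch br (a₁ + 1 / 2 - w) k)
    (c := -br (a₃ + a₄ + n - 1) * br (2 * w)) (n := n) ?_ ?_ ?_ ?_
  · rw [wilsonSum, wilsonSum, wilsonSum, ← key, Finset.mul_sum, Finset.mul_sum,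
      ← Finset.sum_sub_distrib]
    exact Finset.sum_congr rfl fun k _ => by ring
  · have := hb.add (a₃ - 1 / 2) (a₄ - 1 / 2) w
    rw [show a₃ - 1 / 2 + (a₄ - 1 / 2) = a₃ + a₄ - 1 by ring] at this
    simp only [brPoch_zero]
    simp only [Nat.cast_zero, add_zero]
    linear_combination -this
  · intro k
    have := hb.quartic (a₃ - 1 / 2) (a₄ - 1 / 2) (a₁ - 1 / 2) (1 + k) w
    have e1 : brPoch br (a₁ + (w - 1 / 2)) (k + 1)
        = br (a₁ - 1 / 2 + w) * brPoch br (a₁ + 1 / 2 + w) k := by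
      rw [brPoch_succ']
      ring_nf
    have e2 : brPoch br (a₁ - (w + 1 / 2)) (k + 1)
        = br (a₁ - 1 / 2 - w) * brPoch br (a₁ + 1 / 2 - w) k := by
      rw [brPoch_succ']
      ring_nf
    have e3 : brPoch br (a₁ - (w - 1 / 2)) (k + 1)
        = brPoch br (a₁ + 1 / 2 - w) k * br (a₁ - 1 / 2 + (1 + k) - w) := by
      rw [brPoch_succ]
      ring_nf
    have e4 : brPoch br (a₁ + (w + 1 / 2)) (k + 1)
        = brPoch br (a₁ + 1 / 2 + w) k * br (a₁ - 1 / 2 + (1 + k) + w) := by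
      rw [brPoch_succ]
      ring_nf
    rw [e1, e2, e3, e4, brPoch_succ br (a₁ + 1 / 2 + w), brPoch_succ br (a₁ + 1 / 2 - w),
      show a₁ + 1 / 2 + w + k = a₁ - 1 / 2 + (1 + k) + w by ring,
      show a₁ + 1 / 2 - w + k = a₁ - 1 / 2 + (1 + k) - w by ring,
      show a₁ + a₃ + k = a₁ - 1 / 2 + (a₃ - 1 / 2) + (1 + k) by ring,
      show a₁ + a₄ + k = a₁ - 1 / 2 + (a₄ - 1 / 2) + (1 + k) by ring,
      show a₃ + a₄ - 1 + ((k + 1 : ℕ) : ℂ) = a₃ - 1 / 2 + (a₄ - 1 / 2) + (1 + k) by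
        push_cast; ring]
    linear_combination (brPoch br (a₁ + 1 / 2 + w) k * brPoch br (a₁ + 1 / 2 - w) k) * this
  · intro k hk
    obtain ⟨m, rfl⟩ := Nat.exists_eq_add_of_lt hk
    have hx := hb.exchange (a₁ + a₂) (a₃ + a₄ - 1) (k + m + 1) k
    have hne := hb.ne_zero k
    have hne' : brPoch br 1 k ≠ 0 := Finset.prod_ne_zero_iff.2 fun i _ => hb.ne_zero i
    simp only [wilsonCoeff]
    rw [show k + m + 1 - k = m + 1 by omega, show k + m + 1 - (k + 1) = m by omega,
      brPoch_succ' br (a₁ + a₂ + k), brPoch_succ' br (a₁ + a₃ + k), brPoch_succ' br (a₁ + a₄ + k),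
      brPoch_succ br _ k, brPoch_succ br _ k, brPoch_succ br 1 k,
      show a₁ + 1 / 2 + (a₃ - 1 / 2) + k = a₁ + a₃ + k by ring,
      show a₁ + 1 / 2 + (a₄ - 1 / 2) + k = a₁ + a₄ + k by ring,
      show a₁ + 1 / 2 + (a₂ + 1 / 2) + k = a₁ + a₂ + k + 1 by ring,
      brPoch_succ' br (a₁ + a₃ + k), brPoch_succ' br (a₁ + a₄ + k),
      brPoch_succ br (a₁ + a₂ + k + 1),
      show a₁ + 1 / 2 + (a₂ + 1 / 2) + (a₃ - 1 / 2) + (a₄ - 1 / 2) = a₁ + a₂ + a₃ + a₄ by ring,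
      show a₁ + a₂ + ((k + 1 : ℕ) : ℂ) = a₁ + a₂ + k + 1 by push_cast; ring,
      show a₁ + a₃ + ((k + 1 : ℕ) : ℂ) = a₁ + a₃ + k + 1 by push_cast; ring,
      show a₁ + a₄ + ((k + 1 : ℕ) : ℂ) = a₁ + a₄ + k + 1 by push_cast; ring,
      show -((k + m + 1 : ℕ) : ℂ) + k = k - (k + m + 1) by push_cast; ring,
      show ((k + m + 1 : ℕ) : ℂ) + (a₁ + a₂ + a₃ + a₄) - 1 + k
        = k + m + 1 + (a₁ + a₂) + (a₃ + a₄ - 1) + k by push_cast; ring,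
      show a₁ + a₂ + k + 1 + m = a₁ + a₂ + (k + m + 1) by ring,
      show a₃ + a₄ + ((k + m + 1 : ℕ) : ℂ) - 1 = a₃ + a₄ - 1 + (k + m + 1) by push_cast; ring]
    field_simp
    linear_combination -(brPoch br (-((k + m + 1 : ℕ) : ℂ)) k
      * brPoch br (((k + m + 1 : ℕ) : ℂ) + (a₁ + a₂ + a₃ + a₄) - 1) k
      * brPoch br (a₁ + a₂ + k + 1) m * br (a₁ + a₃ + k) * brPoch br (a₁ + a₃ + k + 1) m
      * br (a₁ + a₄ + k) * brPoch br (a₁ + a₄ + k + 1) m * br (2 * w)) * hx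
  · simp only [wilsonCoeff, Nat.sub_self, brPoch_zero]
    rw [show a₁ + 1 / 2 + (a₂ + 1 / 2) + (a₃ - 1 / 2) + (a₄ - 1 / 2) = a₁ + a₂ + a₃ + a₄ by ring,
      show a₃ + a₄ + (n : ℂ) - 1 = a₃ + a₄ - 1 + n by ring]
    ring

/-- The coefficients of `hahnSum`. -/
noncomputable def hahnCoeff (a₁ a₂ a₃ a₄ : ℂ) (n k : ℕ) : ℂ :=
  brPoch (fun u => u) (-n) k * brPoch (fun u => u) (n + (a₁ + a₂ + a₃ + a₄) - 1) k
    / brPoch (fun u => u) 1 k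
    * (brPoch (fun u => u) (a₁ + a₃ + k) (n - k) * brPoch (fun u => u) (a₁ + a₄ + k) (n - k))

/-- The continuous Hahn polynomial up to a constant factor. -/
noncomputable def hahnSum (a₁ a₂ a₃ a₄ : ℂ) (n : ℕ) (w : ℂ) : ℂ :=
  ∑ k ∈ Finset.range (n + 1), hahnCoeff a₁ a₂ a₃ a₄ n k * brPoch (fun u => u) (a₁ + w) k

/-- For the continuous Hahn sum the pairs are `(a₁, a₃)` and `(a₂, a₄)`. The first relation is again
one between single terms, the second needs `sum_two_term`. -/
theorem hahnSum_shift_fst (a₁ a₂ a₃ a₄ : ℂ) (n : ℕ) (w : ℂ) :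
    (a₃ - 1 / 2 - w) * hahnSum a₁ a₂ a₃ a₄ n (w - 1 / 2)
      + (a₁ - 1 / 2 + w) * hahnSum a₁ a₂ a₃ a₄ n (w + 1 / 2)
      = (a₁ + a₃ + n - 1)
        * hahnSum (a₁ - 1 / 2) (a₂ + 1 / 2) (a₃ - 1 / 2) (a₄ + 1 / 2) n w := by
  simp only [hahnSum, Finset.mul_sum]
  rw [← Finset.sum_add_distrib]
  refine Finset.sum_congr rfl fun k hk => ?_
  have hk : k ≤ n := by simpa [Nat.lt_succ_iff] using hk
  have e2 : (a₁ - 1 / 2 + w) * brPoch (fun u => u) (a₁ + (w + 1 / 2)) k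
      = brPoch (fun u => u) (a₁ - 1 / 2 + w) k * (a₁ - 1 / 2 + k + w) := by
    have := brPoch_succ' (fun u => u) (a₁ - 1 / 2 + w) k
    rw [brPoch_succ, show a₁ - 1 / 2 + w + 1 = a₁ + (w + 1 / 2) by ring] at this
    rw [← this]
    ring
  have e4 : (a₁ + a₃ - 1 + k) * brPoch (fun u => u) (a₁ + a₃ + k) (n - k)
      = (a₁ + a₃ + n - 1) * brPoch (fun u => u) (a₁ - 1 / 2 + (a₃ - 1 / 2) + k) (n - k) := by
    have := brPoch_succ' (fun u => u) (a₁ - 1 / 2 + (a₃ - 1 / 2) + k) (n - k)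
    rw [brPoch_succ, Nat.cast_sub hk,
      show a₁ - 1 / 2 + (a₃ - 1 / 2) + k + 1 = a₁ + a₃ + k by ring] at this
    linear_combination -this
  simp only [hahnCoeff]
  rw [show a₁ + (w - 1 / 2) = a₁ - 1 / 2 + w by ring,
    show a₁ - 1 / 2 + (a₂ + 1 / 2) + (a₃ - 1 / 2) + (a₄ + 1 / 2) = a₁ + a₂ + a₃ + a₄ by ring,
    show a₁ - 1 / 2 + (a₄ + 1 / 2) + k = a₁ + a₄ + k by ring]
  generalize brPoch (fun u => u) (-n) k * brPoch (fun u => u) (n + (a₁ + a₂ + a₃ + a₄) - 1) k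
    / brPoch (fun u => u) 1 k = c
  generalize brPoch (fun u => u) (a₁ + a₄ + k) (n - k) = x₄
  linear_combination (c * x₄ * brPoch (fun u => u) (a₁ + a₃ + k) (n - k)) * e2
    + (c * x₄ * brPoch (fun u => u) (a₁ - 1 / 2 + w) k) * e4

theorem hahnSum_shift_snd (a₁ a₂ a₃ a₄ : ℂ) (n : ℕ) (w : ℂ) :
    (a₄ - 1 / 2 - w) * hahnSum a₁ a₂ a₃ a₄ n (w - 1 / 2)
      + (a₂ - 1 / 2 + w) * hahnSum a₁ a₂ a₃ a₄ n (w + 1 / 2)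
      = (a₂ + a₄ + n - 1)
        * hahnSum (a₁ + 1 / 2) (a₂ - 1 / 2) (a₃ + 1 / 2) (a₄ - 1 / 2) n w := by
  have key := sum_two_term (C := hahnCoeff a₁ a₂ a₃ a₄ n)
    (C' := hahnCoeff (a₁ + 1 / 2) (a₂ - 1 / 2) (a₃ + 1 / 2) (a₄ - 1 / 2) n)
    (A := fun k => a₂ + a₄ - 1 + k)
    (B := fun k => (1 + k) * (a₁ + a₄ + k))
    (T := fun k => (a₄ - 1 / 2 - w) * brPoch (fun u => u) (a₁ + (w - 1 / 2)) k
      + (a₂ - 1 / 2 + w) * brPoch (fun u => u) (a₁ + (w + 1 / 2)) k)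
    (b := fun k => brPoch (fun u => u) (a₁ + 1 / 2 + w) k)
    (c := a₂ + a₄ + n - 1) (n := n) ?_ ?_ ?_ ?_
  · rw [hahnSum, hahnSum, hahnSum, ← key, Finset.mul_sum, Finset.mul_sum,
      ← Finset.sum_add_distrib]
    exact Finset.sum_congr rfl fun k _ => by ring
  · simp only [brPoch_zero]
    push_cast
    ring
  · intro k
    have e1 : brPoch (fun u => u) (a₁ + (w - 1 / 2)) (k + 1)
        = (a₁ - 1 / 2 + w) * brPoch (fun u => u) (a₁ + 1 / 2 + w) k := by
      rw [brPoch_succ']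
      ring_nf
    rw [e1, show a₁ + (w + 1 / 2) = a₁ + 1 / 2 + w by ring, brPoch_succ]
    push_cast
    ring
  · intro k hk
    obtain ⟨m, rfl⟩ := Nat.exists_eq_add_of_lt hk
    have hne := isBracket_id.ne_zero k
    have hne' : brPoch (fun u => u) 1 k ≠ 0 :=
      Finset.prod_ne_zero_iff.2 fun i _ => isBracket_id.ne_zero i
    simp only [hahnCoeff]
    rw [show k + m + 1 - k = m + 1 by omega, show k + m + 1 - (k + 1) = m by omega,
      brPoch_succ' _ (a₁ + a₃ + k), brPoch_succ' _ (a₁ + a₄ + k),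
      brPoch_succ _ _ k, brPoch_succ _ _ k, brPoch_succ _ 1 k,
      show a₁ + 1 / 2 + (a₃ + 1 / 2) + k = a₁ + a₃ + k + 1 by ring,
      show a₁ + 1 / 2 + (a₄ - 1 / 2) + k = a₁ + a₄ + k by ring,
      brPoch_succ' _ (a₁ + a₄ + k), brPoch_succ _ (a₁ + a₃ + k + 1),
      show a₁ + 1 / 2 + (a₂ - 1 / 2) + (a₃ + 1 / 2) + (a₄ - 1 / 2) = a₁ + a₂ + a₃ + a₄ by ring,
      show a₁ + a₃ + ((k + 1 : ℕ) : ℂ) = a₁ + a₃ + k + 1 by push_cast; ring,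
      show a₁ + a₄ + ((k + 1 : ℕ) : ℂ) = a₁ + a₄ + k + 1 by push_cast; ring]
    field_simp
    push_cast
    ring
  · simp only [hahnCoeff, Nat.sub_self, brPoch_zero]
    rw [show a₁ + 1 / 2 + (a₂ - 1 / 2) + (a₃ + 1 / 2) + (a₄ - 1 / 2) = a₁ + a₂ + a₃ + a₄ by ring]
    ring

end Hypergeometric

/-! ### The shift relations for the three families of polynomials. -/

noncomputable section

namespace System

variable (S : System)

theorem cpow_q (hq : 0 < S.q) (b : ℂ) :
    (S.q : ℂ) ^ b = Complex.exp ((Real.log S.q : ℂ) * b) := by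
  rw [Complex.cpow_def_of_ne_zero (by exact_mod_cast hq.ne'), Complex.ofReal_log hq.le]

theorem pow_q (hq : 0 < S.q) (k : ℕ) :
    (S.q : ℂ) ^ k = Complex.exp ((Real.log S.q : ℂ) * k) := by
  rw [← cpow_q S hq, Complex.cpow_natCast]

/-- The bracket `[u] = q^{-u/2} - q^{u/2}` of the Askey-Wilson system. -/
def qbr (u : ℂ) : ℂ :=
  Complex.exp (-(((Real.log S.q / 2 : ℝ) : ℂ) * u)) - Complex.exp (((Real.log S.q / 2 : ℝ) : ℂ) * u)

theorem log_q_ne (hq₀ : 0 < S.q) (hq₁ : S.q < 1) : Real.log S.q ≠ 0 :=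
  (Real.log_neg hq₀ hq₁).ne

theorem isBracket_qbr (hq₀ : 0 < S.q) (hq₁ : S.q < 1) : IsBracket S.qbr :=
  isBracket_exp (div_ne_zero (S.log_q_ne hq₀ hq₁) two_ne_zero)

/-- The factor `f(y)` of a type `t`; the potential functions are products of such factors. -/
def fac (t : VType) (y : ℂ) : ℂ :=
  match S.kind with
  | .cH => I * S.lin (S.lam (S.pair t).1) y
  | .W => S.lin (S.lam (S.pair t).1) y * S.lin (S.lam (S.pair t).2) y
  | .AW => Complex.exp (-((Real.log S.q : ℂ) / 2 * S.pairSum t) - I * y)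
      * (S.lin (S.lam (S.pair t).1) y * S.lin (S.lam (S.pair t).2) y)

/-- The counterpart of `fac` for the opposite shift. -/
def facStar (t : VType) (y : ℂ) : ℂ :=
  match S.kind with
  | .cH => -I * S.lin (S.lam (S.pair t).2) (-y)
  | .W => S.fac t (-y)
  | .AW => S.fac t (-y)

/-- The system with the parameters `λ + δ̃` of a type. -/
def shift (t : VType) : System :=
  { S with lam := fun k => S.lam k + S.deltaTilde t k }

/-- The constant in the shift relation `facStar_mul_P_sub`. -/
def fwd (t : VType) (n : ℕ) : ℂ :=
  match S.kind with
  | .cH => -I * (S.pairSum t + n - 1)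
  | .W => -I * (S.pairSum t + n - 1)
  | .AW => I * S.qbr (S.pairSum t + n - 1)

theorem poch_eq_brPoch (hk : S.kind ≠ .AW) (b x : ℂ) (k : ℕ) :
    S.poch b x k = brPoch (fun u => u) (b + I * x) k := by
  refine Finset.prod_congr rfl fun i _ => ?_
  rcases h : S.kind <;> simp_all [lin] <;> ring

theorem lin_eq_qbr (hq₀ : 0 < S.q) (hq₁ : S.q < 1) (hk : S.kind = .AW) (b x : ℂ) :
    S.lin b x = Complex.exp ((Real.log S.q : ℂ) / 2 * b + I * x / 2)
      * S.qbr (b + I * x / (Real.log S.q : ℂ)) := by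
  have hl : (Real.log S.q : ℂ) ≠ 0 := by exact_mod_cast S.log_q_ne hq₀ hq₁
  simp only [lin, hk, qbr, cpow_q S hq₀, mul_sub, ← Complex.exp_add]
  push_cast
  congr 1
  · rw [← Complex.exp_zero]
    congr 1
    field_simp
    ring
  · congr 1
    field_simp
    ring

theorem poch_eq_qbrPoch (hq₀ : 0 < S.q) (hq₁ : S.q < 1) (hk : S.kind = .AW) (b x : ℂ) (k : ℕ) :
    S.poch b x k = Complex.exp ((Real.log S.q : ℂ) / 2 * (k * b + k * (k - 1) / 2) + I * x * k / 2)
      * brPoch S.qbr (b + I * x / (Real.log S.q : ℂ)) k := by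
  induction k with
  | zero => simp [poch, brPoch]
  | succ k ih =>
    rw [poch, Finset.prod_range_succ, ← poch, ih, brPoch_succ, lin_eq_qbr S hq₀ hq₁ hk]
    have : Complex.exp ((Real.log S.q : ℂ) / 2 * (k * b + k * (k - 1) / 2) + I * x * k / 2)
        * Complex.exp ((Real.log S.q : ℂ) / 2 * (b + k) + I * x / 2)
        = Complex.exp ((Real.log S.q : ℂ) / 2 * ((k + 1 : ℕ) * b + (k + 1 : ℕ) *
          ((k + 1 : ℕ) - 1) / 2) + I * x * (k + 1 : ℕ) / 2) := by
      rw [← Complex.exp_add]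
      congr 1
      push_cast
      ring
    rw [← this, show b + I * x / (Real.log S.q : ℂ) + k = b + k + I * x / (Real.log S.q : ℂ) by ring]
    ring

theorem P_eq_hahnSum (hk : S.kind = .cH) (n : ℕ) (x : ℂ) :
    S.P n x = I ^ n / (n.factorial : ℂ)
      * hahnSum (S.lam 0) (S.lam 1) (S.lam 2) (S.lam 3) n (I * x) := by
  have hp := S.poch_eq_brPoch (by simp [hk])
  simp only [P, hk, hahnSum, hp, hahnCoeff, mul_zero, add_zero, Fin.sum_univ_four]
  congr 1
  refine Finset.sum_congr rfl fun k _ => ?_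
  have : (k.factorial : ℂ) = brPoch (fun u => u) 1 k := by
    rw [← Finset.prod_range_add_one_eq_factorial, brPoch]
    push_cast
    exact Finset.prod_congr rfl fun i _ => by ring
  rw [this]
  ring

theorem P_eq_wilsonSum (hk : S.kind = .W) (n : ℕ) (x : ℂ) :
    S.P n x = wilsonSum (fun u => u) (S.lam 0) (S.lam 1) (S.lam 2) (S.lam 3) n (I * x) := by
  have hp := S.poch_eq_brPoch (by simp [hk])
  simp only [P, hk, wilsonSum, hp, wilsonCoeff, mul_zero, add_zero, Fin.sum_univ_four]
  refine Finset.sum_congr rfl fun k _ => ?_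
  have : (k.factorial : ℂ) = brPoch (fun u => u) 1 k := by
    rw [← Finset.prod_range_add_one_eq_factorial, brPoch]
    push_cast
    exact Finset.prod_congr rfl fun i _ => by ring
  rw [this, show S.lam 0 + I * -x = S.lam 0 - I * x by ring]
  ring

/-- Each `q`-shifted factorial is its bracket counterpart times a power of `q` and of `e^{ix}`. In
every summand these powers, together with `q ^ k` and the prefactor of `P`, combine to the same
constant, in which the parameters enter only through their sum. -/
theorem P_eq_qWilsonSum (hq₀ : 0 < S.q) (hq₁ : S.q < 1) (hk : S.kind = .AW) (n : ℕ) (x : ℂ) :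
    S.P n x = Complex.exp ((Real.log S.q : ℂ) * (n * (∑ m, S.lam m) / 2 + 3 * n * (n - 1) / 4))
      * wilsonSum S.qbr (S.lam 0) (S.lam 1) (S.lam 2) (S.lam 3) n
        (I * x / (Real.log S.q : ℂ)) := by
  have hp := S.poch_eq_qbrPoch hq₀ hq₁ hk
  simp only [P, hk, wilsonSum, hp, wilsonCoeff, mul_zero, add_zero, zero_div, zero_mul,
    Fin.sum_univ_four, cpow_q S hq₀, pow_q S hq₀, Finset.mul_sum]
  refine Finset.sum_congr rfl fun k hk => ?_
  obtain ⟨m, rfl⟩ := Nat.exists_eq_add_of_le (show k ≤ n by simpa [Nat.lt_succ_iff] using hk)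
  rw [show k + m - k = m by omega,
    show S.lam 0 + I * -x / (Real.log S.q : ℂ) = S.lam 0 - I * x / (Real.log S.q : ℂ) by ring]
  generalize (Real.log S.q : ℂ) = γ
  generalize brPoch S.qbr 1 k = d
  rw [mul_div_assoc, div_eq_mul_inv _ (_ * d), mul_inv, ← Complex.exp_neg]
  have hexp : ∀ a b c e f g h i j l K : ℂ, a + (b + c + (e + f) + g + h + (i + j + l)) = K →
      ∀ x₁ x₂ x₃ x₄ x₅ x₆ x₇ x₈ : ℂ, Complex.exp a * (Complex.exp b * x₁ * (Complex.exp c * x₂)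
        * (Complex.exp e * x₃ * (Complex.exp f * x₄) * (Complex.exp g * x₅)) * Complex.exp h
        * (Complex.exp i * x₆ * (Complex.exp j * x₇) * (Complex.exp l * x₈)))
      = Complex.exp K * (x₁ * x₂ * x₅ * (x₆ * x₇ * x₈) * (x₃ * x₄)) := by
    rintro a b c e f g h i j l K rfl x₁ x₂ x₃ x₄ x₅ x₆ x₇ x₈
    simp only [Complex.exp_add]
    ring
  rw [hexp _ _ _ _ _ _ _ _ _ _ (γ * (((k + m : ℕ) : ℂ) * (S.lam 0 + S.lam 1 + S.lam 2 + S.lam 3)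
    / 2 + 3 * ((k + m : ℕ) : ℂ) * (((k + m : ℕ) : ℂ) - 1) / 4))]
  · simp only [div_eq_mul_inv]
  · push_cast
    ring

theorem fac_eq_qbr (hq₀ : 0 < S.q) (hq₁ : S.q < 1) (hk : S.kind = .AW) (t : VType) (y : ℂ) :
    S.fac t y = S.qbr (S.lam (S.pair t).1 + I * y / (Real.log S.q : ℂ))
      * S.qbr (S.lam (S.pair t).2 + I * y / (Real.log S.q : ℂ)) := by
  simp only [fac, hk, lin_eq_qbr S hq₀ hq₁ hk, pairSum]
  have : Complex.exp (-((Real.log S.q : ℂ) / 2 * (S.lam (S.pair t).1 + S.lam (S.pair t).2)) - I * y)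
      * Complex.exp ((Real.log S.q : ℂ) / 2 * S.lam (S.pair t).1 + I * y / 2)
      * Complex.exp ((Real.log S.q : ℂ) / 2 * S.lam (S.pair t).2 + I * y / 2) = 1 := by
    rw [← Complex.exp_add, ← Complex.exp_add, ← Complex.exp_zero]
    congr 1
    ring
  linear_combination (S.qbr (S.lam (S.pair t).1 + I * y / (Real.log S.q : ℂ))
      * S.qbr (S.lam (S.pair t).2 + I * y / (Real.log S.q : ℂ))) * this

theorem phi_eq_qbr (hq₀ : 0 < S.q) (hq₁ : S.q < 1) (hk : S.kind = .AW) (y : ℂ) :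
    S.phi y = I * S.qbr (2 * (I * y / (Real.log S.q : ℂ))) := by
  have hl : (Real.log S.q : ℂ) ≠ 0 := by exact_mod_cast S.log_q_ne hq₀ hq₁
  simp only [phi, hk, qbr, Complex.sin]
  push_cast
  rw [show (Real.log S.q : ℂ) / 2 * (2 * (I * y / (Real.log S.q : ℂ))) = y * I by field_simp]
  ring_nf

/-- This one relation per type is all that is used about the polynomials apart from `P_zero`. The
factors `I` and the exponentials in `fac` are chosen so that it has the same form for all three
systems. -/
theorem facStar_mul_P_sub (hq₀ : 0 < S.q) (hq₁ : S.q < 1) (t : VType) (n : ℕ) (y : ℂ) :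
    S.facStar t (y - I * S.gam / 2) * S.P n (y + I * S.gam / 2)
      - S.fac t (y + I * S.gam / 2) * S.P n (y - I * S.gam / 2)
      = S.fwd t n * S.phi y * (S.shift t).P n y := by
  have hI : I * (I / 2) = -1 / 2 := by rw [← mul_div_assoc, I_mul_I]
  rcases hk : S.kind with _ | _ | _
  · have hk' : (S.shift t).kind = .cH := hk
    rw [S.P_eq_hahnSum hk, S.P_eq_hahnSum hk, (S.shift t).P_eq_hahnSum hk']
    simp only [facStar, fac, hk, gam, lin, phi, fwd, pairSum, mul_one]
    rcases t with _ | _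
    · have := hahnSum_shift_fst (S.lam 0) (S.lam 1) (S.lam 2) (S.lam 3) n (I * y)
      simp only [shift, deltaTilde, pair, hk]
      simp only [Fin.reduceEq, or_false, or_true, if_true, if_false, or_self]
      rw [show I * (y + I / 2) = I * y - 1 / 2 by linear_combination hI,
        show I * (y - I / 2) = I * y + 1 / 2 by linear_combination -hI,
        show I * -(y - I / 2) = -(I * y) - 1 / 2 by linear_combination hI]
      ring_nf at this ⊢
      linear_combination (-I * I ^ n * (n.factorial : ℂ)⁻¹) * this
    · have := hahnSum_shift_snd (S.lam 0) (S.lam 1) (S.lam 2) (S.lam 3) n (I * y)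
      simp only [shift, deltaTilde, pair, hk]
      simp only [Fin.reduceEq, or_false, or_true, if_true, if_false, or_self]
      rw [show I * (y + I / 2) = I * y - 1 / 2 by linear_combination hI,
        show I * (y - I / 2) = I * y + 1 / 2 by linear_combination -hI,
        show I * -(y - I / 2) = -(I * y) - 1 / 2 by linear_combination hI]
      ring_nf at this ⊢
      linear_combination (-I * I ^ n * (n.factorial : ℂ)⁻¹) * this
  · have hk' : (S.shift t).kind = .W := hk
    rw [S.P_eq_wilsonSum hk, S.P_eq_wilsonSum hk, (S.shift t).P_eq_wilsonSum hk']
    simp only [facStar, fac, hk, gam, lin, phi, fwd, pairSum, mul_one]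
    rw [show I * (y + I / 2) = I * y - 1 / 2 by linear_combination hI,
        show I * (y - I / 2) = I * y + 1 / 2 by linear_combination -hI,
        show I * -(y - I / 2) = -(I * y) - 1 / 2 by linear_combination hI]
    rcases t with _ | _
    · have := wilsonSum_shift_fst isBracket_id (S.lam 0) (S.lam 1) (S.lam 2) (S.lam 3) n (I * y)
      simp only [shift, deltaTilde, pair, hk]
      simp only [Fin.reduceEq, or_false, or_true, if_true, if_false, or_self]
      ring_nf at this ⊢
      linear_combination this
    · have := wilsonSum_shift_snd isBracket_id (S.lam 0) (S.lam 1) (S.lam 2) (S.lam 3) n (I * y)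
      simp only [shift, deltaTilde, pair, hk]
      simp only [Fin.reduceEq, or_false, or_true, if_true, if_false, or_self]
      ring_nf at this ⊢
      linear_combination this
  · have hk' : (S.shift t).kind = .AW := hk
    have hl : (Real.log S.q : ℂ) ≠ 0 := by exact_mod_cast S.log_q_ne hq₀ hq₁
    -- The entries of `deltaTilde` add up to zero, so the constant of `P_eq_qWilsonSum` is the same
    -- on both sides.
    have hsum : ∑ m, (S.shift t).lam m = ∑ m, S.lam m := by
      rcases t with _ | _ <;> simp [shift, Fin.sum_univ_four, deltaTilde, pair, hk] <;> ring
    rw [S.P_eq_qWilsonSum hq₀ hq₁ hk, S.P_eq_qWilsonSum hq₀ hq₁ hk,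
      (S.shift t).P_eq_qWilsonSum hq₀ hq₁ hk', hsum, S.phi_eq_qbr hq₀ hq₁ hk]
    have hbr : (S.shift t).qbr = S.qbr := rfl
    have hqq : (S.shift t).q = S.q := rfl
    simp only [facStar, hk, S.fac_eq_qbr hq₀ hq₁ hk, gam, fwd, pairSum, hbr, hqq]
    have e1 : I * (y + I * (Real.log S.q : ℂ) / 2) / (Real.log S.q : ℂ)
        = I * y / (Real.log S.q : ℂ) - 1 / 2 := by
      field_simp
      linear_combination (Real.log S.q : ℂ) * I_sq
    have e2 : I * (y - I * (Real.log S.q : ℂ) / 2) / (Real.log S.q : ℂ)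
        = I * y / (Real.log S.q : ℂ) + 1 / 2 := by
      field_simp
      linear_combination -(Real.log S.q : ℂ) * I_sq
    rw [show I * -(y - I * (Real.log S.q : ℂ) / 2) / (Real.log S.q : ℂ)
      = -(I * (y - I * (Real.log S.q : ℂ) / 2) / (Real.log S.q : ℂ)) by ring, e1, e2]
    generalize I * y / (Real.log S.q : ℂ) = w
    generalize Complex.exp ((Real.log S.q : ℂ) * (n * (∑ m, S.lam m) / 2 + 3 * n * (n - 1) / 4)) = c
    have hI2 := I_mul_I
    rcases t with _ | _
    · have := wilsonSum_shift_fst (S.isBracket_qbr hq₀ hq₁) (S.lam 0) (S.lam 1) (S.lam 2) (S.lam 3)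
        n w
      simp only [shift, deltaTilde, pair, hk]
      simp only [Fin.reduceEq, or_false, or_true, if_true, if_false, or_self]
      ring_nf at this hI2 ⊢
      rw [hI2]
      linear_combination c * this
    · have := wilsonSum_shift_snd (S.isBracket_qbr hq₀ hq₁) (S.lam 0) (S.lam 1) (S.lam 2) (S.lam 3)
        n w
      simp only [shift, deltaTilde, pair, hk]
      simp only [Fin.reduceEq, or_false, or_true, if_true, if_false, or_self]
      ring_nf at this hI2 ⊢
      rw [hI2]
      linear_combination c * this

end System

end

/-! ### Factorized potentials, twisted and shifted parameters, second order equations. -/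

noncomputable section

namespace System

variable (S : System)

/-- The factor that relates the potential functions to the symmetric factors `fac`. -/
def sig : ℂ :=
  match S.kind with
  | .cH => 1
  | .W => 1
  | .AW => Complex.exp ((Real.log S.q : ℂ) / 2 * ((∑ k, S.lam k) - 1))

theorem sig_ne_zero : S.sig ≠ 0 := by
  rcases hk : S.kind <;> simp [sig, hk, Complex.exp_ne_zero]

theorem phi_neg (hk : S.kind ≠ .cH) (y : ℂ) : S.phi (-y) = -S.phi y := by
  rcases h : S.kind <;> simp_all [phi]

theorem one_sub_exp (y : ℂ) :
    1 - Complex.exp (2 * I * y) = -I * Complex.exp (I * y) * (2 * Complex.sin y) := by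
  have h : Complex.exp (I * y) * Complex.exp (-(I * y)) = 1 := by
    rw [← Complex.exp_add]
    simp
  have h2 : Complex.exp (2 * I * y) = Complex.exp (I * y) * Complex.exp (I * y) := by
    rw [← Complex.exp_add]
    ring_nf
  rw [h2, Complex.sin, show -y * I = -(I * y) by ring, show y * I = I * y by ring]
  linear_combination -h + (Complex.exp (I * y) * Complex.exp (-(I * y))
    - Complex.exp (I * y) * Complex.exp (I * y)) * I_sq

theorem Vden_eq (hq : 0 < S.q) (y : ℂ) :
    S.Vden y = -(match S.kind with
      | .cH => -1
      | .W => 1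
      | .AW => Complex.exp ((Real.log S.q : ℂ) / 2 + 2 * (I * y)))
      * (S.phi y * S.phi (y - I * S.gam / 2)) := by
  rcases hk : S.kind with _ | _ | _
  · simp [Vden, phi, hk]
  · simp only [Vden, phi, gam, hk]
    linear_combination (4 * y ^ 2) * I_sq
  · simp only [Vden, phi, gam, hk]
    have hq' : (S.q : ℂ) = Complex.exp (Real.log S.q : ℂ) := by
      rw [← Complex.ofReal_exp, Real.exp_log hq]
    have e : (S.q : ℂ) * Complex.exp (2 * I * y)
        = Complex.exp (2 * I * (y - I * (Real.log S.q : ℂ) / 2)) := by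
      rw [hq', ← Complex.exp_add]
      congr 1
      linear_combination (Real.log S.q : ℂ) * I_sq
    rw [e, one_sub_exp, one_sub_exp]
    have e2 : Complex.exp (I * y) * Complex.exp (I * (y - I * (Real.log S.q : ℂ) / 2))
        = Complex.exp ((Real.log S.q : ℂ) / 2 + 2 * (I * y)) := by
      rw [← Complex.exp_add]
      congr 1
      linear_combination (-(Real.log S.q : ℂ) / 2) * I_sq
    rw [← e2]
    ring_nf
    rw [I_sq]
    ring

/-- The potential is a product of one factor per type. The exponentials that make `fac` symmetric
cancel against those of the denominator up to the constant `sig`. -/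
theorem V_eq (hq : 0 < S.q) (y : ℂ) :
    S.V y = -(S.sig * (S.fac .one y * S.fac .two y) / (S.phi y * S.phi (y - I * S.gam / 2))) := by
  have h := S.Vden_eq hq y
  rcases hk : S.kind with _ | _ | _
  · simp only [V, sig, fac, hk, phi, pair]
    linear_combination (S.lin (S.lam 0) y * S.lin (S.lam 1) y) * I_sq
  · simp only [Vden, hk] at h
    simp only [V, hk]
    rw [h]
    simp only [sig, fac, hk, pair, Fin.prod_univ_four]
    rw [neg_mul, div_neg]
    ring_nf
  · simp only [Vden, hk] at h
    simp only [V, hk]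
    rw [h]
    simp only [sig, fac, hk, pair, Fin.prod_univ_four, pairSum, Fin.sum_univ_four]
    have e : Complex.exp ((Real.log S.q : ℂ) / 2 * (S.lam 0 + S.lam 1 + S.lam 2 + S.lam 3 - 1))
        * Complex.exp (-((Real.log S.q : ℂ) / 2 * (S.lam 0 + S.lam 1)) - I * y)
        * Complex.exp (-((Real.log S.q : ℂ) / 2 * (S.lam 2 + S.lam 3)) - I * y)
        = (Complex.exp ((Real.log S.q : ℂ) / 2 + 2 * (I * y)))⁻¹ := by
      rw [← Complex.exp_neg, ← Complex.exp_add, ← Complex.exp_add]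
      congr 1
      ring
    rw [neg_mul, div_neg, div_mul_eq_div_div, div_eq_mul_inv (S.lin _ _ * _ * _ * _), ← e]
    ring

theorem Vstar_eq (hq : 0 < S.q) (y : ℂ) :
    S.Vstar y = -(S.sig * (S.facStar .one y * S.facStar .two y)
      / (S.phi y * S.phi (y + I * S.gam / 2))) := by
  rcases hk : S.kind with _ | _ | _
  · simp only [Vstar, sig, facStar, hk, phi, pair]
    linear_combination (S.lin (S.lam 2) (-y) * S.lin (S.lam 3) (-y)) * I_sq
  · have e := S.phi_neg (by simp [hk]) (y + I * S.gam / 2)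
    rw [show -(y + I * S.gam / 2) = -y - I * S.gam / 2 by ring] at e
    simp only [Vstar, hk, facStar, S.V_eq hq, S.phi_neg (by simp [hk] : S.kind ≠ .cH) y, e]
    simp
  · have e := S.phi_neg (by simp [hk]) (y + I * S.gam / 2)
    rw [show -(y + I * S.gam / 2) = -y - I * S.gam / 2 by ring] at e
    simp only [Vstar, hk, facStar, S.V_eq hq, S.phi_neg (by simp [hk] : S.kind ≠ .cH) y, e]
    simp

theorem lin_add (hq : 0 < S.q) (b c y : ℂ) : S.lin (b + c) y = S.lin b (y - I * c * S.gam) := by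
  rcases hk : S.kind with _ | _ | _
  · simp only [lin, gam, hk]
    linear_combination c * I_sq
  · simp only [lin, gam, hk]
    linear_combination c * I_sq
  · simp only [lin, gam, hk, cpow_q S hq, ← Complex.exp_add]
    congr 2
    linear_combination c * (Real.log S.q : ℂ) * I_sq

theorem qbr_neg (u : ℂ) : S.qbr (-u) = -S.qbr u := by
  simp [qbr]

/-- A parameter `λ` becomes `1 - λ`, and the brackets are odd. So the twist exchanges `fac` and
`facStar` of its own type and moves the argument by one lattice step. -/
theorem twist_fac (hq₀ : 0 < S.q) (hq₁ : S.q < 1) (t : VType) (y : ℂ) :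
    (S.twist t).fac t y = S.facStar t (y - I * S.gam) := by
  rcases hk : S.kind with _ | _ | _
  · cases t <;> simp [twist, fac, facStar, hk, pair, lin, gam] <;> linear_combination I * I_sq
  · cases t <;> simp [twist, fac, facStar, hk, pair, lin, gam]
    · linear_combination (-S.lam 0 - S.lam 1 + 2 * I * y + 1 - I ^ 2) * I_sq
    · linear_combination (-S.lam 2 - S.lam 3 + 2 * I * y + 1 - I ^ 2) * I_sq
  · have hl : (Real.log S.q : ℂ) ≠ 0 := by exact_mod_cast S.log_q_ne hq₀ hq₁
    have hk' : (S.twist t).kind = .AW := hk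
    have e : I * -(y - I * S.gam) / (Real.log S.q : ℂ) = -(I * y / (Real.log S.q : ℂ)) - 1 := by
      simp only [gam, hk]
      field_simp
      linear_combination (Real.log S.q : ℂ) * I_sq
    simp only [facStar, hk, S.fac_eq_qbr hq₀ hq₁ hk, (S.twist t).fac_eq_qbr hq₀ hq₁ hk', e]
    have hbr : (S.twist t).qbr = S.qbr := rfl
    have hqq : (S.twist t).q = S.q := rfl
    rw [hbr, hqq, ← neg_mul_neg, ← qbr_neg, ← qbr_neg]
    cases t <;> simp [twist, pair, hk] <;> ring_nf

theorem twist_facStar (hq₀ : 0 < S.q) (hq₁ : S.q < 1) (t : VType) (y : ℂ) :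
    (S.twist t).facStar t y = S.fac t (y + I * S.gam) := by
  rcases hk : S.kind with _ | _ | _
  · cases t <;> simp [twist, fac, facStar, hk, pair, lin, gam] <;> linear_combination -I * I_sq
  · have h := S.twist_fac hq₀ hq₁ t (-y)
    have hk' : (S.twist t).kind = .W := hk
    simp only [facStar, hk, hk'] at h ⊢
    rw [h]
    ring_nf
  · have h := S.twist_fac hq₀ hq₁ t (-y)
    have hk' : (S.twist t).kind = .AW := hk
    simp only [facStar, hk, hk'] at h ⊢
    rw [h]
    ring_nf

theorem twist_other_fac (t : VType) (y : ℂ) :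
    (S.twist t).fac t.other y = S.fac t.other y := by
  rcases hk : S.kind with _ | _ | _ <;>
  cases t <;> simp [twist, fac, hk, pair, lin, VType.other, pairSum]

theorem twist_other_facStar (t : VType) (y : ℂ) :
    (S.twist t).facStar t.other y = S.facStar t.other y := by
  rcases hk : S.kind with _ | _ | _ <;>
  cases t <;> simp [twist, fac, facStar, hk, pair, lin, VType.other, pairSum]

theorem shift_other_fac (hq₀ : 0 < S.q) (hq₁ : S.q < 1) (t : VType) (y : ℂ) :
    (S.shift t).fac t.other (y + I * S.gam / 2) = S.fac t.other y := by
  rcases hk : S.kind with _ | _ | _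
  · cases t <;> simp [shift, fac, hk, pair, lin, VType.other, deltaTilde, gam] <;>
      linear_combination (1 / 2) * I_sq
  · have e : I * (y + I * S.gam / 2) = I * y - 1 / 2 := by
      simp only [gam, hk]
      linear_combination I_sq / 2
    cases t <;> simp [shift, fac, hk, pair, lin, VType.other, deltaTilde, e]
  · have hl : (Real.log S.q : ℂ) ≠ 0 := by exact_mod_cast S.log_q_ne hq₀ hq₁
    have hk' : (S.shift t).kind = .AW := hk
    have e : I * (y + I * S.gam / 2) / (Real.log S.q : ℂ) = I * y / (Real.log S.q : ℂ) - 1 / 2 := by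
      simp only [gam, hk]
      field_simp
      linear_combination (Real.log S.q : ℂ) * I_sq
    have hbr : (S.shift t).qbr = S.qbr := rfl
    have hqq : (S.shift t).q = S.q := rfl
    rw [S.fac_eq_qbr hq₀ hq₁ hk, (S.shift t).fac_eq_qbr hq₀ hq₁ hk', hbr, hqq, e]
    cases t <;> simp [shift, hk, pair, VType.other, deltaTilde]

theorem shift_other_facStar (hq₀ : 0 < S.q) (hq₁ : S.q < 1) (t : VType) (y : ℂ) :
    (S.shift t).facStar t.other (y - I * S.gam / 2) = S.facStar t.other y := by
  rcases hk : S.kind with _ | _ | _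
  · cases t <;> simp [shift, facStar, hk, pair, lin, VType.other, deltaTilde, gam] <;>
      linear_combination (1 / 2) * I_sq
  · have h := S.shift_other_fac hq₀ hq₁ t (-y)
    have hk' : (S.shift t).kind = .W := hk
    simp only [facStar, hk, hk']
    rw [← h]
    ring_nf
  · have h := S.shift_other_fac hq₀ hq₁ t (-y)
    have hk' : (S.shift t).kind = .AW := hk
    simp only [facStar, hk, hk']
    rw [← h]
    ring_nf

theorem shift_shift_other (t : VType) : (S.shift t).shift t.other = S := by
  have : ∀ k, ((S.shift t).shift t.other).lam k = S.lam k := by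
    intro k
    rcases hk : S.kind with _ | _ | _ <;> cases t <;> fin_cases k <;>
      simp [shift, deltaTilde, pair, hk, VType.other] <;> ring
  exact System.mk.injEq .. |>.mpr ⟨rfl, rfl, funext this⟩

/-- On the pair of the type, `1 - λ - 1/2 = 1 - (λ + 1/2)`. Hence the shift relation of a virtual
state leads to the virtual state of the system at `λ + δ`. -/
theorem twist_shift (t : VType) : (S.twist t).shift t = S.plusDelta.twist t := by
  have : ∀ k, ((S.twist t).shift t).lam k = (S.plusDelta.twist t).lam k := by
    intro k
    rcases hk : S.kind with _ | _ | _ <;> cases t <;> fin_cases k <;>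
      simp [shift, deltaTilde, pair, hk, twist, plusDelta] <;> ring
  exact System.mk.injEq .. |>.mpr ⟨rfl, rfl, funext this⟩

theorem P_zero (y : ℂ) : S.P 0 y = 1 := by
  rcases hk : S.kind with _ | _ | _ <;> simp [P, hk, poch]

/-- The eigenvalue of the composition of two shift relations. -/
def fwdProd (t : VType) (n : ℕ) : ℂ := S.fwd t n * (S.shift t).fwd t.other n

/-- Going from `λ` to `λ + δ̃` with one type and back with the other. The relation of type `t` at `y
+ iγ/2` and `y - iγ/2` gives the shifted polynomial there, and the relation of the other type takes
these two values back to `P n y`. The diagonal coefficient does not depend on `n`. -/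
theorem shift_comp (hq₀ : 0 < S.q) (hq₁ : S.q < 1) (t : VType) (n : ℕ) (y : ℂ)
    (h0 : S.phi y ≠ 0) (h1 : S.phi (y + I * S.gam / 2) ≠ 0) (h2 : S.phi (y - I * S.gam / 2) ≠ 0) :
    S.fac t y * S.fac t.other y / (S.phi y * S.phi (y - I * S.gam / 2)) * S.P n (y - I * S.gam)
      + S.facStar t y * S.facStar t.other y / (S.phi y * S.phi (y + I * S.gam / 2))
        * S.P n (y + I * S.gam)
      - (S.facStar t.other y * S.fac t (y + I * S.gam) / S.phi (y + I * S.gam / 2)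
        + S.fac t.other y * S.facStar t (y - I * S.gam) / S.phi (y - I * S.gam / 2)) / S.phi y
        * S.P n y
      = S.fwdProd t n * S.P n y := by
  have r1 := S.facStar_mul_P_sub hq₀ hq₁ t n (y + I * S.gam / 2)
  have r2 := S.facStar_mul_P_sub hq₀ hq₁ t n (y - I * S.gam / 2)
  have r3 := (S.shift t).facStar_mul_P_sub hq₀ hq₁ t.other n y
  have hg : (S.shift t).gam = S.gam := rfl
  have hphi : (S.shift t).phi = S.phi := rfl
  rw [hg, hphi, S.shift_other_fac hq₀ hq₁, S.shift_other_facStar hq₀ hq₁,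
    S.shift_shift_other] at r3
  rw [show y + I * S.gam / 2 - I * S.gam / 2 = y by ring,
    show y + I * S.gam / 2 + I * S.gam / 2 = y + I * S.gam by ring] at r1
  rw [show y - I * S.gam / 2 + I * S.gam / 2 = y by ring,
    show y - I * S.gam / 2 - I * S.gam / 2 = y - I * S.gam by ring] at r2
  rw [fwdProd]
  generalize S.phi (y + I * S.gam / 2) = φ1 at *
  generalize S.phi (y - I * S.gam / 2) = φ2 at *
  generalize S.phi y = φ0 at *
  field_simp
  linear_combination S.facStar t.other y * φ2 * r1 - S.fac t.other y * φ1 * r2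
    + S.fwd t n * φ1 * φ2 * r3

theorem pairSum_shift_other (t : VType) : (S.shift t).pairSum t.other = S.pairSum t.other + 1 := by
  rcases hk : S.kind with _ | _ | _ <;> cases t <;>
    simp [pairSum, shift, pair, deltaTilde, VType.other, hk] <;> ring

theorem pairSum_twist (t : VType) : (S.twist t).pairSum t = 2 - S.pairSum t := by
  rcases hk : S.kind with _ | _ | _ <;> cases t <;>
    simp [pairSum, twist, pair, hk] <;> ring

theorem pairSum_twist_other (t : VType) : (S.twist t).pairSum t.other = S.pairSum t.other := by
  rcases hk : S.kind with _ | _ | _ <;> cases t <;>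
    simp [pairSum, twist, pair, VType.other, hk]

theorem sum_lam (t : VType) : ∑ k, S.lam k = S.pairSum t + S.pairSum t.other := by
  rcases hk : S.kind with _ | _ | _ <;> cases t <;>
    simp [pairSum, pair, VType.other, hk, Fin.sum_univ_four] <;> ring

theorem energy_eq (hq₀ : 0 < S.q) (n : ℕ) :
    S.energy n = -S.sig * (S.fwdProd .one n - S.fwdProd .one 0) := by
  have h1 := S.pairSum_shift_other .one
  have h2 := S.sum_lam .one
  simp only [VType.other] at h1 h2
  have hk' : (S.shift .one).kind = S.kind := rfl
  have hq' : (S.shift .one).q = S.q := rfl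
  rcases hk : S.kind with _ | _ | _
  · simp only [energy, sig, fwdProd, fwd, hk, hk', h1, h2, VType.other]
    push_cast
    linear_combination (n * (n + S.pairSum .one + S.pairSum .two - 1)) * I_sq
  · simp only [energy, sig, fwdProd, fwd, hk, hk', h1, h2, VType.other]
    push_cast
    linear_combination (n * (n + S.pairSum .one + S.pairSum .two - 1)) * I_sq
  · simp only [energy, sig, fwdProd, fwd, hk, hk', h1, h2, VType.other, qbr, cpow_q S hq₀, hq']
    push_cast
    have hγ : (Real.log S.q : ℂ) = (Real.log S.q : ℂ) / 2 + (Real.log S.q : ℂ) / 2 := by ring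
    generalize hc : (Real.log S.q : ℂ) / 2 = c at *
    rw [hγ]
    simp only [mul_add, add_mul, mul_sub, neg_add, neg_sub, Complex.exp_add, Complex.exp_sub,
      Complex.exp_neg, mul_neg, mul_one, mul_zero, Complex.exp_zero]
    have x1 := Complex.exp_ne_zero c
    have x2 := Complex.exp_ne_zero (c * n)
    have x3 := Complex.exp_ne_zero (c * S.pairSum .one)
    have x4 := Complex.exp_ne_zero (c * S.pairSum .two)
    field_simp
    ring_nf
    simp only [I_sq]
    ring

theorem virtEnergy_eq (hq₀ : 0 < S.q) (d : Label) :
    S.virtEnergy d = -S.sig * (S.twist d.2).fwdProd d.2 d.1 := by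
  obtain ⟨v, t⟩ := d
  have h1 := (S.twist t).pairSum_shift_other t
  rw [pairSum_twist_other] at h1
  have h2 := S.sum_lam t
  have h3 := S.pairSum_twist t
  have hk' : (S.twist t).kind = S.kind := rfl
  have hk'' : ((S.twist t).shift t).kind = S.kind := rfl
  have hq' : (S.twist t).q = S.q := rfl
  have hq'' : ((S.twist t).shift t).q = S.q := rfl
  rcases hk : S.kind with _ | _ | _
  · simp only [virtEnergy, lin, sig, fwdProd, fwd, hk, hk', hk'', h1, h3]
    linear_combination ((1 - S.pairSum t + v) * (S.pairSum t.other + v)) * I_sq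
  · simp only [virtEnergy, lin, sig, fwdProd, fwd, hk, hk', hk'', h1, h3]
    linear_combination ((1 - S.pairSum t + v) * (S.pairSum t.other + v)) * I_sq
  · simp only [virtEnergy, lin, sig, fwdProd, fwd, hk, hk', hk'', h1, h2, h3, qbr, cpow_q S hq₀,
      hq', hq'']
    push_cast
    have hγ : (Real.log S.q : ℂ) = (Real.log S.q : ℂ) / 2 + (Real.log S.q : ℂ) / 2 := by ring
    generalize hc : (Real.log S.q : ℂ) / 2 = c at *
    rw [hγ]
    simp only [mul_add, add_mul, mul_sub, neg_sub, Complex.exp_add, Complex.exp_sub, mul_one, mul_zero, Complex.exp_zero, mul_two]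
    have x1 := Complex.exp_ne_zero c
    have x2 := Complex.exp_ne_zero (c * v)
    have x3 := Complex.exp_ne_zero (c * S.pairSum t)
    have x4 := Complex.exp_ne_zero (c * S.pairSum t.other)
    field_simp
    ring_nf
    simp only [I_sq]
    ring

end System

end

/-! ### The lattice, the gauge factors and the common difference equation. -/

noncomputable section

namespace System

variable (S : System)

/-- The lattice `y₀ - i j γ`. -/
def lat (y₀ : ℂ) (j : ℕ) : ℂ := y₀ - I * j * S.gam

/-- The function `φ` on the half lattice `y₀ - i s γ / 2`. -/
def phiLat (y₀ : ℂ) (s : ℕ) : ℂ := S.phi (y₀ - I * (s / 2) * S.gam)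

theorem lat_succ (y₀ : ℂ) (j : ℕ) : S.lat y₀ (j + 1) = S.lat y₀ j - I * S.gam := by
  simp only [lat]
  push_cast
  ring

theorem phi_lat (y₀ : ℂ) (j : ℕ) : S.phi (S.lat y₀ j) = S.phiLat y₀ (2 * j) := by
  simp [lat, phiLat]

theorem phi_lat_sub (y₀ : ℂ) (j : ℕ) :
    S.phi (S.lat y₀ j - I * S.gam / 2) = S.phiLat y₀ (2 * j + 1) := by
  simp only [lat, phiLat]
  push_cast
  ring_nf

theorem phi_lat_add (y₀ : ℂ) (j : ℕ) :
    S.phi (S.lat y₀ (j + 1) + I * S.gam / 2) = S.phiLat y₀ (2 * j + 1) := by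
  rw [← phi_lat_sub, lat_succ]
  ring_nf

/-- None of the factors in question vanishes on the first `L + 1` points of the lattice. -/
structure IsGeneric (y₀ : ℂ) (L : ℕ) : Prop where
  fac_ne : ∀ t, ∀ j ≤ L, S.fac t (S.lat y₀ j) ≠ 0
  facStar_ne : ∀ t, ∀ j ≤ L, S.facStar t (S.lat y₀ j) ≠ 0
  phi_ne : ∀ s ≤ 2 * L + 1, S.phiLat y₀ s ≠ 0

/-- The gauge factor of a type on the lattice. -/
def theta (t : VType) (y₀ : ℂ) (j : ℕ) : ℂ :=
  ∏ i ∈ Finset.range j, S.fac t (S.lat y₀ i) / S.facStar t (S.lat y₀ (i + 1))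

variable {S}

theorem theta_succ {t : VType} {y₀ : ℂ} {j L : ℕ} (h : S.IsGeneric y₀ L) (hj : j < L) :
    S.theta t y₀ (j + 1) * S.facStar t (S.lat y₀ (j + 1))
      = S.theta t y₀ j * S.fac t (S.lat y₀ j) := by
  have := h.facStar_ne t (j + 1) hj
  rw [theta, Finset.prod_range_succ, ← theta]
  field_simp

theorem theta_ne {t : VType} {y₀ : ℂ} {j L : ℕ} (h : S.IsGeneric y₀ L) (hj : j ≤ L) :
    S.theta t y₀ j ≠ 0 := by
  refine Finset.prod_ne_zero_iff.2 fun i hi => ?_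
  rw [Finset.mem_range] at hi
  exact div_ne_zero (h.fac_ne t i (by omega)) (h.facStar_ne t (i + 1) (by omega))

variable (S)

/-- The sequence that belongs to a virtual state. -/
def seqV (y₀ : ℂ) (d : Label) (j : ℕ) : ℂ := S.theta d.2.other y₀ j * S.xi d (S.lat y₀ j)

/-- The sequence that belongs to an eigenfunction. -/
def seqP (y₀ : ℂ) (n : ℕ) (j : ℕ) : ℂ :=
  S.theta .one y₀ j * S.theta .two y₀ j * S.P n (S.lat y₀ j)

/-- The coefficient of the shift to the right in the difference equation of `seqV` and `seqP`. -/
def coefR (y : ℂ) : ℂ :=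
  -S.sig * (S.facStar .one (y - I * S.gam) * S.facStar .two (y - I * S.gam))
    / (S.phi y * S.phi (y - I * S.gam / 2))

/-- The coefficient of the shift to the left in the difference equation of `seqV` and `seqP`. -/
def coefL (y : ℂ) : ℂ :=
  -S.sig * (S.fac .one (y + I * S.gam) * S.fac .two (y + I * S.gam))
    / (S.phi y * S.phi (y + I * S.gam / 2))

/-- The equation `shift_comp` minus its case `n = 0`. Since `P_0 = 1`, the latter evaluates the
diagonal coefficient, and the eigenvalue becomes the difference in `energy_eq`. -/
theorem difference_eq_P (hq₀ : 0 < S.q) (hq₁ : S.q < 1) (n : ℕ) (y : ℂ)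
    (h0 : S.phi y ≠ 0) (h1 : S.phi (y + I * S.gam / 2) ≠ 0) (h2 : S.phi (y - I * S.gam / 2) ≠ 0) :
    S.V y * S.P n (y - I * S.gam) + S.Vstar y * S.P n (y + I * S.gam)
      - (S.V y + S.Vstar y) * S.P n y = S.energy n * S.P n y := by
  have e1 := S.shift_comp hq₀ hq₁ .one n y h0 h1 h2
  have e2 := S.shift_comp hq₀ hq₁ .one 0 y h0 h1 h2
  simp only [P_zero] at e2
  simp only [VType.other] at e1 e2
  rw [S.V_eq hq₀, S.Vstar_eq hq₀, S.energy_eq hq₀]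
  linear_combination -S.sig * e1 + S.sig * S.P n y * e2

/-- This is `shift_comp` for the twisted system. There the twist turns the diagonal coefficient, up
to `-sig`, into `V + V*` of the untwisted system, so no case `n = 0` has to be subtracted and the
diagonal agrees with that of `difference_eq_P`. -/
theorem difference_eq_xi (hq₀ : 0 < S.q) (hq₁ : S.q < 1) (d : Label) (y : ℂ)
    (h0 : S.phi y ≠ 0) (h1 : S.phi (y + I * S.gam / 2) ≠ 0) (h2 : S.phi (y - I * S.gam / 2) ≠ 0) :
    -S.sig * (S.facStar d.2 (y - I * S.gam) * S.fac d.2.other y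
          / (S.phi y * S.phi (y - I * S.gam / 2))) * S.xi d (y - I * S.gam)
      - S.sig * (S.fac d.2 (y + I * S.gam) * S.facStar d.2.other y
          / (S.phi y * S.phi (y + I * S.gam / 2))) * S.xi d (y + I * S.gam)
      - (S.V y + S.Vstar y) * S.xi d y = S.virtEnergy d * S.xi d y := by
  have e1 := (S.twist d.2).shift_comp hq₀ hq₁ d.2 d.1 y h0 h1 h2
  have hphi : (S.twist d.2).phi = S.phi := rfl
  have hgam : (S.twist d.2).gam = S.gam := rfl
  simp only [S.twist_fac hq₀ hq₁, S.twist_facStar hq₀ hq₁, S.twist_other_fac,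
    S.twist_other_facStar, hphi, hgam, add_sub_cancel_right, sub_add_cancel] at e1
  have hV : S.V y + S.Vstar y = -S.sig * ((S.facStar d.2.other y * S.facStar d.2 y
      / S.phi (y + I * S.gam / 2) + S.fac d.2.other y * S.fac d.2 y
      / S.phi (y - I * S.gam / 2)) / S.phi y) := by
    rw [S.V_eq hq₀, S.Vstar_eq hq₀]
    rcases d with ⟨v, _ | _⟩ <;> simp only [VType.other] <;> field_simp <;> ring
  rw [hV, S.virtEnergy_eq hq₀]
  simp only [xi]
  linear_combination -S.sig * e1

variable {S}

/-- By `theta_succ` a step to the right trades `fac` at a place for `facStar` at the next one. Doing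
this for both types changes `V` and `V*` into `coefR` and `coefL`. -/
theorem isSol_seqP (hq₀ : 0 < S.q) (hq₁ : S.q < 1) {y₀ : ℂ} {L : ℕ} (h : S.IsGeneric y₀ (L + 1))
    (n : ℕ) :
    IsSol (fun j => S.coefR (S.lat y₀ j)) (fun j => S.coefL (S.lat y₀ j))
      (fun j => -(S.V (S.lat y₀ j) + S.Vstar (S.lat y₀ j))) L (S.energy n) (S.seqP y₀ n) := by
  intro j hj
  have p0 := h.phi_ne (2 * j + 2) (by omega)
  have p1 := h.phi_ne (2 * j + 1) (by omega)
  have p2 := h.phi_ne (2 * j + 3) (by omega)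
  have t1 := theta_succ (t := .one) h (show j < L + 1 by omega)
  have t2 := theta_succ (t := .two) h (show j < L + 1 by omega)
  have t1' := theta_succ (t := .one) h (show j + 1 < L + 1 by omega)
  have t2' := theta_succ (t := .two) h (show j + 1 < L + 1 by omega)
  have e := S.difference_eq_P hq₀ hq₁ n (S.lat y₀ (j + 1)) (by rwa [phi_lat])
    (by rwa [phi_lat_add]) (by rwa [phi_lat_sub])
  have hr : S.lat y₀ (j + 1) - I * S.gam = S.lat y₀ (j + 2) := (S.lat_succ y₀ (j + 1)).symm
  have hl : S.lat y₀ (j + 1) + I * S.gam = S.lat y₀ j := by rw [lat_succ]; ring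
  rw [S.V_eq hq₀, S.Vstar_eq hq₀, hr, hl, phi_lat, phi_lat_add, phi_lat_sub] at e
  simp only [coefR, coefL, seqP, hr, hl, phi_lat, phi_lat_add, phi_lat_sub, S.V_eq hq₀,
    S.Vstar_eq hq₀]
  rw [show 2 * (j + 1) + 1 = 2 * j + 3 by ring, show 2 * (j + 1) = 2 * j + 2 by ring] at *
  field_simp at e ⊢
  linear_combination (S.theta .one y₀ (j + 1) * S.theta .two y₀ (j + 1)) * e
    - S.sig * S.P n (S.lat y₀ (j + 2)) * S.phiLat y₀ (2 * j + 1)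
      * (S.theta .two y₀ (j + 2) * S.facStar .two (S.lat y₀ (j + 2)) * t1'
        + S.theta .one y₀ (j + 1) * S.fac .one (S.lat y₀ (j + 1)) * t2')
    + S.sig * S.P n (S.lat y₀ j) * S.phiLat y₀ (2 * j + 3)
      * (S.theta .two y₀ (j + 1) * S.facStar .two (S.lat y₀ (j + 1)) * t1
        + S.theta .one y₀ j * S.fac .one (S.lat y₀ j) * t2)

/-- In the equation of a virtual state the factors of its own type already stand where `coefR` and
`coefL` have them. Only the other type needs the gauge, which is why the column of a virtual state
carries `r` of the other type. -/
theorem isSol_seqV (hq₀ : 0 < S.q) (hq₁ : S.q < 1) {y₀ : ℂ} {L : ℕ} (h : S.IsGeneric y₀ (L + 1))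
    (d : Label) :
    IsSol (fun j => S.coefR (S.lat y₀ j)) (fun j => S.coefL (S.lat y₀ j))
      (fun j => -(S.V (S.lat y₀ j) + S.Vstar (S.lat y₀ j))) L (S.virtEnergy d)
      (S.seqV y₀ d) := by
  intro j hj
  have p0 := h.phi_ne (2 * j + 2) (by omega)
  have p1 := h.phi_ne (2 * j + 1) (by omega)
  have p2 := h.phi_ne (2 * j + 3) (by omega)
  have t1 := theta_succ (t := d.2.other) h (show j < L + 1 by omega)
  have t1' := theta_succ (t := d.2.other) h (show j + 1 < L + 1 by omega)
  have e := S.difference_eq_xi hq₀ hq₁ d (S.lat y₀ (j + 1)) (by rwa [phi_lat])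
    (by rwa [phi_lat_add]) (by rwa [phi_lat_sub])
  have hr : S.lat y₀ (j + 1) - I * S.gam = S.lat y₀ (j + 2) := (S.lat_succ y₀ (j + 1)).symm
  have hl : S.lat y₀ (j + 1) + I * S.gam = S.lat y₀ j := by rw [lat_succ]; ring
  have hR : S.coefR (S.lat y₀ (j + 1)) = -S.sig * (S.facStar d.2 (S.lat y₀ (j + 2))
      * S.facStar d.2.other (S.lat y₀ (j + 2)))
      / (S.phiLat y₀ (2 * j + 2) * S.phiLat y₀ (2 * j + 3)) := by
    rw [coefR, hr, phi_lat, phi_lat_sub]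
    rcases d with ⟨v, _ | _⟩ <;> simp only [VType.other] <;> ring_nf
  have hL : S.coefL (S.lat y₀ (j + 1)) = -S.sig * (S.fac d.2 (S.lat y₀ j)
      * S.fac d.2.other (S.lat y₀ j))
      / (S.phiLat y₀ (2 * j + 2) * S.phiLat y₀ (2 * j + 1)) := by
    rw [coefL, hl, phi_lat, phi_lat_add]
    rcases d with ⟨v, _ | _⟩ <;> simp only [VType.other] <;> ring_nf
  rw [hr, hl, phi_lat, phi_lat_add, phi_lat_sub] at e
  simp only [seqV, hR, hL]
  rw [show 2 * (j + 1) + 1 = 2 * j + 3 by ring, show 2 * (j + 1) = 2 * j + 2 by ring] at *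
  generalize S.V (S.lat y₀ (j + 1)) + S.Vstar (S.lat y₀ (j + 1)) = b at *
  field_simp at e ⊢
  linear_combination (S.theta d.2.other y₀ (j + 1)) * e
    - S.sig * S.xi d (S.lat y₀ (j + 2)) * S.phiLat y₀ (2 * j + 1)
      * S.facStar d.2 (S.lat y₀ (j + 2)) * t1'
    + S.sig * S.xi d (S.lat y₀ j) * S.phiLat y₀ (2 * j + 3)
      * S.fac d.2 (S.lat y₀ j) * t1

end System

end

/-! ### The entries and denominators of the determinants as products over a window. -/

noncomputable section

namespace System

variable (S : System)

/-- The centre of the window `a, …, a + N - 1` of the lattice. -/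
def cen (y₀ : ℂ) (a N : ℕ) : ℂ := y₀ - I * (a + ((N : ℂ) - 1) / 2) * S.gam

theorem node_cen (y₀ : ℂ) (a N : ℕ) (j : Fin N) :
    S.node (S.cen y₀ a N) j = S.lat y₀ (a + j) := by
  simp only [node, cen, lat]
  push_cast
  ring

/-- The offset `-(N - 1)/2` of the parameter undoes the distance from the centre of the window to
its ends: the factors sit at the successive places from the left end. With `-x` in `poch_neg_cen`
they are counted from the right end. -/
theorem poch_cen (hq : 0 < S.q) (b y₀ : ℂ) (a N m : ℕ) :
    S.poch (b + -((N : ℂ) - 1) / 2) (S.cen y₀ a N) m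
      = ∏ i ∈ Finset.range m, S.lin b (S.lat y₀ (a + i)) := by
  refine Finset.prod_congr rfl fun i _ => ?_
  rw [add_assoc, S.lin_add hq]
  congr 1
  simp only [cen, lat]
  push_cast
  ring

theorem poch_neg_cen (hq : 0 < S.q) (b y₀ : ℂ) (a N m : ℕ) (hm : m ≤ N) :
    S.poch (b + -((N : ℂ) - 1) / 2) (-S.cen y₀ a N) m
      = ∏ i ∈ Finset.range m, S.lin b (-S.lat y₀ (a + N - 1 - i)) := by
  refine Finset.prod_congr rfl fun i hi => ?_
  rw [Finset.mem_range] at hi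
  rw [add_assoc, S.lin_add hq]
  congr 1
  obtain ⟨k, rfl⟩ := Nat.exists_eq_add_of_lt (show i < N by omega)
  rw [show a + (i + k + 1) - 1 - i = a + k by omega]
  simp only [cen, lat]
  push_cast
  ring

theorem prod_exp_linear (A B : ℂ) (m : ℕ) :
    ∏ i ∈ Finset.range m, Complex.exp (A + B * i) = Complex.exp (m * A + B * (m * (m - 1) / 2)) := by
  induction m with
  | zero => simp
  | succ m ih =>
    rw [Finset.prod_range_succ, ih, ← Complex.exp_add]
    congr 1
    push_cast
    ring

/-- The factor between `pairPoch` and the product of the symmetric factors. -/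
def pochScale (t : VType) (N m n : ℕ) (x : ℂ) : ℂ :=
  match S.kind with
  | .cH => I ^ m * (-I) ^ n
  | .W => 1
  | .AW => Complex.exp (-((Real.log S.q : ℂ) / 2 * S.pairSum t) * (m + n) + I * x * (n - m)
      + (Real.log S.q : ℂ) / 2 * ((m + n) * (N - 1) - m * (m - 1) - n * (n - 1)))

theorem pairPoch_cen (hq : 0 < S.q) (t : VType) (y₀ : ℂ) (a N m n : ℕ) (hn : n ≤ N) :
    S.pochScale t N m n (S.cen y₀ a N) * S.pairPoch t (-((N : ℂ) - 1) / 2) m n (S.cen y₀ a N)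
      = (∏ i ∈ Finset.range m, S.fac t (S.lat y₀ (a + i)))
        * ∏ i ∈ Finset.range n, S.facStar t (S.lat y₀ (a + N - 1 - i)) := by
  rcases hk : S.kind with _ | _ | _
  · simp only [pochScale, pairPoch, fac, facStar, hk, S.poch_cen hq, S.poch_neg_cen hq _ _ _ _ _ hn,
      Finset.prod_mul_distrib, Finset.prod_const, Finset.card_range]
    ring
  · simp only [pochScale, pairPoch, fac, facStar, hk, S.poch_cen hq, S.poch_neg_cen hq _ _ _ _ _ hn,
      Finset.prod_mul_distrib]
    ring
  · simp only [pochScale, pairPoch, fac, facStar, hk, S.poch_cen hq, S.poch_neg_cen hq _ _ _ _ _ hn,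
      Finset.prod_mul_distrib]
    have e1 : ∏ i ∈ Finset.range m, Complex.exp (-((Real.log S.q : ℂ) / 2 * S.pairSum t)
        - I * S.lat y₀ (a + i)) = Complex.exp (m * (-((Real.log S.q : ℂ) / 2 * S.pairSum t)
          - I * S.cen y₀ a N + (Real.log S.q : ℂ) / 2 * (N - 1))
          + -(Real.log S.q : ℂ) * (m * (m - 1) / 2)) := by
      rw [← prod_exp_linear]
      refine Finset.prod_congr rfl fun i _ => ?_
      congr 1
      simp only [lat, cen, gam, hk]
      push_cast
      linear_combination ((Real.log S.q : ℂ) * (i - (N - 1) / 2)) * I_sq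
    have e2 : ∏ i ∈ Finset.range n, Complex.exp (-((Real.log S.q : ℂ) / 2 * S.pairSum t)
        - I * -S.lat y₀ (a + N - 1 - i)) = Complex.exp (n * (-((Real.log S.q : ℂ) / 2 * S.pairSum t)
          + I * S.cen y₀ a N + (Real.log S.q : ℂ) / 2 * (N - 1))
          + -(Real.log S.q : ℂ) * (n * (n - 1) / 2)) := by
      rw [← prod_exp_linear]
      refine Finset.prod_congr rfl fun i hi => ?_
      rw [Finset.mem_range] at hi
      congr 1
      obtain ⟨k, rfl⟩ := Nat.exists_eq_add_of_lt (show i < N by omega)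
      rw [show a + (i + k + 1) - 1 - i = a + k by omega]
      simp only [lat, cen, gam, hk]
      push_cast
      linear_combination (-(Real.log S.q : ℂ) * (k - (i + k) / 2)) * I_sq
    rw [e1, e2]
    have e3 : ∀ A B C : ℂ, A = B + C → ∀ x₁ x₂ x₃ x₄ : ℂ, Complex.exp A * (x₁ * x₂ * (x₃ * x₄))
        = Complex.exp B * (x₁ * x₃) * (Complex.exp C * (x₂ * x₄)) := by
      rintro A B C rfl x₁ x₂ x₃ x₄
      rw [Complex.exp_add]
      ring
    apply e3
    ring

/-- The powers of `α` and `κ` and the phase in `r` are exactly `pochScale`, the factor that turns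
the shifted factorials into products of the symmetric factors. -/
theorem r_eq_prod (hq : 0 < S.q) (t : VType) (y₀ : ℂ) (a N : ℕ) (j : Fin N) :
    S.r t j (S.cen y₀ a N) = (∏ i ∈ Finset.range j, S.fac t (S.lat y₀ (a + i)))
        * ∏ i ∈ Finset.range (N - 1 - j), S.facStar t (S.lat y₀ (a + N - 1 - i)) := by
  rw [← S.pairPoch_cen hq t y₀ a N j (N - 1 - j) (by omega), r]
  congr 1
  obtain ⟨j, hj⟩ := j
  obtain ⟨n, rfl⟩ := Nat.exists_eq_add_of_lt hj
  simp only [show j + n + 1 - 1 - j = n by omega]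
  rcases hk : S.kind with _ | _ | _
  · simp only [alphaPow, kappa, phase, pochScale, hk]
    rw [← Complex.inv_I, inv_pow, ← zpow_natCast, ← zpow_natCast, ← div_eq_mul_inv,
      ← zpow_sub₀ I_ne_zero]
    simp
    congr 1
    ring
  · simp [alphaPow, kappa, phase, pochScale, hk]
  · simp only [alphaPow, kappa, phase, pochScale, hk, cpow_q S hq]
    have : (((S.q⁻¹ : ℝ) : ℂ)) = Complex.exp (-(Real.log S.q : ℂ)) := by
      rw [← Complex.ofReal_neg, ← Complex.ofReal_exp, Real.exp_neg, Real.exp_log hq]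
    rw [this, ← Complex.exp_int_mul, ← Complex.exp_add, ← Complex.exp_add]
    congr 1
    push_cast
    ring

/-- The constant factor of `normA`. -/
def normK (N j : ℕ) : ℂ :=
  match S.kind with
  | .cH => 1
  | .W => 1
  | .AW => Complex.exp ((Real.log S.q : ℂ) * (j * (j + 1) / 2 - j * (N - 1) + j * (j - 1)))

theorem normK_ne (N j : ℕ) : S.normK N j ≠ 0 := by
  rcases hk : S.kind <;> simp [normK, hk, Complex.exp_ne_zero]

theorem normK_zero (N : ℕ) : S.normK N 0 = 1 := by
  rcases hk : S.kind <;> simp [normK, hk]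

/-- The products of which the factors `normA` are composed. -/
def facProd (t : VType) (y₀ : ℂ) (a N j : ℕ) : ℂ :=
  ∏ i ∈ Finset.range j, S.fac t (S.lat y₀ (a + i)) * S.facStar t (S.lat y₀ (a + N - 1 - i))

theorem normC_mul_pairPoch (hq : 0 < S.q) (t : VType) (y₀ : ℂ) (a N j : ℕ) (hj : j ≤ N) :
    S.normC t j * S.pairPoch t (-((N : ℂ) - 1) / 2) j j (S.cen y₀ a N)
      = S.normK N j * S.facProd t y₀ a N j := by
  rw [facProd, Finset.prod_mul_distrib, ← S.pairPoch_cen hq t y₀ a N j j hj, ← mul_assoc]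
  congr 1
  rcases hk : S.kind with _ | _ | _
  · simp [normC, normK, pochScale, hk, ← mul_pow]
  · simp [normC, normK, pochScale, hk]
  · simp only [normC, normK, pochScale, hk, cpow_q S hq, ← Complex.exp_add]
    congr 1
    ring

/-- The product of `φ` over the midpoints of the pairs of points of a window. -/
def phiPairs (y₀ : ℂ) (a N : ℕ) : ℂ :=
  ∏ j ∈ Finset.range N, ∏ i ∈ Finset.range j, S.phiLat y₀ (2 * a + j + i)

theorem phiPairs_succ (y₀ : ℂ) (a N : ℕ) :
    S.phiPairs y₀ a (N + 1)
      = S.phiPairs y₀ a N * ∏ i ∈ Finset.range N, S.phiLat y₀ (2 * a + N + i) := by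
  rw [phiPairs, Finset.prod_range_succ, ← phiPairs]

theorem phiPairs_succ' (y₀ : ℂ) (a N : ℕ) :
    S.phiPairs y₀ a (N + 1)
      = S.phiPairs y₀ (a + 1) N * ∏ i ∈ Finset.range N, S.phiLat y₀ (2 * a + 1 + i) := by
  rw [phiPairs, Finset.prod_range_succ', Finset.prod_range_zero, mul_one, phiPairs,
    ← Finset.prod_mul_distrib]
  refine Finset.prod_congr rfl fun j _ => ?_
  rw [Finset.prod_range_succ']
  congr 1
  · refine Finset.prod_congr rfl fun i _ => ?_
    congr 1
    ring
  · congr 1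
    ring

theorem phiPairs_succ_succ (y₀ : ℂ) (a N : ℕ) :
    S.phiPairs y₀ a (N + 2) = S.phiPairs y₀ (a + 1) N
      * ∏ i ∈ Finset.range (2 * N + 1), S.phiLat y₀ (2 * a + 1 + i) := by
  rw [phiPairs_succ, phiPairs_succ', mul_assoc, show 2 * N + 1 = N + (N + 1) by ring,
    Finset.prod_range_add (fun i => S.phiLat y₀ (2 * a + 1 + i)) N (N + 1)]
  congr 2
  refine Finset.prod_congr rfl fun i _ => ?_
  congr 1
  ring

theorem phiN_add_two (N : ℕ) (x : ℂ) :
    S.phiN (N + 2) x = S.phiN N x * (S.phi x * ∏ k ∈ Finset.Icc 1 N,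
      (S.phi (x - I * k / 2 * S.gam) * S.phi (x + I * k / 2 * S.gam))) := by
  have h : ∏ k ∈ Finset.Icc 1 (N - 2),
      (S.phi (x - I * k / 2 * S.gam) * S.phi (x + I * k / 2 * S.gam)) ^ ((N - k) / 2)
      = ∏ k ∈ Finset.Icc 1 N,
      (S.phi (x - I * k / 2 * S.gam) * S.phi (x + I * k / 2 * S.gam)) ^ ((N - k) / 2) := by
    -- The exponent is zero for `k = N - 1` and `k = N`, so the product may run up to `N`; then all
    -- exponents rise by one in the step from `N` to `N + 2`.
    refine Finset.prod_subset (Finset.Icc_subset_Icc le_rfl (by omega)) fun k hk hk' => ?_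
    rw [Finset.mem_Icc] at hk hk'
    rw [show (N - k) / 2 = 0 by omega, pow_zero]
  rw [phiN, phiN, h, show (N + 2) / 2 = N / 2 + 1 by omega, pow_succ]
  have h2 : ∏ k ∈ Finset.Icc 1 (N + 2 - 2),
      (S.phi (x - I * k / 2 * S.gam) * S.phi (x + I * k / 2 * S.gam)) ^ ((N + 2 - k) / 2)
      = (∏ k ∈ Finset.Icc 1 N,
      (S.phi (x - I * k / 2 * S.gam) * S.phi (x + I * k / 2 * S.gam)) ^ ((N - k) / 2))
        * ∏ k ∈ Finset.Icc 1 N,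
          (S.phi (x - I * k / 2 * S.gam) * S.phi (x + I * k / 2 * S.gam)) := by
    rw [← Finset.prod_mul_distrib]
    refine Finset.prod_congr (by simp) fun k hk => ?_
    rw [Finset.mem_Icc] at hk
    rw [← pow_succ]
    congr 1
    omega
  rw [h2]
  ring

theorem phi_cen_add (y₀ : ℂ) (a N k : ℕ) :
    S.phi (S.cen y₀ a (N + 1) - I * k / 2 * S.gam) = S.phiLat y₀ (2 * a + N + k) := by
  simp only [cen, phiLat]
  push_cast
  ring_nf

/-- Adding one point at each end of a window keeps its centre, hence the induction in steps of two.
The midpoints of the new pairs are one half-lattice point at the centre and `N` on either side,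
which are the new factors in `phiN_add_two`. -/
theorem phiN_cen (y₀ : ℂ) : ∀ N a : ℕ, S.phiN N (S.cen y₀ a N) = S.phiPairs y₀ a N
  | 0, a => by simp [phiN, phiPairs]
  | 1, a => by simp [phiN, phiPairs]
  | N + 2, a => by
    have hc : S.cen y₀ a (N + 2) = S.cen y₀ (a + 1) N := by
      simp only [cen]
      push_cast
      ring
    rw [phiN_add_two, hc, phiN_cen y₀ N (a + 1), phiPairs_succ_succ, ← hc]
    congr 1
    rw [show 2 * N + 1 = N + (1 + N) by ring, Finset.prod_range_add, Finset.prod_range_add,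
      Finset.range_one, Finset.prod_singleton, Finset.prod_mul_distrib, ← Finset.prod_range_reflect]
    have e0 : S.phi (S.cen y₀ a (N + 2)) = S.phiLat y₀ (2 * a + 1 + (N + 0)) := by
      have := S.phi_cen_add y₀ a (N + 1) 0
      simp only [Nat.cast_zero, mul_zero, zero_div, zero_mul, sub_zero] at this
      rw [this]
      congr 1
      ring
    have e1 : ∏ k ∈ Finset.Icc 1 N, S.phi (S.cen y₀ a (N + 2) - I * k / 2 * S.gam)
        = ∏ x ∈ Finset.range N, S.phiLat y₀ (2 * a + 1 + (N + (1 + x))) := by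
      rw [← Finset.Ico_add_one_right_eq_Icc, Finset.prod_Ico_eq_prod_range]
      refine Finset.prod_congr (by simp) fun k _ => ?_
      rw [phi_cen_add]
      congr 1
      ring
    have e2 : ∏ k ∈ Finset.Icc 1 N, S.phi (S.cen y₀ a (N + 2) + I * k / 2 * S.gam)
        = ∏ j ∈ Finset.range N, S.phiLat y₀ (2 * a + 1 + (N - 1 - j)) := by
      rw [← Finset.Ico_add_one_right_eq_Icc, Finset.prod_Ico_eq_prod_range]
      refine Finset.prod_congr (by simp) fun k hk => ?_
      obtain ⟨m, hm⟩ := Nat.exists_eq_add_of_lt (show k < N by simpa using hk)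
      rw [show N - 1 - k = m by omega]
      simp only [cen, phiLat, hm]
      push_cast
      ring_nf
    rw [e0, e1, e2]
    ring

end System

end

/-! ### How the normalization factors change when the window moves or grows. -/

noncomputable section

namespace System

variable (S : System)

/-- The factor by which the columns of the determinants of size `N` differ from the columns of the
Casoratians. -/
def colScale (t : VType) (y₀ : ℂ) (a N : ℕ) : ℂ :=
  (∏ i ∈ Finset.range (N - 1), S.facStar t (S.lat y₀ (a + 1 + i))) / S.theta t y₀ a

/-- The contribution of the columns of a type to the factor between the quotients of determinants
and the Casoratians. -/
def colNorm (t : VType) (y₀ : ℂ) (a N m : ℕ) : ℂ :=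
  ∏ j ∈ Finset.range m, S.colScale t y₀ a N / (S.normK N j * S.facProd t y₀ a N j)

variable {S}

theorem theta_add_mul {y₀ : ℂ} {L : ℕ} (h : S.IsGeneric y₀ L) (t : VType)
    {a N : ℕ} (hN : a + N ≤ L) :
    S.theta t y₀ (a + N) * ∏ i ∈ Finset.range N, S.facStar t (S.lat y₀ (a + 1 + i))
      = S.theta t y₀ a * ∏ i ∈ Finset.range N, S.fac t (S.lat y₀ (a + i)) := by
  rw [theta, theta, Finset.prod_range_add, mul_assoc, ← Finset.prod_mul_distrib]
  congr 1
  refine Finset.prod_congr rfl fun i hi => ?_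
  rw [Finset.mem_range] at hi
  rw [show a + i + 1 = a + 1 + i by ring]
  exact div_mul_cancel₀ _ (h.facStar_ne t _ (by omega))

/-- `r` has `j` factors `fac` from the left and `N - 1 - j` factors `facStar` from the right, and
`theta` is a product of quotients of such factors. The ratio does not depend on `j`, so the gauge
factor is what remains of `r` in a column. -/
theorem r_cen (hq : 0 < S.q) {y₀ : ℂ} {L : ℕ} (h : S.IsGeneric y₀ L) (t : VType) {a N : ℕ}
    (hN : a + N ≤ L + 1) (j : Fin N) :
    S.r t j (S.cen y₀ a N) = S.colScale t y₀ a N * S.theta t y₀ (a + j) := by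
  obtain ⟨j, hj⟩ := j
  obtain ⟨n, rfl⟩ := Nat.exists_eq_add_of_lt hj
  have hθ := theta_add_mul h t (show a + j ≤ L by omega)
  have ht := theta_ne (t := t) h (show a ≤ L by omega)
  have hrefl : ∏ i ∈ Finset.range n, S.facStar t (S.lat y₀ (a + (j + n + 1) - 1 - i))
      = ∏ i ∈ Finset.range n, S.facStar t (S.lat y₀ (a + 1 + (j + i))) := by
    rw [← Finset.prod_range_reflect]
    refine Finset.prod_congr rfl fun i hi => ?_
    rw [Finset.mem_range] at hi
    congr 2
    omega
  rw [S.r_eq_prod hq, colScale]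
  simp only [show j + n + 1 - 1 = j + n by omega, Nat.add_sub_cancel_left]
  rw [hrefl, Finset.prod_range_add]
  field_simp
  linear_combination -(∏ i ∈ Finset.range n, S.facStar t (S.lat y₀ (a + 1 + (j + i)))) * hθ

theorem facProd_ne {y₀ : ℂ} {L : ℕ} (h : S.IsGeneric y₀ L) (t : VType) {a N j : ℕ}
    (hN : a + N ≤ L + 1) (hj : j ≤ N) : S.facProd t y₀ a N j ≠ 0 := by
  refine Finset.prod_ne_zero_iff.2 fun i hi => ?_
  rw [Finset.mem_range] at hi
  exact mul_ne_zero (h.fac_ne t _ (by omega)) (h.facStar_ne t _ (by omega))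

theorem colScale_succ (y₀ : ℂ) (t : VType) (a N : ℕ) :
    S.colScale t y₀ a (N + 2) = S.colScale t y₀ a (N + 1) * S.facStar t (S.lat y₀ (a + N + 1)) := by
  simp only [colScale, show N + 2 - 1 = N + 1 by omega, show N + 1 - 1 = N by omega,
    Finset.prod_range_succ]
  rw [show a + 1 + N = a + N + 1 by ring]
  ring

theorem colScale_succ' {y₀ : ℂ} {L : ℕ} (h : S.IsGeneric y₀ L) (t : VType) {a : ℕ} (N : ℕ)
    (ha : a < L) :
    S.colScale t y₀ a (N + 2) = S.colScale t y₀ (a + 1) (N + 1) * S.fac t (S.lat y₀ a) := by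
  have h1 := theta_ne (t := t) h ha.le
  have h2 := theta_ne (t := t) h ha
  have h3 := theta_succ (t := t) h ha
  simp only [colScale, show N + 2 - 1 = N + 1 by omega, show N + 1 - 1 = N by omega,
    Finset.prod_range_succ']
  have e : ∏ k ∈ Finset.range N, S.facStar t (S.lat y₀ (a + 1 + (k + 1)))
      = ∏ k ∈ Finset.range N, S.facStar t (S.lat y₀ (a + 1 + 1 + k)) := by
    refine Finset.prod_congr rfl fun i _ => ?_
    congr 2
    ring
  rw [e, add_zero]
  field_simp
  linear_combination (∏ k ∈ Finset.range N, S.facStar t (S.lat y₀ (a + 1 + 1 + k))) * h3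

theorem facProd_succ_mul {y₀ : ℂ} (t : VType) (a N j : ℕ) :
    S.facProd t y₀ (a + 1) N j * (S.fac t (S.lat y₀ a) * S.facStar t (S.lat y₀ (a + N - j)))
      = S.facProd t y₀ a N j * (S.fac t (S.lat y₀ (a + j)) * S.facStar t (S.lat y₀ (a + N))) := by
  have e1 := (Finset.prod_range_succ' (fun i => S.fac t (S.lat y₀ (a + i))) j).symm.trans
    (Finset.prod_range_succ (fun i => S.fac t (S.lat y₀ (a + i))) j)
  have e2 := (Finset.prod_range_succ' (fun i => S.facStar t (S.lat y₀ (a + N - i))) j).symm.trans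
    (Finset.prod_range_succ (fun i => S.facStar t (S.lat y₀ (a + N - i))) j)
  simp only [facProd, Finset.prod_mul_distrib]
  have e3 : ∏ i ∈ Finset.range j, S.fac t (S.lat y₀ (a + 1 + i))
      = ∏ i ∈ Finset.range j, S.fac t (S.lat y₀ (a + (i + 1))) :=
    Finset.prod_congr rfl fun i _ => by congr 2; ring
  have e4 : ∏ i ∈ Finset.range j, S.facStar t (S.lat y₀ (a + 1 + N - 1 - i))
      = ∏ i ∈ Finset.range j, S.facStar t (S.lat y₀ (a + N - i)) :=
    Finset.prod_congr rfl fun i _ => by congr 2; omega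
  have e5 : ∏ i ∈ Finset.range j, S.facStar t (S.lat y₀ (a + N - 1 - i))
      = ∏ i ∈ Finset.range j, S.facStar t (S.lat y₀ (a + N - (i + 1))) :=
    Finset.prod_congr rfl fun i _ => by congr 2; omega
  simp only [Nat.sub_zero, add_zero] at e1 e2
  rw [e3, e4, e5]
  linear_combination (∏ i ∈ Finset.range j, S.facStar t (S.lat y₀ (a + N - i)))
      * S.facStar t (S.lat y₀ (a + N - j)) * e1
    - (∏ i ∈ Finset.range j, S.fac t (S.lat y₀ (a + i))) * S.fac t (S.lat y₀ (a + j)) * e2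

/-- Moving the window by one place changes only end factors: for each `j`, one `fac` near the left
end against one `facStar` near the right end. -/
theorem colNorm_shift {y₀ : ℂ} {L : ℕ} (h : S.IsGeneric y₀ L) (t : VType) {a N m : ℕ}
    (hN : a + N ≤ L) (hm : m ≤ N) :
    S.colNorm t y₀ (a + 1) N m * ∏ j ∈ Finset.range m, S.fac t (S.lat y₀ (a + j))
      = S.colNorm t y₀ a N m * ∏ j ∈ Finset.range m, S.facStar t (S.lat y₀ (a + N - j)) := by
  rw [colNorm, colNorm, ← Finset.prod_mul_distrib, ← Finset.prod_mul_distrib]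
  refine Finset.prod_congr rfl fun j hj => ?_
  rw [Finset.mem_range] at hj
  obtain ⟨N, rfl⟩ := Nat.exists_eq_add_of_lt (show 0 < N by omega)
  have h1 := facProd_ne h t (show a + 1 + (0 + N + 1) ≤ L + 1 by omega) (show j ≤ 0 + N + 1 by omega)
  have h2 := facProd_ne h t (show a + (0 + N + 1) ≤ L + 1 by omega) (show j ≤ 0 + N + 1 by omega)
  have h3 := S.normK_ne (0 + N + 1) j
  have h4 := facProd_succ_mul (S := S) (y₀ := y₀) t a (0 + N + 1) j
  have h5 := (colScale_succ (S := S) y₀ t a (0 + N)).symm.trans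
    (colScale_succ' h t (0 + N) (by omega))
  have h6 := h.fac_ne t a (by omega)
  rw [show a + (0 + N) + 1 = a + (0 + N + 1) by ring] at h5
  field_simp
  apply mul_left_cancel₀ h6
  linear_combination -S.fac t (S.lat y₀ (a + j)) * S.facProd t y₀ a (0 + N + 1) j * h5
    - S.colScale t y₀ a (0 + N + 1) * h4

variable (S)

/-- The ratio of the constant factors of determinants whose sizes differ by three and one. -/
def qShift (N : ℕ) : ℂ :=
  match S.kind with
  | .cH => 1
  | .W => 1
  | .AW => Complex.exp ((Real.log S.q : ℂ) * N)

theorem qShift_zero : S.qShift 0 = 1 := by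
  rcases hk : S.kind <;> simp [qShift, hk]

theorem normK_mul_qShift (N j : ℕ) :
    S.normK (N + 2) (j + 1) * S.qShift N = S.normK N j * S.qShift j := by
  rcases hk : S.kind with _ | _ | _
  · simp [normK, qShift, hk]
  · simp [normK, qShift, hk]
  · simp only [normK, qShift, hk, ← Complex.exp_add]
    congr 1
    push_cast
    ring

theorem normK_succ_mul (N j : ℕ) :
    S.normK (N + 2) (j + 1) * S.normK (N + 1) (j + 1)
      = S.normK (N + 3) (j + 2) * S.normK N j := by
  rcases hk : S.kind with _ | _ | _
  · simp [normK, hk]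
  · simp [normK, hk]
  · simp only [normK, hk, ← Complex.exp_add]
    congr 1
    push_cast
    ring

/-- Of the constants for the four sizes `N, …, N + 3` only `qShift (N + 1)` survives. One such
factor per type, together with `κ` and `α`, makes up `sig` in `kappa_sqrtAlpha`. -/
theorem prod_normK_succ (N m : ℕ) :
    (∏ j ∈ Finset.range m, S.normK (N + 2) (j + 1)) * (∏ j ∈ Finset.range (m + 1), S.normK (N + 1) j)
      = S.qShift (N + 1) * ((∏ j ∈ Finset.range (m + 1), S.normK (N + 3) (j + 1))
        * ∏ j ∈ Finset.range m, S.normK N j) := by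
  induction m with
  | zero =>
    have := S.normK_mul_qShift (N + 1) 0
    simp only [qShift_zero, mul_one] at this
    simp [← this, mul_comm]
  | succ m ih =>
    rw [Finset.prod_range_succ (fun j => S.normK (N + 2) (j + 1)) m,
      Finset.prod_range_succ (fun j => S.normK (N + 1) j) (m + 1),
      Finset.prod_range_succ (fun j => S.normK (N + 3) (j + 1)) (m + 1),
      Finset.prod_range_succ (fun j => S.normK N j) m]
    linear_combination (S.normK (N + 2) (m + 1) * S.normK (N + 1) (m + 1)) * ih + S.qShift (N + 1)
      * (∏ j ∈ Finset.range (m + 1), S.normK (N + 3) (j + 1))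
        * (∏ j ∈ Finset.range m, S.normK N j) * S.normK_succ_mul N m

variable {S}

theorem facProd_succ_succ {y₀ : ℂ} (t : VType) (a N j : ℕ) :
    S.facProd t y₀ a (N + 2) (j + 1)
      = S.facProd t y₀ (a + 1) N j * (S.fac t (S.lat y₀ a) * S.facStar t (S.lat y₀ (a + N + 1))) := by
  rw [facProd, Finset.prod_range_succ', facProd]
  congr 1
  refine Finset.prod_congr rfl fun i _ => ?_
  congr 3 <;> [ring; omega]

/-- The two windows are concentric. The outermost factors split off by `facProd_succ_succ` are just
those by which `colScale` changes. -/
theorem colNorm_succ_succ {y₀ : ℂ} {L : ℕ} (h : S.IsGeneric y₀ L) (t : VType) {a N m : ℕ}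
    (hN : a + N + 1 ≤ L) (hm : m ≤ N) :
    S.colNorm t y₀ a (N + 2) (m + 1) * ∏ j ∈ Finset.range m, S.normK (N + 2) (j + 1)
      = S.colScale t y₀ a (N + 2) * S.colNorm t y₀ (a + 1) N m
        * ∏ j ∈ Finset.range m, S.normK N j := by
  rw [colNorm, colNorm, Finset.prod_range_succ', S.normK_zero, facProd, Finset.prod_range_zero,
    mul_one, div_one, mul_right_comm, mul_assoc (S.colScale t y₀ a (N + 2)),
    ← Finset.prod_mul_distrib, ← Finset.prod_mul_distrib, mul_comm]
  congr 1
  refine Finset.prod_congr rfl fun j hj => ?_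
  rw [Finset.mem_range] at hj
  obtain ⟨N, rfl⟩ := Nat.exists_eq_add_of_lt (show 0 < N by omega)
  have h1 := S.normK_ne (0 + N + 1 + 2) (j + 1)
  have h2 := S.normK_ne (0 + N + 1) j
  have h3 := facProd_ne h t (show a + 1 + (0 + N + 1) ≤ L + 1 by omega)
    (show j ≤ 0 + N + 1 by omega)
  have h4 := h.fac_ne t a (by omega)
  have h5 := h.facStar_ne t (a + (0 + N + 1) + 1) (by omega)
  have h6 := colScale_succ' h t (0 + N + 1) (show a < L by omega)
  rw [show 0 + N + 1 + 1 = 0 + N + 2 by ring, colScale_succ y₀ t (a + 1) (0 + N),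
    show a + 1 + (0 + N) + 1 = a + (0 + N + 1) + 1 by ring] at h6
  rw [facProd_succ_succ, h6]
  field_simp

/-- Sizes `N` and `N + 1` with counts `m` and `m + 1` are those of `Ξ_D` and `P_{D,n}`. All but two
factors cancel: `fac` at the place `a + m` belongs to the potential at `λ_D`, and `facStar` at `a +
N + 1` to `coefR`. -/
theorem colNorm_rel_right {y₀ : ℂ} {L : ℕ} (h : S.IsGeneric y₀ L) (t : VType) {a N m : ℕ}
    (hN : a + N + 1 ≤ L) (hm : m ≤ N) :
    S.colNorm t y₀ (a + 1) (N + 1) (m + 1) * S.colNorm t y₀ a N m * S.fac t (S.lat y₀ (a + m))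
      = S.colNorm t y₀ a (N + 1) (m + 1) * S.colNorm t y₀ (a + 1) N m
        * S.facStar t (S.lat y₀ (a + N + 1)) := by
  have e1 := colNorm_shift h t (a := a) (N := N) (by omega) hm
  have e2 := colNorm_shift h t (a := a) (N := N + 1) (m := m + 1) (by omega) (by omega)
  rw [Finset.prod_range_succ, Finset.prod_range_succ'] at e2
  simp only [Nat.sub_zero, show ∀ j, a + (N + 1) - (j + 1) = a + N - j by omega] at e2
  have h1 : ∏ j ∈ Finset.range m, S.fac t (S.lat y₀ (a + j)) ≠ 0 :=
    Finset.prod_ne_zero_iff.2 fun j hj => h.fac_ne t _ (by rw [Finset.mem_range] at hj; omega)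
  apply mul_right_cancel₀ h1
  rw [← add_assoc] at e2
  linear_combination (S.colNorm t y₀ a N m) * e2
    - S.colNorm t y₀ a (N + 1) (m + 1) * S.facStar t (S.lat y₀ (a + N + 1)) * e1

theorem colNorm_rel_left {y₀ : ℂ} {L : ℕ} (h : S.IsGeneric y₀ L) (t : VType) {a N m : ℕ}
    (hN : a + N + 1 ≤ L) (hm : m ≤ N) :
    S.colNorm t y₀ a (N + 1) (m + 1) * S.colNorm t y₀ (a + 2) N m
        * S.facStar t (S.lat y₀ (a + 1 + (N - m)))
      = S.colNorm t y₀ (a + 1) (N + 1) (m + 1) * S.colNorm t y₀ (a + 1) N m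
        * S.fac t (S.lat y₀ a) := by
  have e1 := colNorm_shift h t (a := a + 1) (N := N) (by omega) hm
  have e2 := colNorm_shift h t (a := a) (N := N + 1) (m := m + 1) (by omega) (by omega)
  rw [Finset.prod_range_succ', Finset.prod_range_succ] at e2
  have h1 : ∏ j ∈ Finset.range m, S.fac t (S.lat y₀ (a + 1 + j)) ≠ 0 :=
    Finset.prod_ne_zero_iff.2 fun j hj => h.fac_ne t _ (by rw [Finset.mem_range] at hj; omega)
  have e3 : ∏ j ∈ Finset.range m, S.fac t (S.lat y₀ (a + (j + 1)))
      = ∏ j ∈ Finset.range m, S.fac t (S.lat y₀ (a + 1 + j)) :=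
    Finset.prod_congr rfl fun i _ => by congr 2; ring
  have e4 : ∏ j ∈ Finset.range m, S.facStar t (S.lat y₀ (a + (N + 1) - j))
      = ∏ j ∈ Finset.range m, S.facStar t (S.lat y₀ (a + 1 + N - j)) :=
    Finset.prod_congr rfl fun i _ => by congr 2; omega
  rw [e3, e4, add_zero, show a + (N + 1) - m = a + 1 + (N - m) by omega] at e2
  apply mul_right_cancel₀ h1
  linear_combination S.colNorm t y₀ a (N + 1) (m + 1) * S.facStar t (S.lat y₀ (a + 1 + (N - m)))
    * e1 - S.colNorm t y₀ (a + 1) N m * e2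

theorem prod_normK_ne (N m k : ℕ) : ∏ j ∈ Finset.range m, S.normK N (j + k) ≠ 0 :=
  Finset.prod_ne_zero_iff.2 fun _ _ => S.normK_ne _ _

/-- The sizes are those of `Ξ_D`, `P_{D''',n}`, `Ξ_{D'''}` and `P_{D,n}`. As `D'''` has one more
state of each type than `D`, every count `m` rises by one from `D` to `D'''`. -/
theorem colNorm_rel_three_right {y₀ : ℂ} {L : ℕ} (h : S.IsGeneric y₀ L) (t : VType) {a N m : ℕ}
    (hN : a + N + 2 ≤ L) (hm : m ≤ N) :
    S.colNorm t y₀ (a + 1) N m * S.colNorm t y₀ a (N + 3) (m + 2)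
      = S.qShift (N + 1) * (S.colNorm t y₀ a (N + 2) (m + 1)
        * S.colNorm t y₀ (a + 1) (N + 1) (m + 1) * S.facStar t (S.lat y₀ (a + N + 2))) := by
  have e1 := colNorm_succ_succ h t (a := a) (N := N) (m := m) (by omega) hm
  have e2 := colNorm_succ_succ h t (a := a) (N := N + 1) (m := m + 1) (by omega) (by omega)
  rw [colScale_succ] at e2
  have e3 := S.prod_normK_succ N m
  have n1 := prod_normK_ne (S := S) (N + 2) m 1
  have n2 := prod_normK_ne (S := S) (N + 3) (m + 1) 1
  simp only [add_assoc, Nat.reduceAdd] at *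
  generalize ∏ j ∈ Finset.range m, S.normK (N + 2) (j + 1) = k1 at *
  generalize ∏ j ∈ Finset.range (m + 1), S.normK (N + 3) (j + 1) = k2 at *
  generalize ∏ j ∈ Finset.range (m + 1), S.normK (N + 1) j = k3 at *
  generalize ∏ j ∈ Finset.range m, S.normK N j = k4 at *
  apply mul_right_cancel₀ (mul_ne_zero n1 n2)
  linear_combination S.colNorm t y₀ (a + 1) N m * k1 * e2
    + S.colNorm t y₀ (a + 1) N m * S.colNorm t y₀ (a + 1) (N + 1) (m + 1)
      * S.facStar t (S.lat y₀ (a + (N + 2))) * S.colScale t y₀ a (N + 2) * e3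
    - S.colNorm t y₀ (a + 1) (N + 1) (m + 1) * S.facStar t (S.lat y₀ (a + (N + 2)))
      * S.qShift (N + 1) * k2 * e1

theorem colNorm_rel_three_left {y₀ : ℂ} {L : ℕ} (h : S.IsGeneric y₀ L) (t : VType) {a N m : ℕ}
    (hN : a + N + 2 ≤ L) (hm : m ≤ N) :
    S.colNorm t y₀ (a + 2) N m * S.colNorm t y₀ a (N + 3) (m + 2)
      = S.qShift (N + 1) * (S.colNorm t y₀ (a + 1) (N + 2) (m + 1)
        * S.colNorm t y₀ (a + 1) (N + 1) (m + 1) * S.fac t (S.lat y₀ a)) := by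
  have e1 := colNorm_succ_succ h t (a := a + 1) (N := N) (m := m) (by omega) hm
  have e2 := colNorm_succ_succ h t (a := a) (N := N + 1) (m := m + 1) (by omega) (by omega)
  rw [colScale_succ' h _ _ (by omega)] at e2
  have e3 := S.prod_normK_succ N m
  have n1 := prod_normK_ne (S := S) (N + 2) m 1
  have n2 := prod_normK_ne (S := S) (N + 3) (m + 1) 1
  simp only [add_assoc, Nat.reduceAdd] at *
  generalize ∏ j ∈ Finset.range m, S.normK (N + 2) (j + 1) = k1 at *
  generalize ∏ j ∈ Finset.range (m + 1), S.normK (N + 3) (j + 1) = k2 at *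
  generalize ∏ j ∈ Finset.range (m + 1), S.normK (N + 1) j = k3 at *
  generalize ∏ j ∈ Finset.range m, S.normK N j = k4 at *
  apply mul_right_cancel₀ (mul_ne_zero n1 n2)
  linear_combination S.colNorm t y₀ (a + 2) N m * k1 * e2
    + S.colNorm t y₀ (a + 2) N m * S.colNorm t y₀ (a + 1) (N + 1) (m + 1)
      * S.fac t (S.lat y₀ a) * S.colScale t y₀ (a + 1) (N + 2) * e3
    - S.colNorm t y₀ (a + 1) (N + 1) (m + 1) * S.fac t (S.lat y₀ a)
      * S.qShift (N + 1) * k2 * e1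

theorem phiPairs_rel_right {y₀ : ℂ} (a N : ℕ) :
    S.phiLat y₀ (2 * a + 2 * N) * S.phiLat y₀ (2 * a + 2 * N + 1) * S.phiPairs y₀ (a + 1) N
        * S.phiPairs y₀ a (N + 1)
      = S.phiLat y₀ (2 * a + N) * S.phiLat y₀ (2 * a + N + 1) * S.phiPairs y₀ a N
        * S.phiPairs y₀ (a + 1) (N + 1) := by
  rw [phiPairs_succ, phiPairs_succ]
  have := (Finset.prod_range_add (fun i => S.phiLat y₀ (2 * a + N + i)) N 2).symm.trans
    ((congrArg (fun k => ∏ i ∈ Finset.range k, S.phiLat y₀ (2 * a + N + i)) (add_comm N 2)).trans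
      (Finset.prod_range_add (fun i => S.phiLat y₀ (2 * a + N + i)) 2 N))
  have e : ∏ i ∈ Finset.range N, S.phiLat y₀ (2 * (a + 1) + N + i)
      = ∏ i ∈ Finset.range N, S.phiLat y₀ (2 * a + N + (2 + i)) :=
    Finset.prod_congr rfl fun i _ => by congr 1; ring
  simp only [Finset.prod_range_succ, Finset.prod_range_zero, one_mul, add_zero] at this
  rw [show 2 * a + N + N = 2 * a + 2 * N by ring, show 2 * a + N + (N + 1) = 2 * a + 2 * N + 1 by ring]
    at this
  rw [e]
  linear_combination S.phiPairs y₀ (a + 1) N * S.phiPairs y₀ a N * this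

theorem phiPairs_rel_left {y₀ : ℂ} (a N : ℕ) :
    S.phiLat y₀ (2 * a + 2) * S.phiLat y₀ (2 * a + 1) * S.phiPairs y₀ (a + 1) N
        * S.phiPairs y₀ (a + 1) (N + 1)
      = S.phiLat y₀ (2 * a + 2 + N) * S.phiLat y₀ (2 * a + 1 + N) * S.phiPairs y₀ (a + 2) N
        * S.phiPairs y₀ a (N + 1) := by
  rw [phiPairs_succ', phiPairs_succ']
  have := (Finset.prod_range_add (fun i => S.phiLat y₀ (2 * a + 1 + i)) N 2).symm.trans
    ((congrArg (fun k => ∏ i ∈ Finset.range k, S.phiLat y₀ (2 * a + 1 + i)) (add_comm N 2)).trans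
      (Finset.prod_range_add (fun i => S.phiLat y₀ (2 * a + 1 + i)) 2 N))
  have e : ∏ i ∈ Finset.range N, S.phiLat y₀ (2 * (a + 1) + 1 + i)
      = ∏ i ∈ Finset.range N, S.phiLat y₀ (2 * a + 1 + (2 + i)) :=
    Finset.prod_congr rfl fun i _ => by congr 1; ring
  simp only [Finset.prod_range_succ, Finset.prod_range_zero, one_mul, add_zero] at this
  rw [show 2 * a + 1 + (N + 1) = 2 * a + 2 + N by ring, show 2 * a + 1 + 1 = 2 * a + 2 by ring]
    at this
  rw [e]
  linear_combination -S.phiPairs y₀ (a + 2) N * S.phiPairs y₀ (a + 1) N * this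

theorem phiPairs_rel_three_right {y₀ : ℂ} (a N : ℕ) :
    S.phiPairs y₀ (a + 1) N * S.phiPairs y₀ a (N + 3)
      = S.phiLat y₀ (2 * a + 2 * N + 2) * S.phiLat y₀ (2 * a + 2 * N + 3)
        * S.phiPairs y₀ a (N + 2) * S.phiPairs y₀ (a + 1) (N + 1) := by
  rw [S.phiPairs_succ y₀ a (N + 2), S.phiPairs_succ y₀ (a + 1) N, Finset.prod_range_succ,
    Finset.prod_range_succ]
  have e : ∏ i ∈ Finset.range N, S.phiLat y₀ (2 * (a + 1) + N + i)
      = ∏ i ∈ Finset.range N, S.phiLat y₀ (2 * a + (N + 2) + i) :=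
    Finset.prod_congr rfl fun i _ => by congr 1; ring
  rw [e, show 2 * a + (N + 2) + N = 2 * a + 2 * N + 2 by ring,
    show 2 * a + (N + 2) + (N + 1) = 2 * a + 2 * N + 3 by ring]
  ring

theorem phiPairs_rel_three_left {y₀ : ℂ} (a N : ℕ) :
    S.phiPairs y₀ (a + 2) N * S.phiPairs y₀ a (N + 3)
      = S.phiLat y₀ (2 * a + 2) * S.phiLat y₀ (2 * a + 1)
        * S.phiPairs y₀ (a + 1) (N + 2) * S.phiPairs y₀ (a + 1) (N + 1) := by
  rw [S.phiPairs_succ' y₀ a (N + 2), S.phiPairs_succ' y₀ (a + 1) N, Finset.prod_range_succ',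
    Finset.prod_range_succ']
  have e : ∏ i ∈ Finset.range N, S.phiLat y₀ (2 * (a + 1) + 1 + i)
      = ∏ i ∈ Finset.range N, S.phiLat y₀ (2 * a + 1 + (i + 1 + 1)) :=
    Finset.prod_congr rfl fun i _ => by congr 1; ring
  rw [e, show 2 * a + 1 + (0 + 1) = 2 * a + 2 by ring]
  ring

end System

end

/-! ### The denominator functions and multi-indexed polynomials as Casoratians. -/

noncomputable section

namespace System

theorem prod_comp_type {M : ℕ} (D : Fin M → Label) (f : VType → ℂ) :
    ∏ k, f (D k).2 = f .one ^ count D .one * f .two ^ count D .two := by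
  have h : ∀ k, f (D k).2 = (if (D k).2 = .one then f .one else 1)
      * (if (D k).2 = .two then f .two else 1) := by
    intro k
    rcases (D k).2 <;> simp
  rw [Finset.prod_congr rfl fun k _ => h k, Finset.prod_mul_distrib]
  simp [count, Finset.prod_ite]

variable (S : System)

/-- The factor between the quotients of determinants and the Casoratians. -/
def casScale (y₀ : ℂ) (a N m₁ m₂ : ℕ) : ℂ :=
  I ^ (N * (N - 1) / 2) * (S.colNorm .two y₀ a N m₁ * S.colNorm .one y₀ a N m₂) / S.phiPairs y₀ a N

variable {S}

/-- The factor of `j = 0` is `1`, so the product over `1, …, m - 1` has one factor for each of `m`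
columns. For `m = 0` the truncated subtraction makes both products empty. -/
theorem prod_normA (hq : 0 < S.q) (t : VType) (y₀ : ℂ) (a N m : ℕ) (hm : m ≤ N) :
    ∏ j ∈ Finset.Icc 1 (m - 1), S.normC t j
        * S.pairPoch t (-((N : ℂ) - 1) / 2) j j (S.cen y₀ a N)
      = ∏ j ∈ Finset.range m, S.normK N j * S.facProd t y₀ a N j := by
  rcases m with _ | m
  · simp
  · rw [Finset.prod_range_succ', S.normK_zero, facProd, Finset.prod_range_zero, mul_one, mul_one,
      ← Finset.Ico_add_one_right_eq_Icc, Finset.prod_Ico_eq_prod_range]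
    refine Finset.prod_congr rfl fun j hj => ?_
    simp only [Finset.mem_range] at hj
    rw [add_comm 1 j, S.normC_mul_pairPoch hq _ _ _ _ _ (by omega)]

theorem colNorm_eq_div (t : VType) (y₀ : ℂ) (a N m : ℕ) :
    S.colNorm t y₀ a N m = S.colScale t y₀ a N ^ m
      / ∏ j ∈ Finset.range m, S.normK N j * S.facProd t y₀ a N j := by
  simp [colNorm, Finset.prod_div_distrib, Finset.prod_const]

theorem count_le {M : ℕ} (D : Fin M → Label) (t : VType) : count D t ≤ M := by
  simpa [count] using Finset.card_filter_le (Finset.univ : Finset (Fin M)) fun k => (D k).2 = t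

theorem count_add {M : ℕ} (D : Fin M → Label) : count D .one + count D .two = M := by
  have h := Finset.card_filter_add_card_filter_not (s := (Finset.univ : Finset (Fin M)))
    fun k => (D k).2 = .one
  have e : ∀ k, ¬ (D k).2 = VType.one ↔ (D k).2 = VType.two := by
    intro k
    rcases (D k).2 <;> simp
  simpa [e, count] using h

theorem XiDen_cen (hq : 0 < S.q) {M : ℕ} (D : Fin M → Label) (y₀ : ℂ) (a : ℕ) :
    S.XiDen D (S.cen y₀ a M) = S.phiPairs y₀ a M
      * ((∏ j ∈ Finset.range (count D .one), S.normK M j * S.facProd .two y₀ a M j)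
        * ∏ j ∈ Finset.range (count D .two), S.normK M j * S.facProd .one y₀ a M j) := by
  rw [XiDen, normA, S.phiN_cen, prod_normA hq _ _ _ _ _ (count_le D _),
    prod_normA hq _ _ _ _ _ (count_le D _)]

theorem PDen_cen (hq : 0 < S.q) {M : ℕ} (D : Fin M → Label) (y₀ : ℂ) (a : ℕ) :
    S.PDen D (S.cen y₀ a (M + 1)) = S.phiPairs y₀ a (M + 1)
      * ((∏ j ∈ Finset.range (count D .one + 1),
          S.normK (M + 1) j * S.facProd .two y₀ a (M + 1) j)
        * ∏ j ∈ Finset.range (count D .two + 1),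
          S.normK (M + 1) j * S.facProd .one y₀ a (M + 1) j) := by
  rw [PDen, normA, S.phiN_cen, ← prod_normA hq _ _ _ _ _ (Nat.succ_le_succ (count_le D _)),
    ← prod_normA hq _ _ _ _ _ (Nat.succ_le_succ (count_le D _))]
  simp

/-- Each column contributes its `colScale`, taken with the other type; this is why in `casScale` the
number of states of type I goes with `colNorm .two`. -/
theorem Xi_cen (hq : 0 < S.q) {y₀ : ℂ} {L : ℕ} (h : S.IsGeneric y₀ L) {M : ℕ}
    (D : Fin M → Label) {a : ℕ} (hN : a + M ≤ L + 1) :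
    S.Xi D (S.cen y₀ a M) = S.casScale y₀ a M (count D .one) (count D .two)
      * casoratian (fun k => S.seqV y₀ (D k)) a := by
  have hdet : Matrix.det (Matrix.of fun j k : Fin M => S.colV (D k) (S.cen y₀ a M) j)
      = (S.colScale .two y₀ a M ^ count D .one * S.colScale .one y₀ a M ^ count D .two)
        * casoratian (fun k => S.seqV y₀ (D k)) a := by
    have e : ∏ k, S.colScale (D k).2.other y₀ a M
        = S.colScale .two y₀ a M ^ count D .one * S.colScale .one y₀ a M ^ count D .two :=
      prod_comp_type D fun t => S.colScale t.other y₀ a M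
    rw [casoratian, ← e, ← Matrix.det_mul_row]
    congr 1
    ext j k
    simp only [Matrix.of_apply, colV, seqV, r_cen hq h _ hN, S.node_cen]
    ring
  rw [Xi, XiNum, hdet, XiDen_cen hq, casScale, colNorm_eq_div, colNorm_eq_div]
  simp only [div_eq_mul_inv, mul_inv]
  ring

/-- The last column carries `r` of both types, which raises both counts by one. -/
theorem PD_cen (hq : 0 < S.q) {y₀ : ℂ} {L : ℕ} (h : S.IsGeneric y₀ L) {M : ℕ}
    (D : Fin M → Label) (n : ℕ) {a : ℕ} (hN : a + M ≤ L) :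
    S.PD D n (S.cen y₀ a (M + 1))
      = S.casScale y₀ a (M + 1) (count D .one + 1) (count D .two + 1)
        * casoratian (snocSeq (fun k => S.seqV y₀ (D k)) (S.seqP y₀ n)) a := by
  have hdet : Matrix.det (Matrix.of fun j k : Fin (M + 1) => (Fin.snoc (α := fun _ => ℂ)
        (fun i : Fin M => S.colV (D i) (S.cen y₀ a (M + 1)) j)
        (S.colP n (S.cen y₀ a (M + 1)) j) : _ → ℂ) k)
      = (S.colScale .two y₀ a (M + 1) ^ (count D .one + 1)
          * S.colScale .one y₀ a (M + 1) ^ (count D .two + 1))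
        * casoratian (snocSeq (fun k => S.seqV y₀ (D k)) (S.seqP y₀ n)) a := by
    have e : (S.colScale .two y₀ a (M + 1) ^ (count D .one + 1)
          * S.colScale .one y₀ a (M + 1) ^ (count D .two + 1))
        = ∏ k : Fin (M + 1), (Fin.snoc (α := fun _ => ℂ)
          (fun i : Fin M => S.colScale (D i).2.other y₀ a (M + 1))
          (S.colScale .one y₀ a (M + 1) * S.colScale .two y₀ a (M + 1)) : _ → ℂ) k := by
      rw [Fin.prod_univ_castSucc]
      simp only [Fin.snoc_castSucc, Fin.snoc_last]
      rw [prod_comp_type D (fun t => S.colScale t.other y₀ a (M + 1))]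
      simp only [VType.other]
      ring
    rw [e, casoratian, ← Matrix.det_mul_row]
    congr 1
    ext j k
    refine Fin.lastCases ?_ (fun k => ?_) k
    · simp only [Matrix.of_apply, Fin.snoc_last, snocSeq_last, colP, seqP,
        r_cen hq h _ (show a + (M + 1) ≤ L + 1 by omega), S.node_cen]
      ring
    · simp only [Matrix.of_apply, Fin.snoc_castSucc, snocSeq_castSucc, colV, seqV,
        r_cen hq h _ (show a + (M + 1) ≤ L + 1 by omega), S.node_cen]
      ring
  rw [PD, PNum, hdet, PDen_cen hq, casScale, colNorm_eq_div, colNorm_eq_div]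
  simp only [div_eq_mul_inv, mul_inv, Nat.add_sub_cancel, mul_comm (M + 1) M]
  ring

end System

end

/-! ### The deformed potentials and the constants of the two identities. -/

noncomputable section

namespace System

variable {S : System}

theorem fac_of_add (hq : 0 < S.q) {S' : System} (hkind : S'.kind = S.kind) (hq' : S'.q = S.q)
    (t : VType) (b : ℂ) (h1 : S'.lam (S.pair t).1 = S.lam (S.pair t).1 + b)
    (h2 : S'.lam (S.pair t).2 = S.lam (S.pair t).2 + b) (y : ℂ) :
    S'.fac t y = S.fac t (y - I * b * S.gam) := by
  have hl : ∀ c z, S'.lin c z = S.lin c z := fun _ _ => by simp only [lin, hkind, hq']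
  have hp : S'.pair t = S.pair t := by simp only [pair, hkind]
  have hs : S'.pairSum t = S.pairSum t + 2 * b := by
    simp only [pairSum, hp, h1, h2]
    ring
  rcases hk : S.kind with _ | _ | _
  · simp only [fac, hkind, hk, hp, hl, h1, S.lin_add hq]
  · simp only [fac, hkind, hk, hp, hl, h1, h2, S.lin_add hq]
  · simp only [fac, hkind, hk, hp, hl, hs, h1, h2, S.lin_add hq, hq']
    congr 2
    simp only [gam, hk]
    linear_combination -(b * (Real.log S.q : ℂ)) * I_sq

theorem facStar_of_add (hq : 0 < S.q) {S' : System} (hkind : S'.kind = S.kind) (hq' : S'.q = S.q)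
    (t : VType) (b : ℂ) (h1 : S'.lam (S.pair t).1 = S.lam (S.pair t).1 + b)
    (h2 : S'.lam (S.pair t).2 = S.lam (S.pair t).2 + b) (y : ℂ) :
    S'.facStar t y = S.facStar t (y + I * b * S.gam) := by
  have hl : ∀ c z, S'.lin c z = S.lin c z := fun _ _ => by simp only [lin, hkind, hq']
  have hp : S'.pair t = S.pair t := by simp only [pair, hkind]
  rcases hk : S.kind with _ | _ | _
  · simp only [facStar, hkind, hk, hp, hl, h2, S.lin_add hq]
    ring_nf
  · simp only [facStar, hkind, hk, fac_of_add hq hkind hq' t b h1 h2]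
    ring_nf
  · simp only [facStar, hkind, hk, fac_of_add hq hkind hq' t b h1 h2]
    ring_nf

/-- A state lowers the pair of its own type by `1/2` and raises the other pair by `1/2`; the two
counts add up to `N`. -/
theorem deform_lam_pair {N : ℕ} (G : Fin N → Label) (t : VType) :
    (S.deform G).lam (S.pair t).1 = S.lam (S.pair t).1 + (count G t.other - (N : ℂ) / 2)
      ∧ (S.deform G).lam (S.pair t).2 = S.lam (S.pair t).2 + (count G t.other - (N : ℂ) / 2) := by
  have hc : (count G .one : ℂ) + count G .two = N := by exact_mod_cast count_add G
  rw [← hc]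
  rcases hk : S.kind with _ | _ | _ <;> cases t <;>
    simp [deform, deltaTilde, pair, hk, VType.other] <;> constructor <;> ring

/-- The parameter offset moves the centre of the window, which may lie halfway between two places,
to a lattice point again. -/
theorem deform_fac_cen (hq : 0 < S.q) {N : ℕ} (G : Fin N → Label) (t : VType) (y₀ : ℂ) (a : ℕ) :
    (S.deform G).fac t (S.cen y₀ a (N + 1)) = S.fac t (S.lat y₀ (a + count G t.other)) := by
  rw [fac_of_add hq (S' := S.deform G) rfl rfl t _ (deform_lam_pair G t).1 (deform_lam_pair G t).2]
  simp only [cen, lat]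
  congr 1
  push_cast
  ring

theorem deform_facStar_cen (hq : 0 < S.q) {N : ℕ} (G : Fin N → Label) (t : VType) (y₀ : ℂ) (a : ℕ) :
    (S.deform G).facStar t (S.cen y₀ a (N + 1))
      = S.facStar t (S.lat y₀ (a + (N - count G t.other))) := by
  rw [facStar_of_add hq (S' := S.deform G) rfl rfl t _ (deform_lam_pair G t).1
    (deform_lam_pair G t).2]
  simp only [cen, lat]
  congr 1
  push_cast [count_le]
  ring

theorem deform_sig {N : ℕ} (G : Fin N → Label) : (S.deform G).sig = S.sig := by
  have hs : ∑ k, (S.deform G).lam k = ∑ k, S.lam k := by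
    rw [(S.deform G).sum_lam .one, S.sum_lam .one]
    have hc : (count G .one : ℂ) + count G .two = N := by exact_mod_cast count_add G
    have h1 := deform_lam_pair (S := S) G .one
    have h2 := deform_lam_pair (S := S) G .two
    have hp : (S.deform G).pair = S.pair := rfl
    simp only [pairSum, hp, h1, h2, VType.other]
    linear_combination 2 * hc
  simp only [sig, hs]
  rfl

theorem deform_V_cen (hq : 0 < S.q) {N : ℕ} (G : Fin N → Label) (y₀ : ℂ) (a : ℕ) :
    (S.deform G).V (S.cen y₀ a (N + 1))
      = -(S.sig * (S.fac .one (S.lat y₀ (a + count G .two))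
          * S.fac .two (S.lat y₀ (a + count G .one)))
        / (S.phiLat y₀ (2 * a + N) * S.phiLat y₀ (2 * a + N + 1))) := by
  have h0 := S.phi_cen_add y₀ a N 0
  have h1 := S.phi_cen_add y₀ a N 1
  have hphi : (S.deform G).phi = S.phi := rfl
  have hgam : (S.deform G).gam = S.gam := rfl
  simp only [Nat.cast_zero, mul_zero, zero_div, zero_mul, sub_zero, Nat.cast_one, mul_one,
    add_zero] at h0 h1
  rw [(S.deform G).V_eq hq, deform_fac_cen hq, deform_fac_cen hq, deform_sig, hphi, hgam, h0, ← h1]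
  simp only [VType.other]
  ring_nf

theorem deform_Vstar_cen (hq : 0 < S.q) {N : ℕ} (G : Fin N → Label) (y₀ : ℂ) (a : ℕ) :
    (S.deform G).Vstar (S.cen y₀ (a + 1) (N + 1))
      = -(S.sig * (S.facStar .one (S.lat y₀ (a + 1 + (N - count G .two)))
          * S.facStar .two (S.lat y₀ (a + 1 + (N - count G .one))))
        / (S.phiLat y₀ (2 * a + 2 + N) * S.phiLat y₀ (2 * a + 1 + N))) := by
  have h0 := S.phi_cen_add y₀ (a + 1) N 0
  have h1 : S.phi (S.cen y₀ (a + 1) (N + 1) + I * S.gam / 2) = S.phiLat y₀ (2 * a + 1 + N) := by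
    simp only [cen, phiLat]
    push_cast
    ring_nf
  have hphi : (S.deform G).phi = S.phi := rfl
  have hgam : (S.deform G).gam = S.gam := rfl
  simp only [Nat.cast_zero, mul_zero, zero_div, zero_mul, sub_zero, add_zero] at h0
  rw [(S.deform G).Vstar_eq hq, deform_facStar_cen hq, deform_facStar_cen hq, deform_sig, hphi,
    hgam, h0, h1]
  simp only [VType.other]
  rfl

theorem coefR_lat (y₀ : ℂ) (j : ℕ) : S.coefR (S.lat y₀ j)
    = -(S.sig * (S.facStar .one (S.lat y₀ (j + 1)) * S.facStar .two (S.lat y₀ (j + 1)))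
      / (S.phiLat y₀ (2 * j) * S.phiLat y₀ (2 * j + 1))) := by
  rw [coefR, ← lat_succ, phi_lat, phi_lat_sub]
  ring

theorem coefL_lat (y₀ : ℂ) (j : ℕ) : S.coefL (S.lat y₀ (j + 1))
    = -(S.sig * (S.fac .one (S.lat y₀ j) * S.fac .two (S.lat y₀ j))
      / (S.phiLat y₀ (2 * j + 2) * S.phiLat y₀ (2 * j + 1))) := by
  rw [coefL, phi_lat, phi_lat_add, lat_succ, sub_add_cancel]
  ring_nf

variable {y₀ : ℂ} {L : ℕ}

/-- This absorbs all normalizations: with the scalars of `Ξ` and `P` attached, the potential of the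
deformed system becomes the coefficient `coefR` of the undeformed recurrence. `Vstar_mul_casScale`
is the mirror image with `coefL`. -/
theorem V_mul_casScale (hq : 0 < S.q) (h : S.IsGeneric y₀ L) {N a : ℕ} (G : Fin N → Label)
    (hN : a + N + 1 ≤ L) :
    (S.deform G).V (S.cen y₀ a (N + 1)) * S.casScale y₀ a N (count G .one) (count G .two)
        * S.casScale y₀ (a + 1) (N + 1) (count G .one + 1) (count G .two + 1)
      = S.coefR (S.lat y₀ (a + N)) * S.casScale y₀ (a + 1) N (count G .one) (count G .two)
        * S.casScale y₀ a (N + 1) (count G .one + 1) (count G .two + 1) := by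
  rw [deform_V_cen hq, coefR_lat, show 2 * (a + N) = 2 * a + 2 * N by ring]
  simp only [casScale]
  refine Eq.trans (b := -(S.sig * I ^ (N * (N - 1) / 2) * I ^ ((N + 1) * (N + 1 - 1) / 2))
    * ((S.colNorm .one y₀ (a + 1) (N + 1) (count G .two + 1) * S.colNorm .one y₀ a N (count G .two)
        * S.fac .one (S.lat y₀ (a + count G .two)))
      * (S.colNorm .two y₀ (a + 1) (N + 1) (count G .one + 1) * S.colNorm .two y₀ a N (count G .one)
        * S.fac .two (S.lat y₀ (a + count G .one))))
    / (S.phiLat y₀ (2 * a + N) * S.phiLat y₀ (2 * a + N + 1) * S.phiPairs y₀ a N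
        * S.phiPairs y₀ (a + 1) (N + 1))) (by ring) ?_
  rw [colNorm_rel_right h .one hN (count_le G .two), colNorm_rel_right h .two hN (count_le G .one),
    ← phiPairs_rel_right]
  ring

theorem Vstar_mul_casScale (hq : 0 < S.q) (h : S.IsGeneric y₀ L) {N a : ℕ} (G : Fin N → Label)
    (hN : a + N + 1 ≤ L) :
    (S.deform G).Vstar (S.cen y₀ (a + 1) (N + 1))
        * S.casScale y₀ (a + 2) N (count G .one) (count G .two)
        * S.casScale y₀ a (N + 1) (count G .one + 1) (count G .two + 1)
      = S.coefL (S.lat y₀ (a + 1)) * S.casScale y₀ (a + 1) N (count G .one) (count G .two)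
        * S.casScale y₀ (a + 1) (N + 1) (count G .one + 1) (count G .two + 1) := by
  rw [deform_Vstar_cen hq, coefL_lat]
  simp only [casScale]
  refine Eq.trans (b := -(S.sig * I ^ (N * (N - 1) / 2) * I ^ ((N + 1) * (N + 1 - 1) / 2))
    * ((S.colNorm .one y₀ a (N + 1) (count G .two + 1) * S.colNorm .one y₀ (a + 2) N (count G .two)
        * S.facStar .one (S.lat y₀ (a + 1 + (N - count G .two))))
      * (S.colNorm .two y₀ a (N + 1) (count G .one + 1) * S.colNorm .two y₀ (a + 2) N (count G .one)
        * S.facStar .two (S.lat y₀ (a + 1 + (N - count G .one)))))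
    / (S.phiLat y₀ (2 * a + 2 + N) * S.phiLat y₀ (2 * a + 1 + N) * S.phiPairs y₀ (a + 2) N
        * S.phiPairs y₀ a (N + 1))) (by ring) ?_
  rw [colNorm_rel_left h .one hN (count_le G .two), colNorm_rel_left h .two hN (count_le G .one),
    ← phiPairs_rel_left]
  ring

/-- The outer two of four consecutive triangular numbers sum to two more than the inner two. The
sign `I ^ 2` compensates the minus sign in `coefR` and `coefL`. -/
theorem I_pow_triangular (N : ℕ) : I ^ (N * (N - 1) / 2) * I ^ ((N + 3) * (N + 3 - 1) / 2)
    = -(I ^ ((N + 2) * (N + 2 - 1) / 2) * I ^ ((N + 1) * (N + 1 - 1) / 2)) := by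
  have h1 : N * (N - 1) / 2 + (N + 3) * (N + 3 - 1) / 2
      = ((N + 2) * (N + 2 - 1) / 2 + (N + 1) * (N + 1 - 1) / 2) + 2 := by
    have e1 := Finset.sum_range_id N
    have e2 := Finset.sum_range_id (N + 1)
    have e3 := Finset.sum_range_id (N + 2)
    have e4 := Finset.sum_range_id (N + 3)
    rw [← e1, ← e2, ← e3, ← e4]
    simp only [Finset.sum_range_succ]
    ring
  rw [← pow_add, h1, pow_add, pow_add, I_sq]
  ring

/-- The constant factor in the case of different types. -/
theorem kappa_sqrtAlpha (hq : 0 < S.q) (N : ℕ) :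
    ((S.kappa ^ (2 * (N : ℝ) + 3 / 2) : ℝ) : ℂ) * S.sqrtAlpha * (S.qShift (N + 1) * S.qShift (N + 1))
      = S.sig := by
  have hs := S.sum_lam .one
  rcases hk : S.kind with _ | _ | _
  · simp [kappa, sqrtAlpha, alphaPow, qShift, sig, hk]
  · simp [kappa, sqrtAlpha, alphaPow, qShift, sig, hk]
  · have h1 : ((S.kappa ^ (2 * (N : ℝ) + 3 / 2) : ℝ) : ℂ)
        = Complex.exp (-(Real.log S.q : ℂ) * (2 * N + 3 / 2)) := by
      simp only [kappa, hk]
      rw [Real.rpow_def_of_pos (inv_pos.2 hq), Real.log_inv]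
      push_cast
      rfl
    rw [h1]
    simp only [sqrtAlpha, alphaPow, qShift, sig, hk, cpow_q S hq, ← Complex.exp_add, hs, VType.other]
    congr 1
    push_cast
    ring

/-- The origin of the constant in the case of different types: the two types supply `qShift (N + 1)`
each, and `κ ^ (2N + 3/2) √(α^I α^II)` is what completes their product to `sig`, the constant in
`coefR`. -/
theorem kappa_mul_casScale_right (hq : 0 < S.q) (h : S.IsGeneric y₀ L) {N a m₁ m₂ : ℕ}
    (h₁ : m₁ ≤ N) (h₂ : m₂ ≤ N) (hN : a + N + 2 ≤ L) :
    ((S.kappa ^ (2 * (N : ℝ) + 3 / 2) : ℝ) : ℂ) * S.sqrtAlpha * S.casScale y₀ (a + 1) N m₁ m₂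
        * S.casScale y₀ a (N + 3) (m₁ + 2) (m₂ + 2)
      = S.coefR (S.lat y₀ (a + N + 1)) * S.casScale y₀ a (N + 2) (m₁ + 1) (m₂ + 1)
        * S.casScale y₀ (a + 1) (N + 1) (m₁ + 1) (m₂ + 1) := by
  rw [coefR_lat, show 2 * (a + N + 1) = 2 * a + 2 * N + 2 by ring,
    show 2 * a + 2 * N + 2 + 1 = 2 * a + 2 * N + 3 by ring, ← kappa_sqrtAlpha hq N]
  simp only [casScale]
  generalize ((S.kappa ^ (2 * (N : ℝ) + 3 / 2) : ℝ) : ℂ) * S.sqrtAlpha = c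
  refine Eq.trans (b := c * (I ^ (N * (N - 1) / 2) * I ^ ((N + 3) * (N + 3 - 1) / 2))
    * ((S.colNorm .one y₀ (a + 1) N m₂ * S.colNorm .one y₀ a (N + 3) (m₂ + 2))
      * (S.colNorm .two y₀ (a + 1) N m₁ * S.colNorm .two y₀ a (N + 3) (m₁ + 2)))
    / (S.phiPairs y₀ (a + 1) N * S.phiPairs y₀ a (N + 3))) (by ring) ?_
  rw [colNorm_rel_three_right h .one hN h₂, colNorm_rel_three_right h .two hN h₁,
    phiPairs_rel_three_right, I_pow_triangular]
  ring_nf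

theorem kappa_mul_casScale_left (hq : 0 < S.q) (h : S.IsGeneric y₀ L) {N a m₁ m₂ : ℕ}
    (h₁ : m₁ ≤ N) (h₂ : m₂ ≤ N) (hN : a + N + 2 ≤ L) :
    ((S.kappa ^ (2 * (N : ℝ) + 3 / 2) : ℝ) : ℂ) * S.sqrtAlpha * S.casScale y₀ (a + 2) N m₁ m₂
        * S.casScale y₀ a (N + 3) (m₁ + 2) (m₂ + 2)
      = S.coefL (S.lat y₀ (a + 1)) * S.casScale y₀ (a + 1) (N + 2) (m₁ + 1) (m₂ + 1)
        * S.casScale y₀ (a + 1) (N + 1) (m₁ + 1) (m₂ + 1) := by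
  rw [coefL_lat, ← kappa_sqrtAlpha hq N]
  simp only [casScale]
  generalize ((S.kappa ^ (2 * (N : ℝ) + 3 / 2) : ℝ) : ℂ) * S.sqrtAlpha = c
  refine Eq.trans (b := c * (I ^ (N * (N - 1) / 2) * I ^ ((N + 3) * (N + 3 - 1) / 2))
    * ((S.colNorm .one y₀ (a + 2) N m₂ * S.colNorm .one y₀ a (N + 3) (m₂ + 2))
      * (S.colNorm .two y₀ (a + 2) N m₁ * S.colNorm .two y₀ a (N + 3) (m₁ + 2)))
    / (S.phiPairs y₀ (a + 2) N * S.phiPairs y₀ a (N + 3))) (by ring) ?_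
  rw [colNorm_rel_three_left h .one hN h₂, colNorm_rel_three_left h .two hN h₁,
    phiPairs_rel_three_left, I_pow_triangular]
  ring

end System

end

/-! ### The system at `λ + δ` and the polynomial `P_{D,0}`. -/

noncomputable section

section CasoratianScale

variable {R : Type*} [CommRing R] {N : ℕ}

theorem casoratian_mul_row (c : ℕ → R) (u : Fin N → ℕ → R) (a : ℕ) :
    casoratian (fun k j => c j * u k j) a
      = (∏ i ∈ Finset.range N, c (a + i)) * casoratian u a := by
  rw [casoratian, casoratian, Finset.prod_range]
  exact Matrix.det_mul_column (fun i : Fin N => c (a + i)) (Matrix.of fun i k => u k (a + i))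

theorem casoratian_mul_column (c : Fin N → R) (u : Fin N → ℕ → R) (a : ℕ) :
    casoratian (fun k j => c k * u k j) a = (∏ k, c k) * casoratian u a := by
  rw [casoratian, casoratian]
  exact Matrix.det_mul_row c (Matrix.of fun i k => u k (a + i))

/-- A Casoratian that involves a constant sequence. -/
theorem casoratian_snoc_one (u : Fin N → ℕ → R) (a : ℕ) :
    casoratian (snocSeq u fun _ => 1) a
      = (-1) ^ N * casoratian (fun k j => u k (j + 1) - u k j) a := by
  let A : Matrix (Fin (N + 1)) (Fin (N + 1)) R :=
    Matrix.of fun i k => snocSeq u (fun _ => 1) k (a + i)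
  let B : Matrix (Fin (N + 1)) (Fin (N + 1)) R :=
    Matrix.of fun i k => Fin.cases (A 0 k) (fun i => A i.succ k - A i.castSucc k) i
  have hAB : A.det = B.det := by
    refine Matrix.det_eq_of_forall_row_eq_smul_add_pred (fun _ => 1) (fun j => rfl) fun i j => ?_
    simp [B]
  change A.det = _
  rw [hAB, Matrix.det_succ_column B (Fin.last N), Fin.sum_univ_succ]
  have h0 : ∀ i : Fin N, B i.succ (Fin.last N) = 0 := fun i => by simp [B, A]
  simp only [h0, mul_zero, zero_mul, Finset.sum_const_zero, add_zero]
  have h1 : B 0 (Fin.last N) = 1 := by simp [B, A]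
  rw [h1, casoratian, Fin.succAbove_zero, Fin.succAbove_last]
  simp only [Fin.val_zero, Fin.val_last, zero_add, mul_one]
  congr 2
  ext i k
  simp [B, A, add_assoc]

theorem casoratian_congr {u v : Fin N → ℕ → R} {a : ℕ}
    (h : ∀ k, ∀ i < N, u k (a + i) = v k (a + i)) : casoratian u a = casoratian v a := by
  rw [casoratian, casoratian]
  congr 1
  ext i k
  exact h k i i.2

end CasoratianScale

namespace System

variable {S : System}

theorem plusDelta_fac (hq : 0 < S.q) (t : VType) (y : ℂ) :
    S.plusDelta.fac t y = S.fac t (y - I * S.gam / 2) := by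
  rw [fac_of_add hq (S' := S.plusDelta) rfl rfl t (1 / 2) rfl rfl]
  ring_nf

theorem plusDelta_facStar (hq : 0 < S.q) (t : VType) (y : ℂ) :
    S.plusDelta.facStar t y = S.facStar t (y + I * S.gam / 2) := by
  rw [facStar_of_add hq (S' := S.plusDelta) rfl rfl t (1 / 2) rfl rfl]
  ring_nf

theorem plusDelta_lat (y₀ : ℂ) (j : ℕ) :
    S.plusDelta.lat (y₀ - I * S.gam / 2) j = S.lat y₀ j - I * S.gam / 2 := by
  have hgam : S.plusDelta.gam = S.gam := rfl
  simp only [lat, hgam]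
  ring

/-- Adding `δ` is a half step, in opposite directions for `fac` and `facStar`. On the lattice that
starts half a step later, `fac` therefore advances by one place while `facStar` stays. -/
theorem plusDelta_fac_lat (hq : 0 < S.q) (t : VType) (y₀ : ℂ) (j : ℕ) :
    S.plusDelta.fac t (S.plusDelta.lat (y₀ - I * S.gam / 2) j) = S.fac t (S.lat y₀ (j + 1)) := by
  rw [plusDelta_fac hq, plusDelta_lat, lat_succ]
  ring_nf

theorem plusDelta_facStar_lat (hq : 0 < S.q) (t : VType) (y₀ : ℂ) (j : ℕ) :
    S.plusDelta.facStar t (S.plusDelta.lat (y₀ - I * S.gam / 2) j) = S.facStar t (S.lat y₀ j) := by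
  rw [plusDelta_facStar hq, plusDelta_lat]
  ring_nf

theorem plusDelta_phiLat (y₀ : ℂ) (s : ℕ) :
    S.plusDelta.phiLat (y₀ - I * S.gam / 2) s = S.phiLat y₀ (s + 1) := by
  have hgam : S.plusDelta.gam = S.gam := rfl
  have hphi : S.plusDelta.phi = S.phi := rfl
  simp only [phiLat, hgam, hphi]
  push_cast
  ring_nf

variable {y₀ : ℂ} {L : ℕ}

theorem isGeneric_plusDelta (hq : 0 < S.q) (h : S.IsGeneric y₀ (L + 1)) :
    S.plusDelta.IsGeneric (y₀ - I * S.gam / 2) L where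
  fac_ne t j hj := by
    rw [plusDelta_fac_lat hq]
    exact h.fac_ne t _ (by omega)
  facStar_ne t j hj := by
    rw [plusDelta_facStar_lat hq]
    exact h.facStar_ne t _ (by omega)
  phi_ne s hs := by
    rw [plusDelta_phiLat]
    exact h.phi_ne _ (by omega)

theorem plusDelta_cen (y₀ : ℂ) (a N : ℕ) :
    S.plusDelta.cen (y₀ - I * S.gam / 2) a N = S.cen y₀ a (N + 1) := by
  have hgam : S.plusDelta.gam = S.gam := rfl
  simp only [cen, hgam]
  push_cast
  ring

theorem plusDelta_theta (hq : 0 < S.q) (h : S.IsGeneric y₀ L) (t : VType) {j : ℕ} (hj : j ≤ L) :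
    S.plusDelta.theta t (y₀ - I * S.gam / 2) j * S.fac t (S.lat y₀ 0)
      = S.theta t y₀ j * S.fac t (S.lat y₀ j) := by
  induction j with
  | zero => simp [theta]
  | succ j ih =>
    have h1 := ih (by omega)
    have h2 := h.facStar_ne t (j + 1) hj
    have e1 : S.plusDelta.theta t (y₀ - I * S.gam / 2) (j + 1)
        = S.plusDelta.theta t (y₀ - I * S.gam / 2) j
          * (S.fac t (S.lat y₀ (j + 1)) / S.facStar t (S.lat y₀ (j + 1))) := by
      rw [theta, Finset.prod_range_succ, ← theta, plusDelta_fac_lat hq, plusDelta_facStar_lat hq]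
    have e2 : S.theta t y₀ (j + 1)
        = S.theta t y₀ j * (S.fac t (S.lat y₀ j) / S.facStar t (S.lat y₀ (j + 1))) :=
      Finset.prod_range_succ _ _
    rw [e1, e2]
    generalize S.plusDelta.theta t (y₀ - I * S.gam / 2) j = A at *
    field_simp
    linear_combination S.fac t (S.lat y₀ (j + 1)) * h1

theorem plusDelta_phiPairs (y₀ : ℂ) (a N : ℕ) :
    S.phiPairs y₀ a (N + 1) = S.plusDelta.phiPairs (y₀ - I * S.gam / 2) a N
      * ∏ i ∈ Finset.range N, S.phiLat y₀ (2 * (a + i) + 1) := by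
  rw [phiPairs, Finset.prod_range_succ', Finset.prod_range_zero, mul_one, phiPairs,
    ← Finset.prod_mul_distrib]
  refine Finset.prod_congr rfl fun j _ => ?_
  rw [Finset.prod_range_succ]
  congr 1
  · refine Finset.prod_congr rfl fun i _ => ?_
    rw [plusDelta_phiLat]
    congr 1
    ring
  · congr 1
    ring

/-- The shift relation for the virtual states. -/
theorem fac_mul_xi_sub (hq₀ : 0 < S.q) (hq₁ : S.q < 1) (d : Label) (y : ℂ) :
    S.fac d.2 (y + I * S.gam / 2) * S.xi d (y + I * S.gam / 2)
      - S.facStar d.2 (y - I * S.gam / 2) * S.xi d (y - I * S.gam / 2)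
      = (S.twist d.2).fwd d.2 d.1 * S.phi y * S.plusDelta.xi d y := by
  have h := (S.twist d.2).facStar_mul_P_sub hq₀ hq₁ d.2 d.1 y
  have hphi : (S.twist d.2).phi = S.phi := rfl
  have hgam : (S.twist d.2).gam = S.gam := rfl
  rw [S.twist_shift, S.twist_fac hq₀ hq₁, S.twist_facStar hq₀ hq₁, hphi, hgam,
    show y - I * S.gam / 2 + I * S.gam = y + I * S.gam / 2 by ring,
    show y + I * S.gam / 2 - I * S.gam = y - I * S.gam / 2 by ring] at h
  exact h

theorem colScale_mul_theta (h : S.IsGeneric y₀ L) (t : VType) {a N : ℕ} (hN : a + N ≤ L) :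
    S.colScale t y₀ a (N + 1) * S.theta t y₀ (a + N)
      = ∏ i ∈ Finset.range N, S.fac t (S.lat y₀ (a + i)) := by
  have h1 := theta_add_mul h t hN
  have h2 := theta_ne (t := t) h (show a ≤ L by omega)
  rw [colScale, Nat.add_sub_cancel]
  field_simp
  linear_combination h1

theorem plusDelta_colScale (hq : 0 < S.q) (h : S.IsGeneric y₀ (L + 1)) (t : VType) {a N : ℕ}
    (ha : a ≤ L) :
    S.colScale t y₀ a (N + 2) * S.fac t (S.lat y₀ 0)
      = S.plusDelta.colScale t (y₀ - I * S.gam / 2) a (N + 1)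
        * (S.fac t (S.lat y₀ a) * S.facStar t (S.lat y₀ (a + N + 1))) := by
  have h1 := plusDelta_theta hq h t (show a ≤ L + 1 by omega)
  have h2 := theta_ne (t := t) h (show a ≤ L + 1 by omega)
  have h3 := theta_ne (t := t) (isGeneric_plusDelta hq h) ha
  rw [colScale_succ, colScale, colScale]
  simp only [plusDelta_facStar_lat hq]
  generalize S.plusDelta.theta t (y₀ - I * S.gam / 2) a = A at *
  field_simp
  linear_combination (∏ i ∈ Finset.range (N + 1 - 1), S.facStar t (S.lat y₀ (a + 1 + i)))
    * S.facStar t (S.lat y₀ (a + N + 1)) * h1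

theorem plusDelta_facProd (hq : 0 < S.q) (t : VType) (a N j : ℕ) :
    S.facProd t y₀ a (N + 1) (j + 1)
      = S.plusDelta.facProd t (y₀ - I * S.gam / 2) a N j
        * (S.fac t (S.lat y₀ a) * S.facStar t (S.lat y₀ (a + N))) := by
  simp only [facProd, Finset.prod_mul_distrib]
  rw [Finset.prod_range_succ', Finset.prod_range_succ']
  simp only [plusDelta_fac_lat hq, plusDelta_facStar_lat hq]
  have e : ∀ i, a + (N + 1) - 1 - (i + 1) = a + N - 1 - i := fun i => by omega
  simp only [e, add_assoc, add_zero, Nat.sub_zero]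
  rw [show a + (N + 1) - 1 = a + N by omega]
  ring

theorem plusDelta_colNorm (hq : 0 < S.q) (h : S.IsGeneric y₀ (L + 1)) (t : VType) {a N m : ℕ}
    (hN : a + N ≤ L + 1) (hm : m ≤ N) :
    S.colNorm t y₀ a (N + 1) (m + 1) * S.fac t (S.lat y₀ 0) ^ m
      = S.colScale t y₀ a (N + 1) * S.plusDelta.colNorm t (y₀ - I * S.gam / 2) a N m
        * ∏ j ∈ Finset.range m, S.normK N j / S.normK (N + 1) (j + 1) := by
  rw [colNorm, Finset.prod_range_succ', S.normK_zero, facProd, Finset.prod_range_zero,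
    mul_one, div_one, mul_right_comm, colNorm, mul_assoc (S.colScale t y₀ a (N + 1)),
    ← Finset.prod_mul_distrib, mul_comm, ← Finset.card_range m, ← Finset.prod_const,
    Finset.card_range, ← Finset.prod_mul_distrib]
  congr 1
  refine Finset.prod_congr rfl fun j hj => ?_
  rw [Finset.mem_range] at hj
  obtain ⟨N, rfl⟩ := Nat.exists_eq_add_of_lt (show 0 < N by omega)
  have hK : S.plusDelta.normK (0 + N + 1) j = S.normK (0 + N + 1) j := rfl
  have h1 := S.normK_ne (0 + N + 1 + 1) (j + 1)
  have h2 := S.normK_ne (0 + N + 1) j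
  have h3 := facProd_ne (isGeneric_plusDelta hq h) t (show a + (0 + N + 1) ≤ L + 1 by omega)
    (show j ≤ 0 + N + 1 by omega)
  have h4 := h.fac_ne t a (by omega)
  have h5 := h.facStar_ne t (a + (0 + N) + 1) (by omega)
  have h6 := plusDelta_colScale (N := 0 + N) hq h t (show a ≤ L by omega)
  rw [plusDelta_facProd hq, hK, show a + (0 + N + 1) = a + (0 + N) + 1 by ring]
  rw [show 0 + N + 1 + 1 = 0 + N + 2 by ring] at h1 ⊢
  generalize S.plusDelta.colScale t (y₀ - I * S.gam / 2) a (0 + N + 1) = A at *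
  generalize S.plusDelta.facProd t (y₀ - I * S.gam / 2) a (0 + N + 1) j = B at *
  field_simp
  linear_combination h6

/-- This collects everything of one type in the passage to `λ + δ`: the gauge of `N + 1` rows, the
inverse gauge of the `N` difference rows, and `fac` at the first place once for each of the `c`
states of the type. Only constants are left besides the factor for `λ + δ`. -/
theorem colNorm_mul_theta (hq : 0 < S.q) (h : S.IsGeneric y₀ (L + 1)) (t : VType) {a N m c : ℕ}
    (hN : a + N ≤ L + 1) (hm : c + m = N) :
    S.colNorm t y₀ a (N + 1) (m + 1) * (∏ i ∈ Finset.range (N + 1), S.theta t y₀ (a + i))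
        / ((∏ i ∈ Finset.range N, S.plusDelta.theta t (y₀ - I * S.gam / 2) (a + i))
          * S.fac t (S.lat y₀ 0) ^ c)
      = S.plusDelta.colNorm t (y₀ - I * S.gam / 2) a N m
        * ∏ j ∈ Finset.range m, S.normK N j / S.normK (N + 1) (j + 1) := by
  have e1 := plusDelta_colNorm hq h t hN (show m ≤ N by omega)
  have e2 := colScale_mul_theta h t hN
  have e3 : (∏ i ∈ Finset.range N, S.plusDelta.theta t (y₀ - I * S.gam / 2) (a + i))
      * S.fac t (S.lat y₀ 0) ^ N = (∏ i ∈ Finset.range N, S.theta t y₀ (a + i))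
        * ∏ i ∈ Finset.range N, S.fac t (S.lat y₀ (a + i)) := by
    rw [← Finset.prod_mul_distrib, ← Finset.card_range N, ← Finset.prod_const, Finset.card_range,
      ← Finset.prod_mul_distrib]
    refine Finset.prod_congr rfl fun i hi => plusDelta_theta hq h t ?_
    rw [Finset.mem_range] at hi
    omega
  have n1 := h.fac_ne t 0 (by omega)
  have n2 : ∏ i ∈ Finset.range N, S.plusDelta.theta t (y₀ - I * S.gam / 2) (a + i) ≠ 0 :=
    Finset.prod_ne_zero_iff.2 fun i hi => theta_ne (isGeneric_plusDelta hq h) (by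
      rw [Finset.mem_range] at hi
      omega)
  have hp : S.fac t (S.lat y₀ 0) ^ N = S.fac t (S.lat y₀ 0) ^ c * S.fac t (S.lat y₀ 0) ^ m := by
    rw [← pow_add, hm]
  rw [hp] at e3
  rw [Finset.prod_range_succ]
  generalize ∏ j ∈ Finset.range m, S.normK N j / S.normK (N + 1) (j + 1) = k at *
  generalize ∏ i ∈ Finset.range N, S.plusDelta.theta t (y₀ - I * S.gam / 2) (a + i) = A at *
  generalize ∏ i ∈ Finset.range N, S.theta t y₀ (a + i) = B at *
  rw [div_eq_iff (mul_ne_zero n2 (pow_ne_zero _ n1))]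
  apply mul_right_cancel₀ (pow_ne_zero m n1)
  generalize S.plusDelta.colNorm t (y₀ - I * S.gam / 2) a N m = D at *
  linear_combination B * S.theta t y₀ (a + N) * e1 + D * k * B * e2 - D * k * e3

/-- Divided by both gauge factors, `seqV` is `ξ` over the gauge of its own type. By `fac_mul_xi_sub`
the difference of neighbouring values is the corresponding sequence at `λ + δ`, times a factor of
the row and a factor of the column. -/
theorem xi_quotient_sub (hq₀ : 0 < S.q) (hq₁ : S.q < 1) (h : S.IsGeneric y₀ (L + 1)) (d : Label)
    {j : ℕ} (hj : j ≤ L) :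
    S.xi d (S.lat y₀ (j + 1)) / S.theta d.2 y₀ (j + 1) - S.xi d (S.lat y₀ j) / S.theta d.2 y₀ j
      = S.phiLat y₀ (2 * j + 1) / (S.plusDelta.theta .one (y₀ - I * S.gam / 2) j
          * S.plusDelta.theta .two (y₀ - I * S.gam / 2) j)
        * (-(S.twist d.2).fwd d.2 d.1 / S.fac d.2 (S.lat y₀ 0)
          * S.plusDelta.seqV (y₀ - I * S.gam / 2) d j) := by
  have e1 := S.fac_mul_xi_sub hq₀ hq₁ d (S.lat y₀ j - I * S.gam / 2)
  have e2 := plusDelta_theta hq₀ h d.2 (show j ≤ L + 1 by omega)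
  have e3 := theta_succ (t := d.2) h (show j < L + 1 by omega)
  have n1 := theta_ne (t := d.2) h (show j ≤ L + 1 by omega)
  have n2 := theta_ne (t := d.2) h (show j + 1 ≤ L + 1 by omega)
  have n3 := fun t => theta_ne (t := t) (isGeneric_plusDelta hq₀ h) hj
  have n4 := h.fac_ne d.2 0 (by omega)
  have n5 := h.fac_ne d.2 j (by omega)
  have n6 := h.facStar_ne d.2 (j + 1) (by omega)
  rw [phi_lat_sub, sub_add_cancel, sub_sub, add_halves, ← lat_succ] at e1
  have hs : S.plusDelta.seqV (y₀ - I * S.gam / 2) d j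
      / (S.plusDelta.theta .one (y₀ - I * S.gam / 2) j
          * S.plusDelta.theta .two (y₀ - I * S.gam / 2) j)
      = S.plusDelta.xi d (S.lat y₀ j - I * S.gam / 2)
        / S.plusDelta.theta d.2 (y₀ - I * S.gam / 2) j := by
    rw [seqV, plusDelta_lat]
    have a1 := n3 .one
    have a2 := n3 .two
    rcases d with ⟨v, _ | _⟩ <;> simp only [VType.other]
    · rw [mul_comm (S.plusDelta.theta .one _ _), mul_div_mul_left _ _ a2]
    · rw [mul_div_mul_left _ _ a1]
  have hr : S.phiLat y₀ (2 * j + 1) / (S.plusDelta.theta .one (y₀ - I * S.gam / 2) j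
          * S.plusDelta.theta .two (y₀ - I * S.gam / 2) j)
        * (-(S.twist d.2).fwd d.2 d.1 / S.fac d.2 (S.lat y₀ 0)
          * S.plusDelta.seqV (y₀ - I * S.gam / 2) d j)
      = S.phiLat y₀ (2 * j + 1) * (-(S.twist d.2).fwd d.2 d.1 / S.fac d.2 (S.lat y₀ 0))
        * (S.plusDelta.seqV (y₀ - I * S.gam / 2) d j
          / (S.plusDelta.theta .one (y₀ - I * S.gam / 2) j
            * S.plusDelta.theta .two (y₀ - I * S.gam / 2) j)) := by ring
  have hr' : S.phiLat y₀ (2 * j + 1) * (-(S.twist d.2).fwd d.2 d.1 / S.fac d.2 (S.lat y₀ 0))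
        * (S.plusDelta.xi d (S.lat y₀ j - I * S.gam / 2)
          / S.plusDelta.theta d.2 (y₀ - I * S.gam / 2) j)
      = -((S.twist d.2).fwd d.2 d.1 * S.phiLat y₀ (2 * j + 1)
          * S.plusDelta.xi d (S.lat y₀ j - I * S.gam / 2))
        / (S.plusDelta.theta d.2 (y₀ - I * S.gam / 2) j * S.fac d.2 (S.lat y₀ 0)) := by ring
  rw [hr, hs, hr', ← e1, e2, div_sub_div _ _ n2 n1, div_eq_div_iff (mul_ne_zero n2 n1)
    (mul_ne_zero n1 n5)]
  linear_combination -S.xi d (S.lat y₀ (j + 1)) * S.theta d.2 y₀ j * e3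

variable (S) in
/-- The constant in the relation between `P_{D,0}` and the denominator polynomial of the system
with the parameters `λ + δ`. -/
def deltaConst {N : ℕ} (G : Fin N → Label) : ℂ :=
  I ^ N * (-1) ^ N * (∏ k, -(S.twist (G k).2).fwd (G k).2 (G k).1)
    * ((∏ j ∈ Finset.range (count G .one), S.normK N j / S.normK (N + 1) (j + 1))
      * ∏ j ∈ Finset.range (count G .two), S.normK N j / S.normK (N + 1) (j + 1))

theorem deltaConst_ne {N : ℕ} (G : Fin N → Label)
    (h : ∀ k, (S.twist (G k).2).fwd (G k).2 (G k).1 ≠ 0) : S.deltaConst G ≠ 0 :=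
  mul_ne_zero (mul_ne_zero (mul_ne_zero (pow_ne_zero _ I_ne_zero)
      (pow_ne_zero _ (neg_ne_zero.2 one_ne_zero)))
      (Finset.prod_ne_zero_iff.2 fun k _ => neg_ne_zero.2 (h k)))
    (mul_ne_zero
      (Finset.prod_ne_zero_iff.2 fun _ _ => div_ne_zero (S.normK_ne _ _) (S.normK_ne _ _))
      (Finset.prod_ne_zero_iff.2 fun _ _ => div_ne_zero (S.normK_ne _ _) (S.normK_ne _ _)))

/-- As `P_0 = 1`, division of the rows by both gauge factors makes the last column constant. Then
`casoratian_snoc_one` passes to differences of one size less, which `xi_quotient_sub` identifies. -/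
theorem casoratian_seqP_zero (hq₀ : 0 < S.q) (hq₁ : S.q < 1) (h : S.IsGeneric y₀ (L + 1)) {N : ℕ}
    (G : Fin N → Label) {a : ℕ} (hN : a + N ≤ L + 1) :
    casoratian (snocSeq (fun k => S.seqV y₀ (G k)) (S.seqP y₀ 0)) a
      = (∏ i ∈ Finset.range (N + 1), S.theta .one y₀ (a + i) * S.theta .two y₀ (a + i))
        * ((-1) ^ N * ((∏ i ∈ Finset.range N, S.phiLat y₀ (2 * (a + i) + 1)
            / (S.plusDelta.theta .one (y₀ - I * S.gam / 2) (a + i)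
              * S.plusDelta.theta .two (y₀ - I * S.gam / 2) (a + i)))
          * ((∏ k, -(S.twist (G k).2).fwd (G k).2 (G k).1 / S.fac (G k).2 (S.lat y₀ 0))
            * casoratian (fun k => S.plusDelta.seqV (y₀ - I * S.gam / 2) (G k)) a))) := by
  rw [← casoratian_mul_column, ← casoratian_mul_row fun j => S.phiLat y₀ (2 * j + 1)
            / (S.plusDelta.theta .one (y₀ - I * S.gam / 2) j
              * S.plusDelta.theta .two (y₀ - I * S.gam / 2) j)]
  rw [← casoratian_congr (u := fun k j => S.xi (G k) (S.lat y₀ (j + 1)) / S.theta (G k).2 y₀ (j + 1)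
      - S.xi (G k) (S.lat y₀ j) / S.theta (G k).2 y₀ j),
    ← casoratian_snoc_one fun k j => S.xi (G k) (S.lat y₀ j) / S.theta (G k).2 y₀ j,
    ← casoratian_mul_row fun j => S.theta .one y₀ j * S.theta .two y₀ j]
  · refine casoratian_congr fun k i hi => ?_
    refine Fin.lastCases ?_ (fun k => ?_) k
    · simp [seqP, S.P_zero]
    · have n1 := theta_ne (t := .one) h (show a + i ≤ L + 1 by omega)
      have n2 := theta_ne (t := .two) h (show a + i ≤ L + 1 by omega)
      simp only [snocSeq_castSucc, seqV]
      rcases G k with ⟨v, _ | _⟩ <;> simp only [VType.other] <;> field_simp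
  · intro k i hi
    exact xi_quotient_sub hq₀ hq₁ h (G k) (by omega)

/-- Thus `Ξ_D` at `λ + δ` is, up to a constant, the Casoratian of the states of `D` with the zero
mode. The ratios in the Hamiltonian need this constant only to be nonzero. -/
theorem PD_zero_cen (hq₀ : 0 < S.q) (hq₁ : S.q < 1) (h : S.IsGeneric y₀ (L + 1)) {N : ℕ}
    (G : Fin N → Label) {a : ℕ} (hN : a + N ≤ L + 1) :
    S.PD G 0 (S.cen y₀ a (N + 1)) = S.deltaConst G * S.plusDelta.Xi G (S.cen y₀ a (N + 1)) := by
  have hδ := isGeneric_plusDelta hq₀ h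
  have e1 := colNorm_mul_theta hq₀ h .one hN (c := count G .one) (m := count G .two) (count_add G)
  have e2 := colNorm_mul_theta hq₀ h .two hN (c := count G .two) (m := count G .one)
    ((add_comm _ _).trans (count_add G))
  have hφ : ∏ i ∈ Finset.range N, S.phiLat y₀ (2 * (a + i) + 1) ≠ 0 :=
    Finset.prod_ne_zero_iff.2 fun i hi => h.phi_ne _ (by rw [Finset.mem_range] at hi; omega)
  have hI : I ^ ((N + 1) * (N + 1 - 1) / 2) = I ^ N * I ^ (N * (N - 1) / 2) := by
    rw [← pow_add, ← Finset.sum_range_id, ← Finset.sum_range_id, Finset.sum_range_succ, add_comm]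
  have hX := Xi_cen (S := S.plusDelta) hq₀ hδ G hN
  rw [plusDelta_cen] at hX
  rw [PD_cen hq₀ h G 0 hN, hX, casoratian_seqP_zero hq₀ hq₁ h G hN, casScale, casScale, deltaConst,
    plusDelta_phiPairs, hI]
  simp only [Finset.prod_div_distrib, Finset.prod_mul_distrib]
  rw [prod_comp_type G fun t => S.fac t (S.lat y₀ 0)]
  have hsplit : ∀ i₁ i₂ ν₁ ν₂ φδ Φ θ₁ θ₂ s δ₁ δ₂ c f₁ f₂ C : ℂ,
      i₁ * i₂ * (ν₂ * ν₁) / (φδ * Φ) * (θ₁ * θ₂ * (s * (Φ / (δ₁ * δ₂) * (c / (f₁ * f₂) * C))))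
        = i₁ * s * c * i₂ / φδ * C * (Φ / Φ) * ((ν₁ * θ₁ / (δ₁ * f₁)) * (ν₂ * θ₂ / (δ₂ * f₂))) :=
    fun i₁ i₂ ν₁ ν₂ φδ Φ θ₁ θ₂ s δ₁ δ₂ c f₁ f₂ C => by ring
  rw [hsplit, e1, e2, div_self hφ]
  simp only [Finset.prod_div_distrib]
  ring

end System

end

/-! ### The two identities at generic parameters and points. -/

noncomputable section

namespace System

variable {S : System}

theorem count_addLabel {M : ℕ} (D : Fin M → Label) (d : Label) (t : VType) :
    count (addLabel D d) t = count D t + if d.2 = t then 1 else 0 := by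
  have h : ∀ {N : ℕ} (D : Fin N → Label), count D t = ∑ k, if (D k).2 = t then 1 else 0 := by
    intro N D
    rw [count, Finset.card_filter]
  rw [h, h, Fin.sum_univ_castSucc]
  simp [addLabel]

theorem seqV_addLabel {M : ℕ} (D : Fin M → Label) (d : Label) (y₀ : ℂ) :
    (fun k => S.seqV y₀ (addLabel D d k))
      = snocSeq (fun k => S.seqV y₀ (D k)) (S.seqV y₀ d) := by
  funext k
  refine Fin.lastCases ?_ (fun k => ?_) k
  · simp [addLabel]
  · simp [addLabel]

theorem energy_zero : S.energy 0 = 0 := by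
  rcases hk : S.kind <;> simp [energy, hk]

theorem IsGeneric.mono {y₀ : ℂ} {L L' : ℕ} (h : S.IsGeneric y₀ L') (hL : L ≤ L') :
    S.IsGeneric y₀ L where
  fac_ne t j hj := h.fac_ne t j (by omega)
  facStar_ne t j hj := h.facStar_ne t j (by omega)
  phi_ne s hs := h.phi_ne s (by omega)

theorem coefR_ne {y₀ : ℂ} {L j : ℕ} (h : S.IsGeneric y₀ L) (hj : j < L) :
    S.coefR (S.lat y₀ j) ≠ 0 := by
  rw [coefR_lat]
  exact neg_ne_zero.2 (div_ne_zero (mul_ne_zero S.sig_ne_zero (mul_ne_zero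
    (h.facStar_ne _ _ (by omega)) (h.facStar_ne _ _ (by omega))))
    (mul_ne_zero (h.phi_ne _ (by omega)) (h.phi_ne _ (by omega))))

theorem coefL_ne {y₀ : ℂ} {L j : ℕ} (h : S.IsGeneric y₀ L) (hj : j < L) :
    S.coefL (S.lat y₀ (j + 1)) ≠ 0 := by
  rw [coefL_lat]
  exact neg_ne_zero.2 (div_ne_zero (mul_ne_zero S.sig_ne_zero (mul_ne_zero
    (h.fac_ne _ _ (by omega)) (h.fac_ne _ _ (by omega))))
    (mul_ne_zero (h.phi_ne _ (by omega)) (h.phi_ne _ (by omega))))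

theorem cen_sub_half (y₀ : ℂ) (a N : ℕ) :
    S.cen y₀ a (N + 1) - I * S.gam / 2 = S.cen y₀ (a + 1) N := by
  simp only [cen]
  push_cast
  ring

theorem cen_add_half (y₀ : ℂ) (a N : ℕ) :
    S.cen y₀ a (N + 1) + I * S.gam / 2 = S.cen y₀ a N := by
  simp only [cen]
  push_cast
  ring

theorem cen_sub (y₀ : ℂ) (a N : ℕ) : S.cen y₀ a N - I * S.gam = S.cen y₀ (a + 1) N := by
  simp only [cen]
  push_cast
  ring

theorem cen_add (y₀ : ℂ) (a N : ℕ) : S.cen y₀ (a + 1) N + I * S.gam = S.cen y₀ a N := by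
  simp only [cen]
  push_cast
  ring

theorem cen_succ_succ (y₀ : ℂ) (a N : ℕ) : S.cen y₀ a (N + 2) = S.cen y₀ (a + 1) N := by
  simp only [cen]
  push_cast
  ring

/-- Rescaling of the terms of the deformed Hamiltonian. -/
theorem rescale_term {v p p' μ₁ μ₂ π₁ π₂ ρ₁ ρ₂ K Z₁ : ℂ} (hμ : μ₂ ≠ 0) (hρ : ρ₁ ≠ 0) (hK : K ≠ 0)
    (hZ : Z₁ ≠ 0) (hr : v * μ₁ * π₂ = p * μ₂ * π₁) (hr' : v * μ₁ * ρ₂ = p' * μ₂ * ρ₁)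
    (g₁ g₂ f₁ f₂ Z₂ : ℂ) :
    v * (μ₁ * g₁ / (μ₂ * g₂)) * (π₂ * f₂ - (ρ₂ * Z₂ / K) / (ρ₁ * Z₁ / K) * (π₁ * f₁))
      = g₁ / g₂ * (p * f₂ - p' * (Z₂ / Z₁) * f₁) * π₁ := by
  have e1 : (ρ₂ * Z₂ / K) / (ρ₁ * Z₁ / K) = ρ₂ / ρ₁ * (Z₂ / Z₁) := by
    field_simp
  have e2 : v * (μ₁ / μ₂) * π₂ = p * π₁ := by
    field_simp
    linear_combination hr
  have e3 : v * (μ₁ / μ₂) * (ρ₂ / ρ₁) = p' := by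
    field_simp
    linear_combination hr'
  rw [e1, mul_div_mul_comm]
  linear_combination g₁ / g₂ * f₂ * e2 - g₁ / g₂ * (Z₂ / Z₁) * f₁ * π₁ * e3

/-- The point `x` is the centre of the `M + 2` places from `1` on; `x - iγ` and `x + iγ` belong to
the windows from `2` and from `0`, and `x - iγ/2`, `x + iγ/2` to the windows of `M + 1` places from
`2` and from `1`. So `casoratian_same_type` applies with `f, g` from `d₁, d₂` and `h, z` from `P_n,
P_0`. -/
theorem same_type_of_isGeneric (hq₀ : 0 < S.q) (hq₁ : S.q < 1) {M : ℕ} (D : Fin M → Label)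
    {d₁ d₂ : Label} (ht : d₁.2 = d₂.2) (n : ℕ) {y₀ : ℂ} (h : S.IsGeneric y₀ (M + 6))
    (hc : ∀ k, (S.twist (addLabel D d₂ k).2).fwd (addLabel D d₂ k).2 (addLabel D d₂ k).1 ≠ 0)
    {x : ℂ} (hx : x = S.cen y₀ 1 (M + 2))
    (h₁ : S.Xi (addLabel D d₂) (x - I * S.gam / 2) ≠ 0)
    (h₂ : S.Xi (addLabel D d₂) (x + I * S.gam / 2) ≠ 0)
    (h₃ : S.plusDelta.Xi (addLabel D d₂) x ≠ 0) :
    (S.energy n - S.virtEnergy d₁)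
        * (S.Xi (addLabel D d₁) (x - I * S.gam / 2) / S.Xi (addLabel D d₂) (x - I * S.gam / 2)
          + S.Xi (addLabel D d₁) (x + I * S.gam / 2) / S.Xi (addLabel D d₂) (x + I * S.gam / 2))
        * S.PD (addLabel D d₂) n x
      = S.ham (addLabel D d₂) (S.PD (addLabel D d₁) n) x
        + (S.energy n - S.virtEnergy d₁ - S.virtEnergy d₂) * S.PD (addLabel D d₁) n x := by
  subst hx
  have hct : ∀ t, count (addLabel D d₁) t = count (addLabel D d₂) t := fun t => by
    rw [count_addLabel, count_addLabel, ht]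
  have hK := deltaConst_ne (S := S) (addLabel D d₂) hc
  have hδ : ∀ a ≤ 2, S.plusDelta.Xi (addLabel D d₂) (S.cen y₀ a (M + 2))
      = S.PD (addLabel D d₂) 0 (S.cen y₀ a (M + 2)) / S.deltaConst (addLabel D d₂) := fun a ha => by
    rw [PD_zero_cen hq₀ hq₁ h (addLabel D d₂) (show a + (M + 1) ≤ M + 6 by omega),
      mul_div_cancel_left₀ _ hK]
  have hΞ : ∀ d : Label, ∀ a ≤ 2, S.Xi (addLabel D d) (S.cen y₀ a (M + 1)) = S.casScale y₀ a (M + 1)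
      (count (addLabel D d) .one) (count (addLabel D d) .two)
      * casoratian (snocSeq (fun k => S.seqV y₀ (D k)) (S.seqV y₀ d)) a := fun d a ha => by
    rw [Xi_cen hq₀ h _ (show a + (M + 1) ≤ M + 6 + 1 by omega), seqV_addLabel]
  have hP : ∀ (d : Label) (n : ℕ), ∀ a ≤ 2, S.PD (addLabel D d) n (S.cen y₀ a (M + 2))
      = S.casScale y₀ a (M + 2)
        (count (addLabel D d) .one + 1) (count (addLabel D d) .two + 1)
      * casoratian (snocSeq (snocSeq (fun k => S.seqV y₀ (D k)) (S.seqV y₀ d)) (S.seqP y₀ n)) a :=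
    fun d n a ha => by
      rw [PD_cen hq₀ h _ _ (show a + (M + 1) ≤ M + 6 by omega), seqV_addLabel]
  rw [cen_sub_half, hΞ _ _ (by omega)] at h₁
  rw [cen_add_half, hΞ _ _ (by omega)] at h₂
  rw [hδ 1 (by omega), hP _ _ _ (by omega)] at h₃
  have hs := h.mono (show M + 2 + 1 ≤ M + 6 by omega)
  have key := casoratian_same_type (N := M) (f := S.seqV y₀ d₁) (g := S.seqV y₀ d₂)
    (h := S.seqP y₀ n) (z := S.seqP y₀ 0)
    (fun j hj => coefR_ne h (show j + 1 < M + 6 by omega)) (coefL_ne h (show 0 < M + 6 by omega))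
    (fun k => isSol_seqV hq₀ hq₁ hs (D k)) (isSol_seqV hq₀ hq₁ hs d₁) (isSol_seqV hq₀ hq₁ hs d₂)
    (isSol_seqP hq₀ hq₁ hs n) (S.energy_zero ▸ isSol_seqP hq₀ hq₁ hs 0)
    (right_ne_zero_of_mul h₂) (right_ne_zero_of_mul h₁)
    (right_ne_zero_of_mul (left_ne_zero_of_mul h₃))
  have r1 := V_mul_casScale hq₀ h (a := 1) (addLabel D d₂) (by omega)
  have r2 := Vstar_mul_casScale hq₀ h (a := 0) (addLabel D d₂) (by omega)
  rw [ham, hamWith, cen_sub_half, cen_add_half, cen_sub, cen_add, hδ 0 (by omega), hδ 1 (by omega),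
    hδ 2 (by omega)]
  simp only [hΞ _ 1 (by omega), hΞ _ 2 (by omega), hP _ _ 0 (by omega), hP _ _ 1 (by omega),
    hP _ _ 2 (by omega), hct] at h₁ h₂ h₃ key ⊢
  rw [show 1 + (M + 1) = M + 2 by ring] at r1
  have n1 := left_ne_zero_of_mul h₁
  have n2 := left_ne_zero_of_mul h₂
  have n3 := left_ne_zero_of_mul (left_ne_zero_of_mul h₃)
  have n4 := right_ne_zero_of_mul (left_ne_zero_of_mul h₃)
  -- Equal types mean equal counts, so both `P` and `Ξ` at `λ + δ` carry the same scalars and one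
  -- relation serves in both places.
  rw [rescale_term n1 n3 hK n4 r1 r1, rescale_term n2 n3 hK n4 r2 r2, mul_div_mul_left _ _ n1,
    mul_div_mul_left _ _ n2]
  linear_combination S.casScale y₀ 1 (M + 2) (count (addLabel D d₂) .one + 1)
    (count (addLabel D d₂) .two + 1) * key

/-- The windows of `D` lie concentrically inside those of `D'''`, two places shorter, so they start
one place later. The identity is `casoratian_other_type`. -/
theorem other_type_of_isGeneric (hq₀ : 0 < S.q) (hq₁ : S.q < 1) {M : ℕ} (D : Fin M → Label)
    {d₁ d₂ : Label} (ht : d₁.2 ≠ d₂.2) (n : ℕ) {y₀ : ℂ} (h : S.IsGeneric y₀ (M + 6))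
    (hc : ∀ k, (S.twist (addLabel (addLabel D d₁) d₂ k).2).fwd (addLabel (addLabel D d₁) d₂ k).2
      (addLabel (addLabel D d₁) d₂ k).1 ≠ 0)
    {x : ℂ} (hx : x = S.cen y₀ 1 (M + 3))
    (h₁ : S.Xi (addLabel (addLabel D d₁) d₂) (x - I * S.gam / 2) ≠ 0)
    (h₂ : S.Xi (addLabel (addLabel D d₁) d₂) (x + I * S.gam / 2) ≠ 0)
    (h₃ : S.plusDelta.Xi (addLabel (addLabel D d₁) d₂) x ≠ 0) :
    ((S.kappa ^ (2 * (M : ℝ) + 3 / 2) : ℝ) : ℂ) * S.sqrtAlpha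
        * (S.Xi D (x - I * S.gam / 2) / S.Xi (addLabel (addLabel D d₁) d₂) (x - I * S.gam / 2)
          + S.Xi D (x + I * S.gam / 2) / S.Xi (addLabel (addLabel D d₁) d₂) (x + I * S.gam / 2))
        * S.PD (addLabel (addLabel D d₁) d₂) n x
      = S.ham (addLabel (addLabel D d₁) d₂) (S.PD D n) x
        + (S.energy n - S.virtEnergy d₁ - S.virtEnergy d₂) * S.PD D n x := by
  subst hx
  set G := addLabel (addLabel D d₁) d₂ with hG
  have hct : ∀ t, count G t = count D t + 1 := fun t => by
    rw [hG, count_addLabel, count_addLabel]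
    revert ht
    rcases d₁ with ⟨_, _ | _⟩ <;> rcases d₂ with ⟨_, _ | _⟩ <;> cases t <;> simp
  have hseq : (fun k => S.seqV y₀ (G k)) = snocSeq (snocSeq (fun k => S.seqV y₀ (D k))
      (S.seqV y₀ d₁)) (S.seqV y₀ d₂) := by
    rw [hG, seqV_addLabel, seqV_addLabel]
  have hK := deltaConst_ne (S := S) G hc
  have hδ : ∀ a ≤ 2, S.plusDelta.Xi G (S.cen y₀ a (M + 3))
      = S.PD G 0 (S.cen y₀ a (M + 3)) / S.deltaConst G := fun a ha => by
    rw [PD_zero_cen hq₀ hq₁ h G (show a + (M + 2) ≤ M + 6 by omega), mul_div_cancel_left₀ _ hK]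
  have hΞ : ∀ a ≤ 2, S.Xi G (S.cen y₀ a (M + 2))
      = S.casScale y₀ a (M + 2) (count D .one + 1) (count D .two + 1)
      * casoratian (snocSeq (snocSeq (fun k => S.seqV y₀ (D k))
        (S.seqV y₀ d₁)) (S.seqV y₀ d₂)) a := fun a ha => by
    rw [Xi_cen hq₀ h _ (show a + (M + 2) ≤ M + 6 + 1 by omega), hseq, hct, hct]
  have hΞ' : ∀ a ≤ 2, S.Xi D (S.cen y₀ a (M + 2))
      = S.casScale y₀ (a + 1) M (count D .one) (count D .two)
      * casoratian (fun k => S.seqV y₀ (D k)) (a + 1) := fun a ha => by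
    rw [cen_succ_succ, Xi_cen hq₀ h _ (show a + 1 + M ≤ M + 6 + 1 by omega)]
  have hP : ∀ n : ℕ, ∀ a ≤ 2, S.PD G n (S.cen y₀ a (M + 3))
      = S.casScale y₀ a (M + 3) (count D .one + 2) (count D .two + 2)
      * casoratian (snocSeq (snocSeq (snocSeq (fun k => S.seqV y₀ (D k))
        (S.seqV y₀ d₁)) (S.seqV y₀ d₂)) (S.seqP y₀ n)) a := fun n a ha => by
    rw [PD_cen hq₀ h _ _ (show a + (M + 2) ≤ M + 6 by omega), hseq, hct, hct]
  have hP' : ∀ n : ℕ, ∀ a ≤ 2, S.PD D n (S.cen y₀ a (M + 3))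
      = S.casScale y₀ (a + 1) (M + 1) (count D .one + 1) (count D .two + 1)
      * casoratian (snocSeq (fun k => S.seqV y₀ (D k)) (S.seqP y₀ n)) (a + 1) := fun n a ha => by
    rw [cen_succ_succ, PD_cen hq₀ h _ _ (show a + 1 + M ≤ M + 6 by omega)]
  rw [cen_sub_half, hΞ _ (by omega)] at h₁
  rw [cen_add_half, hΞ _ (by omega)] at h₂
  rw [hδ 1 (by omega), hP _ _ (by omega)] at h₃
  have hs := h.mono (show M + 3 + 1 ≤ M + 6 by omega)
  have key := casoratian_other_type (N := M) (f := S.seqV y₀ d₁) (g := S.seqV y₀ d₂)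
    (h := S.seqP y₀ n) (z := S.seqP y₀ 0)
    (fun j hj => coefR_ne h (show j + 1 < M + 6 by omega)) (coefL_ne h (show 0 < M + 6 by omega))
    (fun k => isSol_seqV hq₀ hq₁ hs (D k)) (isSol_seqV hq₀ hq₁ hs d₁) (isSol_seqV hq₀ hq₁ hs d₂)
    (isSol_seqP hq₀ hq₁ hs n) (S.energy_zero ▸ isSol_seqP hq₀ hq₁ hs 0)
    (right_ne_zero_of_mul h₂) (right_ne_zero_of_mul h₁)
    (right_ne_zero_of_mul (left_ne_zero_of_mul h₃))
  have r1 := V_mul_casScale hq₀ h (a := 1) G (by omega)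
  have r2 := Vstar_mul_casScale hq₀ h (a := 0) G (by omega)
  have hc₁ := count_le D .one
  have hc₂ := count_le D .two
  have k1 := kappa_mul_casScale_right hq₀ h (a := 1) hc₁ hc₂ (by omega)
  have k2 := kappa_mul_casScale_left hq₀ h (a := 1) hc₁ hc₂ (by omega)
  have k3 := kappa_mul_casScale_right hq₀ h (a := 2) hc₁ hc₂ (by omega)
  have k4 := kappa_mul_casScale_left hq₀ h (a := 0) hc₁ hc₂ (by omega)
  have p1 := coefR_ne h (show M + 3 < M + 6 by omega)
  have p2 := coefL_ne h (show 0 < M + 6 by omega)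
  rw [ham, hamWith, cen_sub_half, cen_add_half, cen_sub, cen_add, hδ 0 (by omega), hδ 1 (by omega),
    hδ 2 (by omega)]
  rw [hct, hct, show 1 + (M + 2) = M + 3 by ring] at r1
  rw [hct, hct] at r2
  rw [show 1 + M + 1 = M + 2 by ring] at k1
  rw [show 2 + M + 1 = M + 3 by ring] at k3
  simp only [hΞ 1 (by omega), hΞ 2 (by omega), hP _ 0 (by omega), hP _ 1 (by omega),
    hP _ 2 (by omega), hΞ' 1 (by omega), hΞ' 2 (by omega), hP' _ 0 (by omega), hP' _ 1 (by omega),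
    hP' _ 2 (by omega)]
  simp only [Nat.reduceAdd, zero_add] at *
  have n1 := left_ne_zero_of_mul h₁
  have n2 := left_ne_zero_of_mul h₂
  have n3 := left_ne_zero_of_mul (left_ne_zero_of_mul h₃)
  have n4 := right_ne_zero_of_mul (left_ne_zero_of_mul h₃)
  generalize ((S.kappa ^ (2 * (M : ℝ) + 3 / 2) : ℝ) : ℂ) * S.sqrtAlpha = c at *
  generalize S.casScale y₀ 2 M (count D .one) (count D .two) = u₂ at *
  generalize S.casScale y₀ 3 M (count D .one) (count D .two) = u₃ at *
  generalize S.casScale y₀ 1 (M + 2) (count D .one + 1) (count D .two + 1) = m₁ at *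
  generalize S.casScale y₀ 2 (M + 2) (count D .one + 1) (count D .two + 1) = m₂ at *
  generalize S.casScale y₀ 0 (M + 3) (count D .one + 2) (count D .two + 2) = s₀ at *
  generalize S.casScale y₀ 1 (M + 3) (count D .one + 2) (count D .two + 2) = s₁ at *
  generalize S.casScale y₀ 2 (M + 3) (count D .one + 2) (count D .two + 2) = s₂ at *
  generalize S.casScale y₀ 1 (M + 1) (count D .one + 1) (count D .two + 1) = w₁ at *
  generalize S.casScale y₀ 2 (M + 1) (count D .one + 1) (count D .two + 1) = w₂ at *
  generalize S.casScale y₀ 3 (M + 1) (count D .one + 1) (count D .two + 1) = w₃ at *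
  generalize (S.deform G).V (S.cen y₀ 1 (M + 3)) = v at *
  generalize (S.deform G).Vstar (S.cen y₀ 1 (M + 3)) = v' at *
  -- The scalars of `P_{D,n}` are not those of `P_{D''',0}`, so two relations are needed for each
  -- potential: `V` meets `coefL` in the former and `coefR` in the latter. The new one follows from
  -- `r1`, `k2`, `k3` after cancelling the nonzero factor `coefR * m₂`.
  have r5 : v * m₁ * w₃ = S.coefL (S.lat y₀ 2) * m₂ * w₂ := by
    apply mul_left_cancel₀ (mul_ne_zero p1 n1)
    linear_combination c * u₃ * r1 - v * m₁ * k3 + S.coefR (S.lat y₀ (M + 3)) * m₂ * k2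
  have r6 : v' * m₂ * w₁ = S.coefR (S.lat y₀ (M + 2)) * m₁ * w₂ := by
    apply mul_left_cancel₀ (mul_ne_zero p2 n2)
    linear_combination c * u₂ * r2 - v' * m₂ * k4 + S.coefL (S.lat y₀ 1) * m₁ * k1
  rw [rescale_term n1 n3 hK n4 r5 r1, rescale_term n2 n3 hK n4 r6 r2]
  have e1 : ∀ A B : ℂ, c * (u₃ * A / (m₂ * B)) * s₁ = S.coefL (S.lat y₀ 2) * w₂ * (A / B) := by
    intro A B
    have : c * (u₃ / m₂) * s₁ = S.coefL (S.lat y₀ 2) * w₂ := by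
      field_simp
      linear_combination k2
    rw [mul_div_mul_comm]
    linear_combination A / B * this
  have e2 : ∀ A B : ℂ, c * (u₂ * A / (m₁ * B)) * s₁ = S.coefR (S.lat y₀ (M + 2)) * w₂ * (A / B) := by
    intro A B
    have : c * (u₂ / m₁) * s₁ = S.coefR (S.lat y₀ (M + 2)) * w₂ := by
      field_simp
      linear_combination k1
    rw [mul_div_mul_comm]
    linear_combination A / B * this
  have e3 : ∀ A B A' B' T : ℂ, c * (u₃ * A / (m₂ * B) + u₂ * A' / (m₁ * B')) * (s₁ * T)
      = w₂ * (T * (S.coefL (S.lat y₀ 2) * A / B + S.coefR (S.lat y₀ (M + 2)) * A' / B')) := by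
    intro A B A' B' T
    linear_combination T * e1 A B + T * e2 A' B'
  rw [e3]
  linear_combination w₂ * key

end System

end

/-! ### Joint continuity in the parameters and the point. -/

noncomputable section

namespace System

variable (S : System)

/-- The system with the parameters replaced. -/
def withLam (f : Fin 4 → ℂ) : System := { S with lam := f }

section Continuity

variable {S} {X : Type*} [TopologicalSpace X] {f : X → Fin 4 → ℂ} {b x : X → ℂ}

@[fun_prop]
theorem continuous_lin (hq : 0 < S.q) (hb : Continuous b) (hx : Continuous x) :
    Continuous fun p => S.lin (b p) (x p) := by
  rcases hk : S.kind with _ | _ | _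
  · simp only [lin, hk]
    fun_prop
  · simp only [lin, hk]
    fun_prop
  · simp only [lin, hk, S.cpow_q hq]
    fun_prop

@[fun_prop]
theorem continuous_poch (hq : 0 < S.q) (hb : Continuous b) (hx : Continuous x) (n : ℕ) :
    Continuous fun p => S.poch (b p) (x p) n :=
  continuous_finsetProd _ fun _ _ => continuous_lin hq (hb.add continuous_const) hx

theorem withLam_kind (f : Fin 4 → ℂ) : (S.withLam f).kind = S.kind := rfl
theorem withLam_q (f : Fin 4 → ℂ) : (S.withLam f).q = S.q := rfl
theorem withLam_lam (f : Fin 4 → ℂ) : (S.withLam f).lam = f := rfl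
theorem withLam_lin (f : Fin 4 → ℂ) : (S.withLam f).lin = S.lin := rfl
theorem withLam_poch (f : Fin 4 → ℂ) : (S.withLam f).poch = S.poch := rfl
theorem withLam_pair (f : Fin 4 → ℂ) : (S.withLam f).pair = S.pair := rfl
theorem withLam_gam (f : Fin 4 → ℂ) : (S.withLam f).gam = S.gam := rfl
theorem withLam_phi (f : Fin 4 → ℂ) : (S.withLam f).phi = S.phi := rfl

-- No denominator of `P` depends on the parameters, since the quotients `(c)_n / (c)_k` are written
-- as products; hence continuity holds without exception.
@[fun_prop]
theorem continuous_P (hq : 0 < S.q) (hf : Continuous f) (hx : Continuous x) (n : ℕ) :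
    Continuous fun p => (S.withLam (f p)).P n (x p) := by
  rcases hk : S.kind with _ | _ | _
  · simp only [P, withLam_kind, withLam_lam, withLam_poch, hk]
    fun_prop (disch := assumption)
  · simp only [P, withLam_kind, withLam_lam, withLam_poch, hk]
    fun_prop (disch := assumption)
  · simp only [P, withLam_kind, withLam_lam, withLam_poch, withLam_q, hk, S.cpow_q hq]
    fun_prop (disch := assumption)

@[fun_prop]
theorem continuous_xi (hq : 0 < S.q) (hf : Continuous f) (hx : Continuous x) (d : Label) :
    Continuous fun p => (S.withLam (f p)).xi d (x p) := by
  refine continuous_P (S := S) (f := fun p => ((S.withLam (f p)).twist d.2).lam) hq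
    (continuous_pi fun k => ?_) hx _
  rcases hk : S.kind with _ | _ | _ <;>
    simp only [twist, withLam_lam, withLam_kind, withLam_pair, hk] <;> split_ifs <;> fun_prop

theorem continuous_phi (hx : Continuous x) : Continuous fun p => S.phi (x p) := by
  rcases hk : S.kind with _ | _ | _ <;> simp only [phi, hk] <;> fun_prop

theorem continuous_pairSum (hf : Continuous f) (t : VType) :
    Continuous fun p => (S.withLam (f p)).pairSum t := by
  simp only [pairSum, withLam_lam, withLam_pair]
  fun_prop

theorem continuous_pairPoch (hq : 0 < S.q) (hf : Continuous f) (hx : Continuous x) (t : VType)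
    (s : ℂ) (m n : ℕ) : Continuous fun p => (S.withLam (f p)).pairPoch t s m n (x p) := by
  rcases hk : S.kind with _ | _ | _ <;>
    simp only [pairPoch, withLam_kind, withLam_lam, withLam_pair, withLam_poch, hk] <;>
    fun_prop (disch := assumption)

theorem continuous_r (hq : 0 < S.q) (hf : Continuous f) (hx : Continuous x) (t : VType) {N : ℕ}
    (j : Fin N) : Continuous fun p => (S.withLam (f p)).r t j (x p) := by
  have h1 := continuous_pairPoch hq hf hx t (-((N : ℂ) - 1) / 2) j (N - 1 - j)
  have h2 := continuous_pairSum (S := S) hf t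
  rcases hk : S.kind with _ | _ | _ <;>
    simp only [r, alphaPow, kappa, phase, withLam_kind, withLam_q, hk, S.cpow_q hq] <;>
    fun_prop

theorem continuous_node (hx : Continuous x) {N : ℕ} (j : Fin N) :
    Continuous fun p => S.node (x p) j := by
  simp only [node]
  fun_prop

theorem continuous_colV (hq : 0 < S.q) (hf : Continuous f) (hx : Continuous x) (d : Label) {N : ℕ}
    (j : Fin N) : Continuous fun p => (S.withLam (f p)).colV d (x p) j :=
  (continuous_r hq hf hx _ j).mul (continuous_xi hq hf (continuous_node (S := S) hx j) d)

theorem continuous_colP (hq : 0 < S.q) (hf : Continuous f) (hx : Continuous x) (n : ℕ) {N : ℕ}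
    (j : Fin N) : Continuous fun p => (S.withLam (f p)).colP n (x p) j :=
  ((continuous_r hq hf hx _ j).mul (continuous_r hq hf hx _ j)).mul
    (continuous_P hq hf (continuous_node (S := S) hx j) n)

theorem continuous_XiNum (hq : 0 < S.q) (hf : Continuous f) (hx : Continuous x) {M : ℕ}
    (D : Fin M → Label) : Continuous fun p => (S.withLam (f p)).XiNum D (x p) :=
  continuous_const.mul (Continuous.matrix_det (continuous_matrix fun j k =>
    continuous_colV hq hf hx (D k) j))

theorem continuous_PNum (hq : 0 < S.q) (hf : Continuous f) (hx : Continuous x) {M : ℕ}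
    (D : Fin M → Label) (n : ℕ) : Continuous fun p => (S.withLam (f p)).PNum D n (x p) := by
  refine continuous_const.mul (Continuous.matrix_det (continuous_matrix fun j k => ?_))
  simp only [Matrix.of_apply]
  refine Fin.lastCases ?_ (fun k => ?_) k
  · simp only [Fin.snoc_last]
    exact continuous_colP hq hf hx n j
  · simp only [Fin.snoc_castSucc]
    exact continuous_colV hq hf hx (D k) j

theorem continuous_phiN (hx : Continuous x) (N : ℕ) : Continuous fun p => S.phiN N (x p) := by
  refine ((continuous_phi hx).pow _).mul (continuous_finsetProd _ fun k _ =>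
    ((continuous_phi ?_).mul (continuous_phi ?_)).pow _) <;> fun_prop

theorem continuous_normA (hq : 0 < S.q) (hf : Continuous f) (hx : Continuous x) (N m₁ m₂ : ℕ) :
    Continuous fun p => (S.withLam (f p)).normA N m₁ m₂ (x p) := by
  have h : ∀ t j, Continuous fun p => (S.withLam (f p)).normC t j := by
    intro t j
    have h2 := continuous_pairSum (S := S) hf t
    rcases hk : S.kind with _ | _ | _ <;>
      simp only [normC, withLam_kind, withLam_q, hk, S.cpow_q hq] <;> fun_prop
  exact (continuous_finsetProd _ fun j _ => (h _ _).mul (continuous_pairPoch hq hf hx _ _ _ _)).mul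
    (continuous_finsetProd _ fun j _ => (h _ _).mul (continuous_pairPoch hq hf hx _ _ _ _))

theorem continuous_XiDen (hq : 0 < S.q) (hf : Continuous f) (hx : Continuous x) {M : ℕ}
    (D : Fin M → Label) : Continuous fun p => (S.withLam (f p)).XiDen D (x p) :=
  (continuous_phiN (S := S) hx _).mul (continuous_normA hq hf hx _ _ _)

theorem continuous_PDen (hq : 0 < S.q) (hf : Continuous f) (hx : Continuous x) {M : ℕ}
    (D : Fin M → Label) : Continuous fun p => (S.withLam (f p)).PDen D (x p) :=
  (continuous_phiN (S := S) hx _).mul (continuous_normA hq hf hx _ _ _)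

theorem continuousAt_Xi (hq : 0 < S.q) (hf : Continuous f) (hx : Continuous x) {M : ℕ}
    (D : Fin M → Label) {p : X} (h : (S.withLam (f p)).XiDen D (x p) ≠ 0) :
    ContinuousAt (fun p => (S.withLam (f p)).Xi D (x p)) p :=
  (continuous_XiNum hq hf hx D).continuousAt.div (continuous_XiDen hq hf hx D).continuousAt h

theorem continuousAt_PD (hq : 0 < S.q) (hf : Continuous f) (hx : Continuous x) {M : ℕ}
    (D : Fin M → Label) (n : ℕ) {p : X} (h : (S.withLam (f p)).PDen D (x p) ≠ 0) :
    ContinuousAt (fun p => (S.withLam (f p)).PD D n (x p)) p :=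
  (continuous_PNum hq hf hx D n).continuousAt.div (continuous_PDen hq hf hx D).continuousAt h

theorem continuousAt_V (hq : 0 < S.q) (hf : Continuous f) (hx : Continuous x) {p : X}
    (h : S.Vden (x p) ≠ 0) : ContinuousAt (fun p => (S.withLam (f p)).V (x p)) p := by
  rcases hk : S.kind with _ | _ | _
  · simp only [V, withLam_kind, withLam_lam, withLam_lin, hk]
    exact Continuous.continuousAt (by fun_prop (disch := assumption))
  · simp only [Vden, hk] at h
    simp only [V, withLam_kind, withLam_lam, withLam_lin, hk]
    exact ContinuousAt.div (Continuous.continuousAt (by fun_prop (disch := assumption)))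
      (Continuous.continuousAt (by fun_prop)) h
  · simp only [Vden, hk] at h
    simp only [V, withLam_kind, withLam_lam, withLam_lin, withLam_q, hk]
    exact ContinuousAt.div (Continuous.continuousAt (by fun_prop (disch := assumption)))
      (Continuous.continuousAt (by fun_prop)) h

theorem continuousAt_Vstar (hq : 0 < S.q) (hf : Continuous f) (hx : Continuous x) {p : X}
    (h : S.Vden (-x p) ≠ 0) : ContinuousAt (fun p => (S.withLam (f p)).Vstar (x p)) p := by
  have hV : ContinuousAt (fun p => (S.withLam (f p)).V (-x p)) p := continuousAt_V hq hf hx.neg h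
  rcases hk : S.kind with _ | _ | _
  · simp only [Vstar, withLam_kind, withLam_lam, withLam_lin, hk]
    exact Continuous.continuousAt (by fun_prop (disch := assumption))
  · simpa only [Vstar, withLam_kind, hk] using hV
  · simpa only [Vstar, withLam_kind, hk] using hV

theorem continuous_energy (hq : 0 < S.q) (hf : Continuous f) (n : ℕ) :
    Continuous fun p => (S.withLam (f p)).energy n := by
  rcases hk : S.kind with _ | _ | _ <;>
    simp only [energy, withLam_kind, withLam_lam, withLam_q, hk, S.cpow_q hq] <;> fun_prop

theorem continuous_virtEnergy (hq : 0 < S.q) (hf : Continuous f) (d : Label) :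
    Continuous fun p => (S.withLam (f p)).virtEnergy d := by
  have h1 := continuous_pairSum (S := S) hf d.2
  have h2 := continuous_pairSum (S := S) hf d.2.other
  simp only [virtEnergy, withLam_lin]
  fun_prop (disch := assumption)

theorem continuous_sqrtAlpha (hq : 0 < S.q) (hf : Continuous f) :
    Continuous fun p => (S.withLam (f p)).sqrtAlpha := by
  have h1 := continuous_pairSum (S := S) hf .one
  have h2 := continuous_pairSum (S := S) hf .two
  rcases hk : S.kind with _ | _ | _ <;>
    simp only [sqrtAlpha, alphaPow, withLam_kind, withLam_q, hk, S.cpow_q hq] <;> fun_prop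

end Continuity

end System

end

/-! ### Non-vanishing after a small translation, and a common limit argument. -/

noncomputable section

section Eventually

open Filter Topology

theorem eventually_mul_ne {f g : ℂ → ℂ} (hf : ∀ᶠ s in 𝓝[≠] (0 : ℂ), f s ≠ 0)
    (hg : ∀ᶠ s in 𝓝[≠] (0 : ℂ), g s ≠ 0) : ∀ᶠ s in 𝓝[≠] (0 : ℂ), f s * g s ≠ 0 := by
  filter_upwards [hf, hg] with s h1 h2 using mul_ne_zero h1 h2

theorem eventually_prod_ne {ι : Type*} (A : Finset ι) {f : ι → ℂ → ℂ}
    (hf : ∀ i ∈ A, ∀ᶠ s in 𝓝[≠] (0 : ℂ), f i s ≠ 0) :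
    ∀ᶠ s in 𝓝[≠] (0 : ℂ), ∏ i ∈ A, f i s ≠ 0 := by
  filter_upwards [(eventually_all_finset A).2 hf] with s h using Finset.prod_ne_zero_iff.2 h

theorem eventually_affine_ne (A : ℂ) {B : ℂ} (hB : B ≠ 0) :
    ∀ᶠ s in 𝓝[≠] (0 : ℂ), A + B * s ≠ 0 := by
  have h : HasDerivAt (fun s => A + B * s) B 0 := by
    simpa using ((hasDerivAt_id (0 : ℂ)).const_mul B).const_add A
  exact h.eventually_ne hB

theorem eventually_one_sub_exp_ne (A : ℂ) {B : ℂ} (hB : B ≠ 0) :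
    ∀ᶠ s in 𝓝[≠] (0 : ℂ), 1 - Complex.exp (A + B * s) ≠ 0 := by
  have h : HasDerivAt (fun s => A + B * s) B 0 := by
    simpa using ((hasDerivAt_id (0 : ℂ)).const_mul B).const_add A
  exact (h.cexp.const_sub 1).eventually_ne
    (neg_ne_zero.2 (mul_ne_zero (Complex.exp_ne_zero _) hB))

namespace System

variable {S : System}

theorem ofReal_add_I_mul_ne (c : ℝ) {e : ℝ} (he : e ≠ 0) : (c : ℂ) + I * e ≠ 0 := fun h =>
  he (by simpa using congrArg Complex.im h)

/-- The argument `b + iy` moves by `(c + ie) s`, and `c + ie ≠ 0` because `c` and `e` are real with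
`e ≠ 0`. So the function of `s` has nonzero derivative at each of its zeros, in particular at `0` if
it vanishes there. -/
theorem eventually_lin_ne (hq : 0 < S.q) (b y : ℂ) (c : ℝ) {e : ℝ} (he : e ≠ 0) :
    ∀ᶠ s in 𝓝[≠] (0 : ℂ), S.lin (b + c * s) (y + e * s) ≠ 0 := by
  have h1 := eventually_affine_ne (b + I * y) (ofReal_add_I_mul_ne c he)
  rcases hk : S.kind with _ | _ | _
  · filter_upwards [h1] with s hs
    simp only [lin, hk]
    convert hs using 1
    ring
  · filter_upwards [h1] with s hs
    simp only [lin, hk]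
    convert hs using 1
    ring
  · filter_upwards [eventually_one_sub_exp_ne ((Real.log S.q : ℂ) * b + I * y)
      (ofReal_add_I_mul_ne (Real.log S.q * c) he)] with s hs
    simp only [lin, hk, S.cpow_q hq, ← Complex.exp_add]
    convert hs using 3
    push_cast
    ring

theorem eventually_phi_ne (y : ℂ) : ∀ᶠ s in 𝓝[≠] (0 : ℂ), S.phi (y + s) ≠ 0 := by
  rcases hk : S.kind with _ | _ | _
  · simp [phi, hk]
  · filter_upwards [eventually_affine_ne (2 * y) (two_ne_zero (α := ℂ))] with s hs
    simp only [phi, hk]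
    convert hs using 1
    ring
  · filter_upwards [eventually_one_sub_exp_ne (2 * I * y)
      (mul_ne_zero (two_ne_zero (α := ℂ)) I_ne_zero)] with s hs
    simp only [phi, hk]
    rw [← mul_add, one_sub_exp] at hs
    exact right_ne_zero_of_mul hs

variable (S) in
/-- The system with all parameters translated. -/
def translate (s : ℂ) : System := S.withLam fun k => S.lam k + s

theorem translate_zero : S.translate 0 = S := by
  simp [translate, withLam]

theorem eventually_translate_fac_ne (hq : 0 < S.q) (t : VType) (y : ℂ) :
    ∀ᶠ s in 𝓝[≠] (0 : ℂ), (S.translate s).fac t (y + s) ≠ 0 := by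
  have h : ∀ k, ∀ᶠ s in 𝓝[≠] (0 : ℂ), S.lin (S.lam k + s) (y + s) ≠ 0 := fun k => by
    simpa using eventually_lin_ne hq (S.lam k) y 1 one_ne_zero
  filter_upwards [h (S.pair t).1, h (S.pair t).2] with s h1 h2
  rcases hk : S.kind with _ | _ | _ <;>
    simp only [fac, translate, withLam_kind, withLam_lam, withLam_lin, withLam_pair, hk]
  · exact mul_ne_zero I_ne_zero h1
  · exact mul_ne_zero h1 h2
  · exact mul_ne_zero (Complex.exp_ne_zero _) (mul_ne_zero h1 h2)

theorem eventually_translate_facStar_ne (hq : 0 < S.q) (t : VType) (y : ℂ) :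
    ∀ᶠ s in 𝓝[≠] (0 : ℂ), (S.translate s).facStar t (y + s) ≠ 0 := by
  have h : ∀ k, ∀ᶠ s in 𝓝[≠] (0 : ℂ), S.lin (S.lam k + s) (-(y + s)) ≠ 0 := fun k => by
    have := eventually_lin_ne hq (S.lam k) (-y) 1 (neg_ne_zero.2 one_ne_zero)
    filter_upwards [this] with s hs
    convert hs using 2
    · simp
    · push_cast
      ring
  filter_upwards [h (S.pair t).1, h (S.pair t).2] with s h1 h2
  rcases hk : S.kind with _ | _ | _ <;>
    simp only [facStar, fac, translate, withLam_kind, withLam_lam, withLam_lin, withLam_pair, hk]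
  · exact mul_ne_zero (neg_ne_zero.2 I_ne_zero) h2
  · exact mul_ne_zero h1 h2
  · exact mul_ne_zero (Complex.exp_ne_zero _) (mul_ne_zero h1 h2)

/-- Parameters and point move by the same complex `s`. The factors `fac` then move with velocity `1
+ i`, the factors `facStar` with `1 - i`, and `φ` moves with the point; none of these velocities
vanishes. -/
theorem eventually_isGeneric (hq : 0 < S.q) (y₀ : ℂ) (L : ℕ) :
    ∀ᶠ s in 𝓝[≠] (0 : ℂ), (S.translate s).IsGeneric (y₀ + s) L := by
  have hl : ∀ (s : ℂ) (j : ℕ), (S.translate s).lat (y₀ + s) j = S.lat y₀ j + s := fun s j => by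
    simp only [lat, translate, withLam_gam]
    ring
  have h1 : ∀ t, ∀ᶠ s in 𝓝[≠] (0 : ℂ), ∀ j ∈ Finset.Iic L,
      (S.translate s).fac t ((S.translate s).lat (y₀ + s) j) ≠ 0 := fun t =>
    (eventually_all_finset _).2 fun j _ => by
      simp only [hl]
      exact eventually_translate_fac_ne hq t _
  have h2 : ∀ t, ∀ᶠ s in 𝓝[≠] (0 : ℂ), ∀ j ∈ Finset.Iic L,
      (S.translate s).facStar t ((S.translate s).lat (y₀ + s) j) ≠ 0 := fun t =>
    (eventually_all_finset _).2 fun j _ => by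
      simp only [hl]
      exact eventually_translate_facStar_ne hq t _
  have h3 : ∀ᶠ s in 𝓝[≠] (0 : ℂ), ∀ j ∈ Finset.Iic (2 * L + 1),
      (S.translate s).phiLat (y₀ + s) j ≠ 0 :=
    (eventually_all_finset _).2 fun j _ => by
      filter_upwards [eventually_phi_ne (S := S) (y₀ - I * (j / 2) * S.gam)] with s hs
      simp only [phiLat, translate, withLam_gam, withLam_phi]
      convert hs using 2
      ring
  filter_upwards [h1 .one, h1 .two, h2 .one, h2 .two, h3] with s a1 a2 a3 a4 a5
  simp only [Finset.mem_Iic] at *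
  exact ⟨fun t => by cases t <;> assumption, fun t => by cases t <;> assumption, a5⟩

/-- These constants do not involve `x`; to make them nonzero the parameters themselves have to move.
The sum of the twisted pair changes by `-2 s`. -/
theorem eventually_fwd_ne (hq₀ : 0 < S.q) (hq₁ : S.q < 1) (t : VType) (n : ℕ) :
    ∀ᶠ s in 𝓝[≠] (0 : ℂ), ((S.translate s).twist t).fwd t n ≠ 0 := by
  have hs : ∀ s, ((S.translate s).twist t).pairSum t + n - 1
      = (1 + n - S.pairSum t) + -2 * s := fun s => by
    rw [pairSum_twist]
    simp only [pairSum, translate, withLam_lam, withLam_pair]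
    ring
  have hk' : ∀ s, ((S.translate s).twist t).kind = S.kind := fun _ => rfl
  have h2 : (-2 : ℂ) ≠ 0 := by norm_num
  rcases hk : S.kind with _ | _ | _
  · filter_upwards [eventually_affine_ne (1 + n - S.pairSum t) h2] with s h
    simp only [fwd, hk', hk, hs]
    exact mul_ne_zero (neg_ne_zero.2 I_ne_zero) h
  · filter_upwards [eventually_affine_ne (1 + n - S.pairSum t) h2] with s h
    simp only [fwd, hk', hk, hs]
    exact mul_ne_zero (neg_ne_zero.2 I_ne_zero) h
  · have hl : (Real.log S.q : ℂ) ≠ 0 := by exact_mod_cast S.log_q_ne hq₀ hq₁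
    filter_upwards [eventually_one_sub_exp_ne ((Real.log S.q : ℂ) * (1 + n - S.pairSum t))
      (mul_ne_zero hl h2)] with s h
    simp only [fwd, hk', hk, hs]
    refine mul_ne_zero I_ne_zero fun h0 => h ?_
    have hq : ((S.translate s).twist t).q = S.q := rfl
    simp only [qbr, hq] at h0
    push_cast at h0
    generalize hu : 1 + n - S.pairSum t + -2 * s = u at h0
    have e1 : (Real.log S.q : ℂ) * (1 + n - S.pairSum t) + (Real.log S.q : ℂ) * -2 * s
        = (Real.log S.q : ℂ) / 2 * u + (Real.log S.q : ℂ) / 2 * u := by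
      rw [← hu]
      ring
    have e2 : Complex.exp (-((Real.log S.q : ℂ) / 2 * u))
        * Complex.exp ((Real.log S.q : ℂ) / 2 * u) = 1 := by
      rw [← Complex.exp_add]
      simp
    rw [e1, Complex.exp_add]
    linear_combination -e2 + Complex.exp ((Real.log S.q : ℂ) / 2 * u) * h0

theorem eventually_poch_ne (hq : 0 < S.q) (b y : ℂ) {e : ℝ} (he : e ≠ 0) (n : ℕ) :
    ∀ᶠ s in 𝓝[≠] (0 : ℂ), S.poch b (y + e * s) n ≠ 0 :=
  eventually_prod_ne _ fun i _ => by simpa using eventually_lin_ne hq (b + i) y 0 he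

theorem eventually_pairPoch_ne (hq : 0 < S.q) (t : VType) (b y : ℂ) (m n : ℕ) :
    ∀ᶠ s in 𝓝[≠] (0 : ℂ), S.pairPoch t b m n (y + s) ≠ 0 := by
  have h1 : ∀ b, ∀ᶠ s in 𝓝[≠] (0 : ℂ), S.poch b (y + s) m ≠ 0 := fun b => by
    simpa using eventually_poch_ne hq b y one_ne_zero m
  have h2 : ∀ b, ∀ᶠ s in 𝓝[≠] (0 : ℂ), S.poch b (-(y + s)) n ≠ 0 := fun b => by
    filter_upwards [eventually_poch_ne hq b (-y) (neg_ne_zero.2 one_ne_zero) n] with s hs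
    convert hs using 2
    push_cast
    ring
  rcases hk : S.kind with _ | _ | _ <;> simp only [pairPoch, hk]
  · exact eventually_mul_ne (h1 _) (h2 _)
  · exact eventually_mul_ne (eventually_mul_ne (h1 _) (h2 _)) (eventually_mul_ne (h1 _) (h2 _))
  · exact eventually_mul_ne (eventually_mul_ne (h1 _) (h2 _)) (eventually_mul_ne (h1 _) (h2 _))

theorem eventually_phiN_ne (N : ℕ) (y : ℂ) : ∀ᶠ s in 𝓝[≠] (0 : ℂ), S.phiN N (y + s) ≠ 0 := by
  refine eventually_mul_ne ?_ (eventually_prod_ne _ fun k _ => ?_)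
  · filter_upwards [eventually_phi_ne (S := S) y] with s hs using pow_ne_zero _ hs
  · filter_upwards [eventually_phi_ne (S := S) (y - I * k / 2 * S.gam),
      eventually_phi_ne (S := S) (y + I * k / 2 * S.gam)] with s h1 h2
    refine pow_ne_zero _ (mul_ne_zero ?_ ?_)
    · convert h1 using 2
      ring
    · convert h2 using 2
      ring

theorem normC_ne (hq : 0 < S.q) (t : VType) (j : ℕ) : S.normC t j ≠ 0 := by
  rcases hk : S.kind with _ | _ | _
  · simp [normC, hk]
  · simp [normC, hk]
  · simp only [normC, hk, S.cpow_q hq]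
    exact Complex.exp_ne_zero _

theorem eventually_normA_ne (hq : 0 < S.q) (N m₁ m₂ : ℕ) (y : ℂ) :
    ∀ᶠ s in 𝓝[≠] (0 : ℂ), S.normA N m₁ m₂ (y + s) ≠ 0 := by
  have h : ∀ t m, ∀ᶠ s in 𝓝[≠] (0 : ℂ), ∏ j ∈ Finset.Icc 1 m,
      S.normC t j * S.pairPoch t (-((N : ℂ) - 1) / 2) j j (y + s) ≠ 0 := fun t m =>
    eventually_prod_ne _ fun j _ => by
      filter_upwards [eventually_pairPoch_ne hq t (-((N : ℂ) - 1) / 2) y j j] with s hs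
      exact mul_ne_zero (normC_ne hq _ _) hs
  exact eventually_mul_ne (h _ _) (h _ _)

theorem eventually_XiDen_ne (hq : 0 < S.q) {M : ℕ} (D : Fin M → Label) (y : ℂ) :
    ∀ᶠ s in 𝓝[≠] (0 : ℂ), S.XiDen D (y + s) ≠ 0 :=
  eventually_mul_ne (eventually_phiN_ne _ _) (eventually_normA_ne hq _ _ _ _)

theorem eventually_PDen_ne (hq : 0 < S.q) {M : ℕ} (D : Fin M → Label) (y : ℂ) :
    ∀ᶠ s in 𝓝[≠] (0 : ℂ), S.PDen D (y + s) ≠ 0 :=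
  eventually_mul_ne (eventually_phiN_ne _ _) (eventually_normA_ne hq _ _ _ _)

end System

/-- Both parts of the proposition, for quotients as well as for polynomials, have this shape, so a
single passage to the limit serves all of them. -/
theorem ham_identity_of_eventually {c e F₁ F₂ G₁ G₂ Q v v' f₀ f₁ f₂ z₀ z₁ z₂ : ℂ → ℂ}
    (hc : ContinuousAt c 0) (he : ContinuousAt e 0) (hF₁ : ContinuousAt F₁ 0)
    (hF₂ : ContinuousAt F₂ 0) (hG₁ : ContinuousAt G₁ 0) (hG₂ : ContinuousAt G₂ 0)
    (hQ : ContinuousAt Q 0) (hv : ContinuousAt v 0) (hv' : ContinuousAt v' 0)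
    (hf₀ : ContinuousAt f₀ 0) (hf₁ : ContinuousAt f₁ 0) (hf₂ : ContinuousAt f₂ 0)
    (hz₀ : ContinuousAt z₀ 0) (hz₁ : ContinuousAt z₁ 0) (hz₂ : ContinuousAt z₂ 0)
    (nG₁ : G₁ 0 ≠ 0) (nG₂ : G₂ 0 ≠ 0) (nz₁ : z₁ 0 ≠ 0)
    (h : ∀ᶠ s in 𝓝[≠] (0 : ℂ), G₁ s ≠ 0 → G₂ s ≠ 0 → z₁ s ≠ 0 →
      c s * (F₂ s / G₂ s + F₁ s / G₁ s) * Q s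
        = v s * (G₁ s / G₂ s) * (f₂ s - z₂ s / z₁ s * f₁ s)
          + v' s * (G₂ s / G₁ s) * (f₀ s - z₀ s / z₁ s * f₁ s) + e s * f₁ s) :
    c 0 * (F₂ 0 / G₂ 0 + F₁ 0 / G₁ 0) * Q 0
        = v 0 * (G₁ 0 / G₂ 0) * (f₂ 0 - z₂ 0 / z₁ 0 * f₁ 0)
          + v' 0 * (G₂ 0 / G₁ 0) * (f₀ 0 - z₀ 0 / z₁ 0 * f₁ 0) + e 0 * f₁ 0 := by
  have n1 := (hG₁.eventually_ne nG₁).filter_mono (nhdsWithin_le_nhds (s := {0}ᶜ))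
  have n2 := (hG₂.eventually_ne nG₂).filter_mono (nhdsWithin_le_nhds (s := {0}ᶜ))
  have n3 := (hz₁.eventually_ne nz₁).filter_mono (nhdsWithin_le_nhds (s := {0}ᶜ))
  refine eq_of_eventually_eq
    (F := fun s => c s * (F₂ s / G₂ s + F₁ s / G₁ s) * Q s)
    (G := fun s => v s * (G₁ s / G₂ s) * (f₂ s - z₂ s / z₁ s * f₁ s)
      + v' s * (G₂ s / G₁ s) * (f₀ s - z₀ s / z₁ s * f₁ s) + e s * f₁ s) ?_ ?_ ?_
  · fun_prop (disch := assumption)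
  · fun_prop (disch := assumption)
  · filter_upwards [h, n1, n2, n3] with s hs a1 a2 a3 using hs a1 a2 a3

end Eventually

end

/-! ### The identities for the quotients at arbitrary admissible points. -/

noncomputable section

namespace System

section Limit

open Filter Topology

variable {S : System}

theorem continuousAt_translate_Xi (hq : 0 < S.q) {x : ℂ → ℂ} (hx : Continuous x) {M : ℕ}
    {D : Fin M → Label} (h : S.XiDen D (x 0) ≠ 0) :
    ContinuousAt (fun s => (S.translate s).Xi D (x s)) 0 :=
  continuousAt_Xi (f := fun s k => S.lam k + s) hq (by fun_prop) hx D
    (by simpa [withLam] using h)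

theorem continuousAt_translate_plusDelta_Xi (hq : 0 < S.q) {x : ℂ → ℂ} (hx : Continuous x) {M : ℕ}
    {D : Fin M → Label} (h : S.plusDelta.XiDen D (x 0) ≠ 0) :
    ContinuousAt (fun s => (S.translate s).plusDelta.Xi D (x s)) 0 :=
  continuousAt_Xi (f := fun s k => S.lam k + s + 1 / 2) hq (by fun_prop) hx D
    (by simpa [withLam, plusDelta] using h)

theorem continuousAt_translate_PD (hq : 0 < S.q) {x : ℂ → ℂ} (hx : Continuous x) {M : ℕ}
    {D : Fin M → Label} (n : ℕ) (h : S.PDen D (x 0) ≠ 0) :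
    ContinuousAt (fun s => (S.translate s).PD D n (x s)) 0 :=
  continuousAt_PD (f := fun s k => S.lam k + s) hq (by fun_prop) hx D n
    (by simpa [withLam] using h)

theorem continuousAt_translate_deform_V (hq : 0 < S.q) {x : ℂ} {M : ℕ} (D : Fin M → Label)
    (h : S.Vden x ≠ 0) : ContinuousAt (fun s => ((S.translate s).deform D).V (x + s)) 0 :=
  continuousAt_V (f := fun s k => S.lam k + s + count D .one * S.deltaTilde .one k
    + count D .two * S.deltaTilde .two k) hq (by fun_prop) (by fun_prop) (by simpa using h)

theorem continuousAt_translate_deform_Vstar (hq : 0 < S.q) {x : ℂ} {M : ℕ} (D : Fin M → Label)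
    (h : S.Vden (-x) ≠ 0) : ContinuousAt (fun s => ((S.translate s).deform D).Vstar (x + s)) 0 :=
  continuousAt_Vstar (f := fun s k => S.lam k + s + count D .one * S.deltaTilde .one k
    + count D .two * S.deltaTilde .two k) hq (by fun_prop) (by fun_prop) (by simpa using h)

/-- Division by zero yields zero, so assuming a quotient nonzero includes its denominator. -/
theorem XiDen_ne_of_Xi_ne {M : ℕ} {D : Fin M → Label} {x : ℂ} (h : S.Xi D x ≠ 0) :
    S.XiDen D x ≠ 0 := fun h0 => h (by rw [Xi, h0, div_zero])

theorem XiDen_addLabel {M : ℕ} (D : Fin M → Label) {d₁ d₂ : Label} (ht : d₁.2 = d₂.2) :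
    S.XiDen (addLabel D d₁) = S.XiDen (addLabel D d₂) := by
  funext x
  simp only [XiDen, count_addLabel, ht]

theorem PDen_addLabel {M : ℕ} (D : Fin M → Label) {d₁ d₂ : Label} (ht : d₁.2 = d₂.2) :
    S.PDen (addLabel D d₁) = S.PDen (addLabel D d₂) := by
  funext x
  simp only [PDen, count_addLabel, ht]

theorem exists_cen_eq (x : ℂ) (a N : ℕ) : ∃ y₀, ∀ s, S.cen (y₀ + s) a N = x + s :=
  ⟨x + I * (a + ((N : ℂ) - 1) / 2) * S.gam, fun s => by simp only [cen]; ring⟩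

/-- The generic identity holds at `λ + s`, `x + s` for small `s ≠ 0`. The hypotheses make every
quotient continuous at `s = 0`; those for `d₁` and `d₂` have the same denominators, because these
depend on types only. -/
theorem same_type_identity (hq₀ : 0 < S.q) (hq₁ : S.q < 1) {M : ℕ} (D : Fin M → Label)
    {d₁ d₂ : Label} (ht : d₁.2 = d₂.2) (n : ℕ) {x : ℂ} (hV : S.Vden x ≠ 0) (hV' : S.Vden (-x) ≠ 0)
    (hδ : S.plusDelta.XiDen (addLabel D d₂) (x - I * S.gam) ≠ 0)
    (hδ' : S.plusDelta.XiDen (addLabel D d₂) (x + I * S.gam) ≠ 0)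
    (hP : S.PDen (addLabel D d₁) x ≠ 0)
    (hPr : S.PDen (addLabel D d₁) (x - I * S.gam) ≠ 0)
    (hPl : S.PDen (addLabel D d₁) (x + I * S.gam) ≠ 0)
    (hΞr : S.Xi (addLabel D d₂) (x - I * S.gam / 2) ≠ 0)
    (hΞl : S.Xi (addLabel D d₂) (x + I * S.gam / 2) ≠ 0)
    (hΞδ : S.plusDelta.Xi (addLabel D d₂) x ≠ 0) :
    (S.energy n - S.virtEnergy d₁)
        * (S.Xi (addLabel D d₁) (x - I * S.gam / 2) / S.Xi (addLabel D d₂) (x - I * S.gam / 2)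
          + S.Xi (addLabel D d₁) (x + I * S.gam / 2) / S.Xi (addLabel D d₂) (x + I * S.gam / 2))
        * S.PD (addLabel D d₂) n x
      = S.ham (addLabel D d₂) (S.PD (addLabel D d₁) n) x
        + (S.energy n - S.virtEnergy d₁ - S.virtEnergy d₂) * S.PD (addLabel D d₁) n x := by
  have hr := XiDen_ne_of_Xi_ne hΞr
  have hl := XiDen_ne_of_Xi_ne hΞl
  have hr₁ := hr
  have hl₁ := hl
  have hP₂ := hP
  rw [← XiDen_addLabel D ht] at hr₁ hl₁
  rw [PDen_addLabel D ht] at hP₂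
  have hf : Continuous fun (s : ℂ) k => S.lam k + s := by fun_prop
  obtain ⟨y₀, hy⟩ := S.exists_cen_eq x 1 (M + 2)
  have key := ham_identity_of_eventually
    (c := fun s => (S.translate s).energy n - (S.translate s).virtEnergy d₁)
    (e := fun s => (S.translate s).energy n - (S.translate s).virtEnergy d₁
      - (S.translate s).virtEnergy d₂)
    (F₁ := fun s => (S.translate s).Xi (addLabel D d₁) (x + s + I * S.gam / 2))
    (F₂ := fun s => (S.translate s).Xi (addLabel D d₁) (x + s - I * S.gam / 2))
    (G₁ := fun s => (S.translate s).Xi (addLabel D d₂) (x + s + I * S.gam / 2))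
    (G₂ := fun s => (S.translate s).Xi (addLabel D d₂) (x + s - I * S.gam / 2))
    (Q := fun s => (S.translate s).PD (addLabel D d₂) n (x + s))
    (v := fun s => ((S.translate s).deform (addLabel D d₂)).V (x + s))
    (v' := fun s => ((S.translate s).deform (addLabel D d₂)).Vstar (x + s))
    (f₀ := fun s => (S.translate s).PD (addLabel D d₁) n (x + s + I * S.gam))
    (f₁ := fun s => (S.translate s).PD (addLabel D d₁) n (x + s))
    (f₂ := fun s => (S.translate s).PD (addLabel D d₁) n (x + s - I * S.gam))
    (z₀ := fun s => (S.translate s).plusDelta.Xi (addLabel D d₂) (x + s + I * S.gam))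
    (z₁ := fun s => (S.translate s).plusDelta.Xi (addLabel D d₂) (x + s))
    (z₂ := fun s => (S.translate s).plusDelta.Xi (addLabel D d₂) (x + s - I * S.gam))
    ((continuous_energy hq₀ hf n).sub (continuous_virtEnergy hq₀ hf d₁)).continuousAt
    (((continuous_energy hq₀ hf n).sub (continuous_virtEnergy hq₀ hf d₁)).sub
      (continuous_virtEnergy hq₀ hf d₂)).continuousAt
    (continuousAt_translate_Xi hq₀ (by fun_prop) (by simpa using hl₁))
    (continuousAt_translate_Xi hq₀ (by fun_prop) (by simpa using hr₁))
    (continuousAt_translate_Xi hq₀ (by fun_prop) (by simpa using hl))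
    (continuousAt_translate_Xi hq₀ (by fun_prop) (by simpa using hr))
    (continuousAt_translate_PD hq₀ (by fun_prop) n (by simpa using hP₂))
    (continuousAt_translate_deform_V hq₀ _ hV)
    (continuousAt_translate_deform_Vstar hq₀ _ hV')
    (continuousAt_translate_PD hq₀ (by fun_prop) n (by simpa using hPl))
    (continuousAt_translate_PD hq₀ (by fun_prop) n (by simpa using hP))
    (continuousAt_translate_PD hq₀ (by fun_prop) n (by simpa using hPr))
    (continuousAt_translate_plusDelta_Xi hq₀ (by fun_prop) (by simpa using hδ'))
    (continuousAt_translate_plusDelta_Xi hq₀ (by fun_prop)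
      (by simpa using XiDen_ne_of_Xi_ne hΞδ))
    (continuousAt_translate_plusDelta_Xi hq₀ (by fun_prop) (by simpa using hδ))
    (by simpa [translate_zero] using hΞl) (by simpa [translate_zero] using hΞr)
    (by simpa [translate_zero] using hΞδ) (by
      filter_upwards [eventually_isGeneric hq₀ y₀ (M + 6), (eventually_all (ι := Fin (M + 1))).2
        fun k => eventually_fwd_ne (S := S) hq₀ hq₁ (addLabel D d₂ k).2 (addLabel D d₂ k).1]
        with s hg hc n1 n2 n3
      exact same_type_of_isGeneric (S := S.translate s) hq₀ hq₁ D ht n hg hc (hy s).symm n2 n1 n3)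
  simp only [translate_zero, add_zero] at key
  exact key

theorem other_type_identity (hq₀ : 0 < S.q) (hq₁ : S.q < 1) {M : ℕ} (D : Fin M → Label)
    {d₁ d₂ : Label} (ht : d₁.2 ≠ d₂.2) (n : ℕ) {x : ℂ} (hV : S.Vden x ≠ 0) (hV' : S.Vden (-x) ≠ 0)
    (hDr : S.XiDen D (x - I * S.gam / 2) ≠ 0)
    (hDl : S.XiDen D (x + I * S.gam / 2) ≠ 0)
    (hδ : S.plusDelta.XiDen (addLabel (addLabel D d₁) d₂) (x - I * S.gam) ≠ 0)
    (hδ' : S.plusDelta.XiDen (addLabel (addLabel D d₁) d₂) (x + I * S.gam) ≠ 0)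
    (hPG : S.PDen (addLabel (addLabel D d₁) d₂) x ≠ 0)
    (hP : S.PDen D x ≠ 0)
    (hPr : S.PDen D (x - I * S.gam) ≠ 0)
    (hPl : S.PDen D (x + I * S.gam) ≠ 0)
    (hΞr : S.Xi (addLabel (addLabel D d₁) d₂) (x - I * S.gam / 2) ≠ 0)
    (hΞl : S.Xi (addLabel (addLabel D d₁) d₂) (x + I * S.gam / 2) ≠ 0)
    (hΞδ : S.plusDelta.Xi (addLabel (addLabel D d₁) d₂) x ≠ 0) :
    ((S.kappa ^ (2 * (M : ℝ) + 3 / 2) : ℝ) : ℂ) * S.sqrtAlpha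
        * (S.Xi D (x - I * S.gam / 2) / S.Xi (addLabel (addLabel D d₁) d₂) (x - I * S.gam / 2)
          + S.Xi D (x + I * S.gam / 2) / S.Xi (addLabel (addLabel D d₁) d₂) (x + I * S.gam / 2))
        * S.PD (addLabel (addLabel D d₁) d₂) n x
      = S.ham (addLabel (addLabel D d₁) d₂) (S.PD D n) x
        + (S.energy n - S.virtEnergy d₁ - S.virtEnergy d₂) * S.PD D n x := by
  set G := addLabel (addLabel D d₁) d₂ with hG
  have hf : Continuous fun (s : ℂ) k => S.lam k + s := by fun_prop
  obtain ⟨y₀, hy⟩ := S.exists_cen_eq x 1 (M + 3)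
  have key := ham_identity_of_eventually
    (c := fun s => ((S.kappa ^ (2 * (M : ℝ) + 3 / 2) : ℝ) : ℂ) * (S.translate s).sqrtAlpha)
    (e := fun s => (S.translate s).energy n - (S.translate s).virtEnergy d₁
      - (S.translate s).virtEnergy d₂)
    (F₁ := fun s => (S.translate s).Xi D (x + s + I * S.gam / 2))
    (F₂ := fun s => (S.translate s).Xi D (x + s - I * S.gam / 2))
    (G₁ := fun s => (S.translate s).Xi G (x + s + I * S.gam / 2))
    (G₂ := fun s => (S.translate s).Xi G (x + s - I * S.gam / 2))
    (Q := fun s => (S.translate s).PD G n (x + s))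
    (v := fun s => ((S.translate s).deform G).V (x + s))
    (v' := fun s => ((S.translate s).deform G).Vstar (x + s))
    (f₀ := fun s => (S.translate s).PD D n (x + s + I * S.gam))
    (f₁ := fun s => (S.translate s).PD D n (x + s))
    (f₂ := fun s => (S.translate s).PD D n (x + s - I * S.gam))
    (z₀ := fun s => (S.translate s).plusDelta.Xi G (x + s + I * S.gam))
    (z₁ := fun s => (S.translate s).plusDelta.Xi G (x + s))
    (z₂ := fun s => (S.translate s).plusDelta.Xi G (x + s - I * S.gam))
    (continuous_const.mul (continuous_sqrtAlpha hq₀ hf)).continuousAt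
    (((continuous_energy hq₀ hf n).sub (continuous_virtEnergy hq₀ hf d₁)).sub
      (continuous_virtEnergy hq₀ hf d₂)).continuousAt
    (continuousAt_translate_Xi hq₀ (by fun_prop) (by simpa using hDl))
    (continuousAt_translate_Xi hq₀ (by fun_prop) (by simpa using hDr))
    (continuousAt_translate_Xi hq₀ (by fun_prop) (by simpa using XiDen_ne_of_Xi_ne hΞl))
    (continuousAt_translate_Xi hq₀ (by fun_prop) (by simpa using XiDen_ne_of_Xi_ne hΞr))
    (continuousAt_translate_PD hq₀ (by fun_prop) n (by simpa using hPG))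
    (continuousAt_translate_deform_V hq₀ _ hV)
    (continuousAt_translate_deform_Vstar hq₀ _ hV')
    (continuousAt_translate_PD hq₀ (by fun_prop) n (by simpa using hPl))
    (continuousAt_translate_PD hq₀ (by fun_prop) n (by simpa using hP))
    (continuousAt_translate_PD hq₀ (by fun_prop) n (by simpa using hPr))
    (continuousAt_translate_plusDelta_Xi hq₀ (by fun_prop) (by simpa using hδ'))
    (continuousAt_translate_plusDelta_Xi hq₀ (by fun_prop)
      (by simpa using XiDen_ne_of_Xi_ne hΞδ))
    (continuousAt_translate_plusDelta_Xi hq₀ (by fun_prop) (by simpa using hδ))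
    (by simpa [translate_zero] using hΞl) (by simpa [translate_zero] using hΞr)
    (by simpa [translate_zero] using hΞδ) (by
      filter_upwards [eventually_isGeneric hq₀ y₀ (M + 6), (eventually_all (ι := Fin (M + 2))).2
        fun k => eventually_fwd_ne (S := S) hq₀ hq₁ (G k).2 (G k).1] with s hg hc n1 n2 n3
      exact other_type_of_isGeneric (S := S.translate s) hq₀ hq₁ D ht n hg hc (hy s).symm n2 n1 n3)
  simp only [translate_zero, add_zero] at key
  exact key

theorem Xi_eq_check {M : ℕ} {D : Fin M → Label} {p : ℂ[X]} (hp : S.IsXiPoly D p) {x : ℂ}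
    (h : S.XiDen D x ≠ 0) : S.Xi D x = S.check p x := by
  rw [Xi, ← hp x, mul_div_cancel_left₀ _ h, check]

theorem PD_eq_check {M : ℕ} {D : Fin M → Label} {n : ℕ} {p : ℂ[X]} (hp : S.IsPDPoly D n p) {x : ℂ}
    (h : S.PDen D x ≠ 0) : S.PD D n x = S.check p x := by
  rw [PD, ← hp x, mul_div_cancel_left₀ _ h, check]

theorem continuous_check (p : ℂ[X]) : Continuous (S.check p) := by
  have h : Continuous fun x => S.eta x := by
    rcases hk : S.kind with _ | _ | _ <;> simp only [eta, hk] <;> fun_prop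
  exact p.continuous.comp h

theorem continuous_Vden : Continuous fun x => S.Vden x := by
  rcases hk : S.kind with _ | _ | _ <;> simp only [Vden, hk] <;> fun_prop

theorem continuousAt_check_add (p : ℂ[X]) {x : ℂ → ℂ} (hx : Continuous x) :
    ContinuousAt (fun s => S.check p (x s)) 0 :=
  ((continuous_check p).comp hx).continuousAt

theorem eventually_XiDen_add_ne (hq : 0 < S.q) {M : ℕ} (D : Fin M → Label) (x w : ℂ) :
    ∀ᶠ s in 𝓝[≠] (0 : ℂ), S.XiDen D (x + s + w) ≠ 0 ∧ S.XiDen D (x + s - w) ≠ 0 := by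
  filter_upwards [eventually_XiDen_ne hq D (x + w), eventually_XiDen_ne hq D (x - w)] with s h1 h2
  exact ⟨by convert h1 using 2; ring, by convert h2 using 2; ring⟩

theorem eventually_PDen_add_ne (hq : 0 < S.q) {M : ℕ} (D : Fin M → Label) (x w : ℂ) :
    ∀ᶠ s in 𝓝[≠] (0 : ℂ), S.PDen D (x + s + w) ≠ 0 ∧ S.PDen D (x + s - w) ≠ 0 := by
  filter_upwards [eventually_PDen_ne hq D (x + w), eventually_PDen_ne hq D (x - w)] with s h1 h2
  exact ⟨by convert h1 using 2; ring, by convert h2 using 2; ring⟩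

theorem eventually_Vden_ne {x : ℂ} (hV : S.Vden x ≠ 0) (hV' : S.Vden (-x) ≠ 0) :
    ∀ᶠ s in 𝓝[≠] (0 : ℂ), S.Vden (x + s) ≠ 0 ∧ S.Vden (-(x + s)) ≠ 0 := by
  have h1 : ContinuousAt (fun s => S.Vden (x + s)) 0 :=
    (continuous_Vden.comp (by fun_prop : Continuous fun s : ℂ => x + s)).continuousAt
  have h2 : ContinuousAt (fun s => S.Vden (-(x + s))) 0 :=
    (continuous_Vden.comp (by fun_prop : Continuous fun s : ℂ => -(x + s))).continuousAt
  exact ((h1.eventually_ne (by simpa using hV)).and (h2.eventually_ne (by simpa using hV'))).filter_mono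
    nhdsWithin_le_nhds

end Limit

end System

end

/-! ### The identities for the polynomials. -/

noncomputable section

namespace System

section Check

open Filter Topology

variable {S : System}

/-- Here only `x` moves. Polynomials in `η` are continuous everywhere, so only the displayed
denominators and those of the potentials must be nonzero at `x`. -/
theorem check_identity_of_eventually (hq : 0 < S.q) {M : ℕ} (D : Fin M → Label) {c e : ℂ}
    {F G Gδ P Q : ℂ[X]} {x : ℂ} (hV : S.Vden x ≠ 0) (hV' : S.Vden (-x) ≠ 0)
    (hr : S.check G (x - I * S.gam / 2) ≠ 0) (hl : S.check G (x + I * S.gam / 2) ≠ 0)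
    (hδ : S.check Gδ x ≠ 0)
    (h : ∀ᶠ s in 𝓝[≠] (0 : ℂ), S.Vden (x + s) ≠ 0 → S.Vden (-(x + s)) ≠ 0 →
      S.check G (x + s - I * S.gam / 2) ≠ 0 → S.check G (x + s + I * S.gam / 2) ≠ 0 →
      S.check Gδ (x + s) ≠ 0 →
      c * (S.check F (x + s - I * S.gam / 2) / S.check G (x + s - I * S.gam / 2)
          + S.check F (x + s + I * S.gam / 2) / S.check G (x + s + I * S.gam / 2))
          * S.check Q (x + s)
        = S.hamWith D (S.check G) (S.check Gδ) (S.check P) (x + s) + e * S.check P (x + s)) :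
    c * (S.check F (x - I * S.gam / 2) / S.check G (x - I * S.gam / 2)
        + S.check F (x + I * S.gam / 2) / S.check G (x + I * S.gam / 2)) * S.check Q x
      = S.hamWith D (S.check G) (S.check Gδ) (S.check P) x + e * S.check P x := by
  have key := ham_identity_of_eventually (c := fun _ => c) (e := fun _ => e)
    (v := fun s => (S.deform D).V (x + s)) (v' := fun s => (S.deform D).Vstar (x + s))
    continuousAt_const continuousAt_const
    (continuousAt_check_add (S := S) F (x := fun s => x + s + I * S.gam / 2) (by fun_prop))
    (continuousAt_check_add (S := S) F (x := fun s => x + s - I * S.gam / 2) (by fun_prop))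
    (continuousAt_check_add (S := S) G (x := fun s => x + s + I * S.gam / 2) (by fun_prop))
    (continuousAt_check_add (S := S) G (x := fun s => x + s - I * S.gam / 2) (by fun_prop))
    (continuousAt_check_add (S := S) Q (x := fun s => x + s) (by fun_prop))
    (continuousAt_V (S := S) (f := fun _ => (S.deform D).lam) hq (by fun_prop) (by fun_prop)
      (by simpa using hV))
    (continuousAt_Vstar (S := S) (f := fun _ => (S.deform D).lam) hq (by fun_prop) (by fun_prop)
      (by simpa using hV'))
    (continuousAt_check_add (S := S) P (x := fun s => x + s + I * S.gam) (by fun_prop))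
    (continuousAt_check_add (S := S) P (x := fun s => x + s) (by fun_prop))
    (continuousAt_check_add (S := S) P (x := fun s => x + s - I * S.gam) (by fun_prop))
    (continuousAt_check_add (S := S) Gδ (x := fun s => x + s + I * S.gam) (by fun_prop))
    (continuousAt_check_add (S := S) Gδ (x := fun s => x + s) (by fun_prop))
    (continuousAt_check_add (S := S) Gδ (x := fun s => x + s - I * S.gam) (by fun_prop))
    (by simpa using hl) (by simpa using hr) (by simpa using hδ) (by
      filter_upwards [h, eventually_Vden_ne hV hV'] with s hs hv n1 n2 n3
      exact hs hv.1 hv.2 n2 n1 n3)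
  simp only [add_zero] at key
  exact key

theorem ham_eq_hamWith_check {M : ℕ} {D : Fin M → Label} {G Gδ P : ℂ[X]} {f : ℂ → ℂ} {x : ℂ}
    (hG : S.IsXiPoly D G) (hGδ : S.plusDelta.IsXiPoly D Gδ)
    (hr : S.XiDen D (x - I * S.gam / 2) ≠ 0) (hl : S.XiDen D (x + I * S.gam / 2) ≠ 0)
    (hδ : S.plusDelta.XiDen D x ≠ 0) (hδr : S.plusDelta.XiDen D (x - I * S.gam) ≠ 0)
    (hδl : S.plusDelta.XiDen D (x + I * S.gam) ≠ 0)
    (hf : f x = S.check P x) (hfr : f (x - I * S.gam) = S.check P (x - I * S.gam))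
    (hfl : f (x + I * S.gam) = S.check P (x + I * S.gam)) :
    S.ham D f x = S.hamWith D (S.check G) (S.check Gδ) (S.check P) x := by
  simp only [ham, hamWith, Xi_eq_check hG hr, Xi_eq_check hG hl, Xi_eq_check hGδ hδ,
    Xi_eq_check hGδ hδr, Xi_eq_check hGδ hδl, hf, hfr, hfl]
  rfl

/-- The elementary denominators are nonzero at all points near but different from `x`, whatever
happens at `x`. There the polynomials agree with the quotients and `same_type_identity` applies. -/
theorem same_type_check_identity (hq₀ : 0 < S.q) (hq₁ : S.q < 1) {M : ℕ} (D : Fin M → Label)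
    {d₁ d₂ : Label} (ht : d₁.2 = d₂.2) (n : ℕ) {Ξ₁ Ξ₂ Ξδ₂ P₁ P₂ : ℂ[X]}
    (h₁ : S.IsXiPoly (addLabel D d₁) Ξ₁) (h₂ : S.IsXiPoly (addLabel D d₂) Ξ₂)
    (hδ₂ : S.plusDelta.IsXiPoly (addLabel D d₂) Ξδ₂)
    (hP₁ : S.IsPDPoly (addLabel D d₁) n P₁) (hP₂ : S.IsPDPoly (addLabel D d₂) n P₂)
    {x : ℂ} (hV : S.Vden x ≠ 0) (hV' : S.Vden (-x) ≠ 0)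
    (hr : S.check Ξ₂ (x - I * S.gam / 2) ≠ 0) (hl : S.check Ξ₂ (x + I * S.gam / 2) ≠ 0)
    (hδ : S.check Ξδ₂ x ≠ 0) :
    (S.energy n - S.virtEnergy d₁)
        * (S.check Ξ₁ (x - I * S.gam / 2) / S.check Ξ₂ (x - I * S.gam / 2)
          + S.check Ξ₁ (x + I * S.gam / 2) / S.check Ξ₂ (x + I * S.gam / 2))
        * S.check P₂ x
      = S.hamWith (addLabel D d₂) (S.check Ξ₂) (S.check Ξδ₂) (S.check P₁) x
        + (S.energy n - S.virtEnergy d₁ - S.virtEnergy d₂) * S.check P₁ x := by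
  refine check_identity_of_eventually hq₀ _ hV hV' hr hl hδ ?_
  filter_upwards [eventually_XiDen_add_ne hq₀ (addLabel D d₂) x (I * S.gam / 2),
    eventually_XiDen_ne (S := S.plusDelta) hq₀ (addLabel D d₂) x,
    eventually_XiDen_add_ne (S := S.plusDelta) hq₀ (addLabel D d₂) x (I * S.gam),
    eventually_PDen_ne hq₀ (addLabel D d₁) x,
    eventually_PDen_add_ne hq₀ (addLabel D d₁) x (I * S.gam)]
    with s a1 a2 a3 a4 a5 v v' nr nl nδ
  have b1 := a1
  have b4 := a4
  rw [← XiDen_addLabel D ht] at b1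
  rw [PDen_addLabel D ht] at b4
  have key := same_type_identity hq₀ hq₁ D ht n v v' a3.2 a3.1 a4 a5.2 a5.1
    (by rwa [Xi_eq_check h₂ a1.2]) (by rwa [Xi_eq_check h₂ a1.1])
    (by rw [Xi_eq_check hδ₂ a2]; exact nδ)
  rwa [ham_eq_hamWith_check h₂ hδ₂ a1.2 a1.1 a2 a3.2 a3.1 (PD_eq_check hP₁ a4)
    (PD_eq_check hP₁ a5.2) (PD_eq_check hP₁ a5.1), Xi_eq_check h₁ b1.1, Xi_eq_check h₁ b1.2,
    Xi_eq_check h₂ a1.1, Xi_eq_check h₂ a1.2, PD_eq_check hP₁ a4, PD_eq_check hP₂ b4] at key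

theorem other_type_check_identity (hq₀ : 0 < S.q) (hq₁ : S.q < 1) {M : ℕ} (D : Fin M → Label)
    {d₁ d₂ : Label} (ht : d₁.2 ≠ d₂.2) (n : ℕ) {Ξ Ξ₃ Ξδ₃ P P₃ : ℂ[X]}
    (h₁ : S.IsXiPoly D Ξ) (h₃ : S.IsXiPoly (addLabel (addLabel D d₁) d₂) Ξ₃)
    (hδ₃ : S.plusDelta.IsXiPoly (addLabel (addLabel D d₁) d₂) Ξδ₃)
    (hP : S.IsPDPoly D n P) (hP₃ : S.IsPDPoly (addLabel (addLabel D d₁) d₂) n P₃)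
    {x : ℂ} (hV : S.Vden x ≠ 0) (hV' : S.Vden (-x) ≠ 0)
    (hr : S.check Ξ₃ (x - I * S.gam / 2) ≠ 0) (hl : S.check Ξ₃ (x + I * S.gam / 2) ≠ 0)
    (hδ : S.check Ξδ₃ x ≠ 0) :
    ((S.kappa ^ (2 * (M : ℝ) + 3 / 2) : ℝ) : ℂ) * S.sqrtAlpha
        * (S.check Ξ (x - I * S.gam / 2) / S.check Ξ₃ (x - I * S.gam / 2)
          + S.check Ξ (x + I * S.gam / 2) / S.check Ξ₃ (x + I * S.gam / 2))
        * S.check P₃ x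
      = S.hamWith (addLabel (addLabel D d₁) d₂) (S.check Ξ₃) (S.check Ξδ₃) (S.check P) x
        + (S.energy n - S.virtEnergy d₁ - S.virtEnergy d₂) * S.check P x := by
  refine check_identity_of_eventually hq₀ _ hV hV' hr hl hδ ?_
  filter_upwards [eventually_XiDen_add_ne hq₀ (addLabel (addLabel D d₁) d₂) x (I * S.gam / 2),
    eventually_XiDen_add_ne hq₀ D x (I * S.gam / 2),
    eventually_XiDen_ne (S := S.plusDelta) hq₀ (addLabel (addLabel D d₁) d₂) x,
    eventually_XiDen_add_ne (S := S.plusDelta) hq₀ (addLabel (addLabel D d₁) d₂) x (I * S.gam),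
    eventually_PDen_ne hq₀ (addLabel (addLabel D d₁) d₂) x,
    eventually_PDen_ne hq₀ D x, eventually_PDen_add_ne hq₀ D x (I * S.gam)]
    with s a1 b1 a2 a3 b4 a4 a5 v v' nr nl nδ
  have key := other_type_identity hq₀ hq₁ D ht n v v' b1.2 b1.1 a3.2 a3.1 b4 a4 a5.2 a5.1
    (by rwa [Xi_eq_check h₃ a1.2]) (by rwa [Xi_eq_check h₃ a1.1])
    (by rw [Xi_eq_check hδ₃ a2]; exact nδ)
  rwa [ham_eq_hamWith_check h₃ hδ₃ a1.2 a1.1 a2 a3.2 a3.1 (PD_eq_check hP a4)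
    (PD_eq_check hP a5.2) (PD_eq_check hP a5.1), Xi_eq_check h₁ b1.1, Xi_eq_check h₁ b1.2,
    Xi_eq_check h₃ a1.1, Xi_eq_check h₃ a1.2, PD_eq_check hP a4, PD_eq_check hP₃ b4] at key

end Check

end System

end

theorem mainTheorem3 (S : System) (hq₀ : 0 < S.q) (hq₁ : S.q < 1)
    {M : ℕ} (D : Fin M → Label) (hD : Function.Injective D)
    (d₁ d₂ : Label) (hd₁ : ∀ k, D k ≠ d₁) (hd₂ : ∀ k, D k ≠ d₂) (hne : d₁ ≠ d₂) (n : ℕ) :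
    -- the case of equal types
    (d₁.2 = d₂.2 →
      (∀ x : ℂ, S.Vden x ≠ 0 → S.Vden (-x) ≠ 0 →
        S.plusDelta.XiDen (addLabel D d₂) (x - I * S.gam) ≠ 0 →
        S.plusDelta.XiDen (addLabel D d₂) (x + I * S.gam) ≠ 0 →
        S.PDen (addLabel D d₁) x ≠ 0 →
        S.PDen (addLabel D d₁) (x - I * S.gam) ≠ 0 →
        S.PDen (addLabel D d₁) (x + I * S.gam) ≠ 0 →
        S.Xi (addLabel D d₂) (x - I * S.gam / 2) ≠ 0 →
        S.Xi (addLabel D d₂) (x + I * S.gam / 2) ≠ 0 →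
        S.plusDelta.Xi (addLabel D d₂) x ≠ 0 →
        (S.energy n - S.virtEnergy d₁)
            * (S.Xi (addLabel D d₁) (x - I * S.gam / 2) / S.Xi (addLabel D d₂) (x - I * S.gam / 2)
              + S.Xi (addLabel D d₁) (x + I * S.gam / 2) / S.Xi (addLabel D d₂) (x + I * S.gam / 2))
            * S.PD (addLabel D d₂) n x
          = S.ham (addLabel D d₂) (S.PD (addLabel D d₁) n) x
            + (S.energy n - S.virtEnergy d₁ - S.virtEnergy d₂) * S.PD (addLabel D d₁) n x) ∧
      (∀ Ξ₁ Ξ₂ Ξδ₂ P₁ P₂ : Polynomial ℂ,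
        S.IsXiPoly (addLabel D d₁) Ξ₁ → S.IsXiPoly (addLabel D d₂) Ξ₂ →
        S.plusDelta.IsXiPoly (addLabel D d₂) Ξδ₂ →
        S.IsPDPoly (addLabel D d₁) n P₁ → S.IsPDPoly (addLabel D d₂) n P₂ →
        ∀ x : ℂ, S.Vden x ≠ 0 → S.Vden (-x) ≠ 0 →
        S.check Ξ₂ (x - I * S.gam / 2) ≠ 0 → S.check Ξ₂ (x + I * S.gam / 2) ≠ 0 →
        S.check Ξδ₂ x ≠ 0 →
        (S.energy n - S.virtEnergy d₁)
            * (S.check Ξ₁ (x - I * S.gam / 2) / S.check Ξ₂ (x - I * S.gam / 2)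
              + S.check Ξ₁ (x + I * S.gam / 2) / S.check Ξ₂ (x + I * S.gam / 2))
            * S.check P₂ x
          = S.hamWith (addLabel D d₂) (S.check Ξ₂) (S.check Ξδ₂) (S.check P₁) x
            + (S.energy n - S.virtEnergy d₁ - S.virtEnergy d₂) * S.check P₁ x)) ∧
    -- the case of different types
    (d₁.2 ≠ d₂.2 →
      (∀ x : ℂ, S.Vden x ≠ 0 → S.Vden (-x) ≠ 0 →
        S.XiDen D (x - I * S.gam / 2) ≠ 0 →
        S.XiDen D (x + I * S.gam / 2) ≠ 0 →
        S.plusDelta.XiDen (addLabel (addLabel D d₁) d₂) (x - I * S.gam) ≠ 0 →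
        S.plusDelta.XiDen (addLabel (addLabel D d₁) d₂) (x + I * S.gam) ≠ 0 →
        S.PDen (addLabel (addLabel D d₁) d₂) x ≠ 0 →
        S.PDen D x ≠ 0 →
        S.PDen D (x - I * S.gam) ≠ 0 →
        S.PDen D (x + I * S.gam) ≠ 0 →
        S.Xi (addLabel (addLabel D d₁) d₂) (x - I * S.gam / 2) ≠ 0 →
        S.Xi (addLabel (addLabel D d₁) d₂) (x + I * S.gam / 2) ≠ 0 →
        S.plusDelta.Xi (addLabel (addLabel D d₁) d₂) x ≠ 0 →
        ((S.kappa ^ (2 * (M : ℝ) + 3 / 2) : ℝ) : ℂ) * S.sqrtAlpha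
            * (S.Xi D (x - I * S.gam / 2)
                / S.Xi (addLabel (addLabel D d₁) d₂) (x - I * S.gam / 2)
              + S.Xi D (x + I * S.gam / 2)
                / S.Xi (addLabel (addLabel D d₁) d₂) (x + I * S.gam / 2))
            * S.PD (addLabel (addLabel D d₁) d₂) n x
          = S.ham (addLabel (addLabel D d₁) d₂) (S.PD D n) x
            + (S.energy n - S.virtEnergy d₁ - S.virtEnergy d₂) * S.PD D n x) ∧
      (∀ Ξ Ξ₃ Ξδ₃ P P₃ : Polynomial ℂ,
        S.IsXiPoly D Ξ → S.IsXiPoly (addLabel (addLabel D d₁) d₂) Ξ₃ →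
        S.plusDelta.IsXiPoly (addLabel (addLabel D d₁) d₂) Ξδ₃ →
        S.IsPDPoly D n P → S.IsPDPoly (addLabel (addLabel D d₁) d₂) n P₃ →
        ∀ x : ℂ, S.Vden x ≠ 0 → S.Vden (-x) ≠ 0 →
        S.check Ξ₃ (x - I * S.gam / 2) ≠ 0 → S.check Ξ₃ (x + I * S.gam / 2) ≠ 0 →
        S.check Ξδ₃ x ≠ 0 →
        ((S.kappa ^ (2 * (M : ℝ) + 3 / 2) : ℝ) : ℂ) * S.sqrtAlpha
            * (S.check Ξ (x - I * S.gam / 2) / S.check Ξ₃ (x - I * S.gam / 2)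
              + S.check Ξ (x + I * S.gam / 2) / S.check Ξ₃ (x + I * S.gam / 2))
            * S.check P₃ x
          = S.hamWith (addLabel (addLabel D d₁) d₂) (S.check Ξ₃) (S.check Ξδ₃) (S.check P) x
            + (S.energy n - S.virtEnergy d₁ - S.virtEnergy d₂) * S.check P x)) := ⟨fun ht => ⟨fun _ hV hV' hδ hδ' hP hPr hPl hΞr hΞl hΞδ =>
      System.same_type_identity hq₀ hq₁ D ht n hV hV' hδ hδ' hP hPr hPl hΞr hΞl hΞδ,
    fun _ _ _ _ _ h₁ h₂ hδ₂ hP₁ hP₂ _ hV hV' hr hl hδ =>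
      System.same_type_check_identity hq₀ hq₁ D ht n h₁ h₂ hδ₂ hP₁ hP₂ hV hV' hr hl hδ⟩,
  fun ht => ⟨fun _ hV hV' hDr hDl hδ hδ' hPG hP hPr hPl hΞr hΞl hΞδ =>
      System.other_type_identity hq₀ hq₁ D ht n hV hV' hDr hDl hδ hδ' hPG hP hPr hPl hΞr hΞl hΞδ,
    fun _ _ _ _ _ h₁ h₃ hδ₃ hP hP₃ _ hV hV' hr hl hδ =>
      System.other_type_check_identity hq₀ hq₁ D ht n h₁ h₃ hδ₃ hP hP₃ hV hV' hr hl hδ⟩⟩
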